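/- All manifolds, bundles, sections and functions are smooth (C^∞), real and finite-dimensional. A *Loday algebroid* $(E,\mathfrak a,\rho,\lambda)$ over a manifold $M$ is a vector bundle $E\to M$ with bundle maps $\rho\colon E\to TM$ (anchor) and $\lambda\colon T^*M\otimes E\otimes E\to E$ (co-anchor) and an $\mathbb R$-bilinear bracket $\mathfrak a=[\cdot,\cdot]$ on $\Gamma(E)$ such that, for all $\alpha,\beta,\gamma\in\Gamma(E)$ and $f\in C^\infty(M)$, $$[\alpha,f\beta]=f[\alpha,\beta]+(\rho(\alpha)f)\beta,\qquad [f\alpha,\beta]=f[\alpha,\beta]-(\rho(\beta)f)\alpha+\lambda(df\otimes\alpha\otimes\beta),$$ $$[[\alpha,\beta],\gamma]+[\beta,[\alpha,\gamma]]=[\alpha,[\beta,\gamma]].$$ Without the last identity it is called an *almost* Loday algebroid. It is a *Lie algebroid* if $[\alpha,\beta]=-[\beta,\alpha]$ for all $\alpha,\beta$. It is a *Courant algebroid* if $E$ carries a fibrewise nondegenerate symmetric pairing $\langle\cdot,\cdot\rangle$ (of any signature) with $\rho(\alpha)\langle\beta,\gamma\rangle=\langle[\alpha,\beta],\gamma\rangle+\langle\beta,[\alpha,\gamma]\rangle$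 and $[\alpha,\beta]+[\beta,\alpha]=\rho^*d\langle\alpha,\beta\rangle$, where $\rho^*\colon T^*M\to E^*\cong E$ is the transpose of $\rho$. Let $p\in M$ be a point where $\rho$ and $\lambda$ vanish (for Lie and Courant algebroids, $\rho_p=0$ implies $\lambda_p=0$). Let $(x_i)$ be coordinates of $M$ and $(e_i)$ a frame of $E$ around $p$, and write $[e_i,e_j]=\sum_k\Gamma_{ij}^k e_k$, $\rho(e_i)=\sum_j\theta_{ij}\,\partial_{x_j}$, $\lambda(dx_i\otimes e_j\otimes e_k)=\sum_l\lambda_{ijk}^l e_l$. The linear parts $$\mathfrak a^L\colon E_p\otimes E_p\to E_p,\qquad \rho^L\colon E_p\to\operatorname{End}(T_pM),\qquad \lambda^L\colon T_p^*M\otimes E_p\otimes E_p\to\operatorname{Hom}(T_pM,E_p)$$ are given by $\mathfrak a^L(e_i(p),e_j(p))=\sum_k\Gamma_{ij}^k(p)e_k(p)$, $\rho^L(e_i(p))x=\sum_{j,k}\partial_{x_k}\theta_{ij}(p)\,x_k\,\partial_{x_j}|_p$ and $\lambda^L(dx_i,e_j(p),e_k(p))x=\sum_{l,m}\partial_{x_m}\lambda^l_{ijk}(p)\,x_m\,e_l(p)$;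 they do not depend on the choices. The *linearization* of $E$ at $p$ is the trivial bundle $T_pM\times E_p\to T_pM$ with anchor $(x,u)\mapsto\rho^L(u)x$, co-anchor $(\xi\otimes u\otimes w)_x\mapsto\lambda^L(\xi,u,w)x$, and the bracket that is $\mathfrak a^L$ on constant sections and is extended to all sections by the two Leibniz rules. $E$ is *linearizable around $p$* if there are open neighbourhoods $U$ of $p$ in $M$ and $U'$ of $0$ in $T_pM$, a diffeomorphism $\varphi\colon U\to U'$ with $\varphi(p)=0$, and a vector bundle isomorphism $E|_U\to U'\times E_p$ covering $\varphi$ that intertwines brackets, anchors and co-anchors. **Corollary.** Let $(E,\mathfrak a,\rho)$ be a Lie algebroid or a Courant algebroid over $M$ whose anchor vanishes at $p\in M$. Let $\mathfrak g=(E_p,\mathfrak a^L)$, which is a Lie algebra, and $\rho^L\colon\mathfrak g\to\operatorname{End}(T_pM)$. If there exists $v$ in the center of $\mathfrak g$ such that $\rho^L(v)=\mathrm{id}_{T_pM}$, then $E$ is linearizable around $p$. -/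

import Mathlib

open Bundle Filter Topology Module
open scoped Manifold ContDiff

noncomputable section

set_option linter.unusedSectionVars false

section Algebroids

variable {B : Type*} [NormedAddCommGroup B] [NormedSpace ℝ B]
  {M : Type*} [TopologicalSpace M] [ChartedSpace B M] [IsManifold 𝓘(ℝ, B) ∞ M]
  {F : Type*} [NormedAddCommGroup F] [NormedSpace ℝ F]
  {V : M → Type*} [TopologicalSpace (TotalSpace F V)] [∀ x, TopologicalSpace (V x)]
  [∀ x, AddCommGroup (V x)] [∀ x, Module ℝ (V x)] [FiberBundle F V] [VectorBundle ℝ F V]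

/-- The space of smooth sections of the vector bundle `V`. -/
abbrev SmoothSection (B F : Type*) [NormedAddCommGroup B] [NormedSpace ℝ B]
    [NormedAddCommGroup F] [NormedSpace ℝ F]
    {M : Type*} [TopologicalSpace M] [ChartedSpace B M]
    (V : M → Type*) [TopologicalSpace (TotalSpace F V)] [∀ x, TopologicalSpace (V x)]
    [FiberBundle F V] : Type _ :=
  ContMDiffSection 𝓘(ℝ, B) F ∞ V

/-- The smooth real functions on `M`. -/
abbrev SmoothFun (B : Type*) [NormedAddCommGroup B] [NormedSpace ℝ B]
    (M : Type*) [TopologicalSpace M] [ChartedSpace B M] : Type _ :=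
  C^∞⟮𝓘(ℝ, B), M; 𝓘(ℝ, ℝ), ℝ⟯

/-- The tangent space `T_x M`. -/
abbrev Tan (B : Type*) [NormedAddCommGroup B] [NormedSpace ℝ B]
    {M : Type*} [TopologicalSpace M] [ChartedSpace B M] (x : M) : Type _ :=
  TangentSpace 𝓘(ℝ, B) x

/-- The cotangent space `T_x^* M`. -/
abbrev Cotan (B : Type*) [NormedAddCommGroup B] [NormedSpace ℝ B]
    {M : Type*} [TopologicalSpace M] [ChartedSpace B M] (x : M) : Type _ :=
  Tan B x →L[ℝ] ℝ

/-- The differential `df` at the point `x`, as a covector. -/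
def differential (f : M → ℝ) (x : M) : Cotan B x := mfderiv 𝓘(ℝ, B) 𝓘(ℝ, ℝ) f x

/-- The product `f s` of a smooth function with a smooth section. -/
def SmoothFun.smulSection (f : SmoothFun B M) (s : SmoothSection B F V) : SmoothSection B F V :=
  ⟨fun x => f x • s x, f.contMDiff.smul_section s.contMDiff⟩

variable (B F V) in
/-- An almost Loday algebroid structure on the smooth vector bundle `V` (model fibre `F`) over the
manifold `M` (modelled on `B`): an `ℝ`-bilinear bracket on the space of smooth sections, a smooth
bundle map `ρ : E → TM` (the anchor) and a smooth bundle map `λ : T*M ⊗ E ⊗ E → E` (the co-anchor)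
with `[α, f β] = f [α, β] + (ρ(α) f) β` and
`[f α, β] = f [α, β] - (ρ(β) f) α + λ(df ⊗ α ⊗ β)`.
The bundle map `λ` is given as a fibrewise trilinear map; since exact one-forms span every
cotangent space, it is smooth iff `λ(df ⊗ α ⊗ β)` is a smooth section for all smooth `f, α, β`. -/
structure AlmostLodayAlgebroid where
  /-- The bracket `𝔞 : Γ(E) × Γ(E) → Γ(E)`. -/
  bracket : SmoothSection B F V →ₗ[ℝ] SmoothSection B F V →ₗ[ℝ] SmoothSection B F V
  /-- The anchor `ρ : E → TM`. -/
  anchor : ∀ x : M, V x →ₗ[ℝ] Tan B x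
  /-- The co-anchor `λ : T*M ⊗ E ⊗ E → E`. -/
  coanchor : ∀ x : M, Cotan B x →ₗ[ℝ] V x →ₗ[ℝ] V x →ₗ[ℝ] V x
  smooth_anchor : ContMDiff (𝓘(ℝ, B).prod 𝓘(ℝ, F)) (𝓘(ℝ, B).prod 𝓘(ℝ, B)) ∞
    (fun e : TotalSpace F V => (⟨e.1, anchor e.1 e.2⟩ : TangentBundle 𝓘(ℝ, B) M))
  smooth_coanchor : ∀ (f : SmoothFun B M) (α β : SmoothSection B F V),
    ContMDiff 𝓘(ℝ, B) (𝓘(ℝ, B).prod 𝓘(ℝ, F)) ∞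
      (fun x => (⟨x, coanchor x (differential f x) (α x) (β x)⟩ : TotalSpace F V))
  leibniz_right : ∀ (α β : SmoothSection B F V) (f : SmoothFun B M) (x : M),
    bracket α (f.smulSection β) x =
      f x • bracket α β x + differential (B := B) f x (anchor x (α x)) • β x
  leibniz_left : ∀ (α β : SmoothSection B F V) (f : SmoothFun B M) (x : M),
    bracket (f.smulSection α) β x =
      f x • bracket α β x - differential (B := B) f x (anchor x (β x)) • α x
        + coanchor x (differential f x) (α x) (β x)

variable (B F V) in
/-- A Loday algebroid: an almost Loday algebroid whose Jacobiator
`[[α, β], γ] + [β, [α, γ]] - [α, [β, γ]]` vanishes. -/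
structure LodayAlgebroid extends AlmostLodayAlgebroid B F V where
  jacobi : ∀ α β γ : SmoothSection B F V,
    bracket (bracket α β) γ + bracket β (bracket α γ) - bracket α (bracket β γ) = 0

namespace LodayAlgebroid

/-- Lie algebroids: the bracket is skew-symmetric. -/
def IsLie (A : LodayAlgebroid B F V) : Prop :=
  ∀ α β : SmoothSection B F V, A.bracket α β + A.bracket β α = 0

/-- A pairing that makes the Loday algebroid `A` a Courant algebroid: a smooth, fibrewise
nondegenerate, symmetric bilinear form (of any signature) on `E` that is preserved by the bracket,
`ρ(α)⟨β, γ⟩ = ⟨[α, β], γ⟩ + ⟨β, [α, γ]⟩`, and such that `[α, β] + [β, α] = ρ^* d⟨α, β⟩`. Here `ρ^*`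
is the transpose of the anchor under `E ≅ E^*`, i.e. `⟨ρ^* ξ, e⟩ = ξ(ρ(e))`; by nondegeneracy the
last equation may be tested against all `e`. -/
structure CourantPairing (A : LodayAlgebroid B F V) where
  pair : ∀ x : M, V x →ₗ[ℝ] V x →ₗ[ℝ] ℝ
  symm : ∀ x u w, pair x u w = pair x w u
  nondegenerate : ∀ x u, (∀ w, pair x u w = 0) → u = 0
  smooth : ∀ α β : SmoothSection B F V,
    ContMDiff 𝓘(ℝ, B) 𝓘(ℝ, ℝ) ∞ (fun x => pair x (α x) (β x))
  invariant : ∀ (α β γ : SmoothSection B F V) (x : M),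
    differential (B := B) (fun y => pair y (β y) (γ y)) x (A.anchor x (α x)) =
      pair x (A.bracket α β x) (γ x) + pair x (β x) (A.bracket α γ x)
  symmetrization : ∀ (α β : SmoothSection B F V) (x : M) (e : V x),
    pair x (A.bracket α β x + A.bracket β α x) e =
      differential (B := B) (fun y => pair y (α y) (β y)) x (A.anchor x e)

/-- Courant algebroids. -/
def IsCourant (A : LodayAlgebroid B F V) : Prop := Nonempty A.CourantPairing

end LodayAlgebroid

/-! ### Linear parts at a point -/

section Extension

variable [FiniteDimensional ℝ B] [T2Space M]
  [ContMDiffVectorBundle ∞ F V 𝓘(ℝ, B)]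


variable (B F V) in
lemma exists_bump (p : M) : ∃ χ : SmoothBumpFunction 𝓘(ℝ, B) p,
    tsupport χ ⊆ (trivializationAt F V p).baseSet := by
  obtain ⟨χ, h⟩ := (SmoothBumpFunction.nhds_basis_support (I := 𝓘(ℝ, B)) (c := p)
    ((trivializationAt F V p).open_baseSet.mem_nhds
      (mem_baseSet_trivializationAt F V p))).ex_mem
  exact ⟨χ, h⟩

variable (B F V) in
/-- A smooth bump function, equal to `1` near `p`, supported in the domains of the preferred chart
and of the preferred trivialization at `p`. -/
def bump (p : M) : SmoothBumpFunction 𝓘(ℝ, B) p := (exists_bump B F V p).choose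

variable (B F V) in
lemma tsupport_bump (p : M) : tsupport (bump B F V p) ⊆ (trivializationAt F V p).baseSet :=
  (exists_bump B F V p).choose_spec

variable (B F V) in
/-- The smooth section that, near `p`, is constant equal to `w : F` in the preferred trivialization
at `p` (it is cut off by a bump function). As `w` runs through a basis of `F` these are the members
of a local frame around `p`. -/
def frameSection (p : M) : F →ₗ[ℝ] SmoothSection B F V where
  toFun w := ⟨fun q => bump B F V p q • (trivializationAt F V p).symmₗ ℝ q w, by
    refine ContMDiffOn.smul_section_of_tsupport (ψ := bump B F V p)
      (s := fun q => (trivializationAt F V p).symmₗ ℝ q w)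
      (bump B F V p).contMDiff.contMDiffOn (trivializationAt F V p).open_baseSet
      (tsupport_bump B F V p) ?_
    rw [Trivialization.contMDiffOn_section_baseSet_iff]
    refine (contMDiffOn_const (c := w)).congr fun x hx => ?_
    rw [Trivialization.symmₗ_apply _ hx, Trivialization.apply_mk_symm _ hx]⟩
  map_add' u w := by ext q; exact (congrArg _ (map_add _ u w)).trans (smul_add _ _ _)
  map_smul' c w := by ext q; exact (congrArg _ (map_smul _ c w)).trans (smul_comm _ _ _)

lemma frameSection_apply (p q : M) (w : F) :
    frameSection B F V p w q = bump B F V p q • (trivializationAt F V p).symmₗ ℝ q w := rfl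

variable (B F V) in
/-- The smooth section that takes the value `v` at `p` and, near `p`, is constant in the preferred
trivialization at `p`. -/
def extSection (p : M) : V p →ₗ[ℝ] SmoothSection B F V :=
  (frameSection B F V p).comp (VectorBundle.continuousLinearEquivAt ℝ F V p).toLinearMap

@[simp] lemma extSection_self (p : M) (v : V p) : extSection B F V p v p = v := by
  have h := FiberBundle.mem_baseSet_trivializationAt' (F := F) (E := V) p
  have h1 : extSection B F V p v p =
    bump B F V p p • (trivializationAt F V p).symmₗ ℝ p
      (VectorBundle.continuousLinearEquivAt ℝ F V p v) := rfl
  rw [h1, SmoothBumpFunction.eq_one, one_smul]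
  exact (VectorBundle.continuousLinearEquivAt ℝ F V p).symm_apply_apply v ▸ by
    simp [Trivialization.symmₗ_apply, h]

variable (B) in
/-- The smooth function that, near `p`, is the affine function `ξ(x - x(p))` in the preferred chart
`x` at `p` (under which `T_p M = B`); its differential at `p` is `ξ`. For `ξ = dx_i` this is the
coordinate function `x_i`, up to an additive constant. -/
def extFun (p : M) : Cotan B p →ₗ[ℝ] SmoothFun B M where
  toFun ξ := ⟨fun q => bump B B (TangentSpace 𝓘(ℝ, B) : M → Type _) p q •
      ξ (extChartAt 𝓘(ℝ, B) p q - extChartAt 𝓘(ℝ, B) p p : B), by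
    refine SmoothBumpFunction.contMDiff_smul _ ?_
    have h1 : ContMDiffOn 𝓘(ℝ, B) 𝓘(ℝ, B) ∞ (extChartAt 𝓘(ℝ, B) p) (chartAt B p).source :=
      contMDiffOn_extChartAt
    let L : B →L[ℝ] ℝ := ξ
    exact L.contMDiff.comp_contMDiffOn (h1.sub contMDiffOn_const)⟩
  map_add' ξ η := by ext q; exact mul_add _ _ _
  map_smul' c ξ := by ext q; exact mul_left_comm _ _ _


lemma mdifferentiableAt_section_coord (p : M) (s : SmoothSection B F V) :
    MDifferentiableAt 𝓘(ℝ, B) 𝓘(ℝ, F) (fun q => (trivializationAt F V p ⟨q, s q⟩).2) p :=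
  ((contMDiffAt_section p).1 (s.contMDiff p)).mdifferentiableAt (by simp)

variable (B F V) in
/-- The linear part at `p` of a smooth section `s`: the derivative `T_p M → E_p` at `p` of the
components of `s` in the preferred trivialization at `p`. It is independent of the choice of the
trivialization if `s p = 0`. For the tangent bundle and a vector field `X` vanishing at `p` this is
the linearization `X^L : T_p M → T_p M`. -/
def sectionLinearPart (p : M) : SmoothSection B F V →ₗ[ℝ] Tan B p →ₗ[ℝ] V p where
  toFun s := (VectorBundle.continuousLinearEquivAt ℝ F V p).symm.toLinearMap.comp
    (mfderiv 𝓘(ℝ, B) 𝓘(ℝ, F) (fun q => (trivializationAt F V p ⟨q, s q⟩).2) p).toLinearMap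
  map_add' s t := by
    have h : (fun q => (trivializationAt F V p ⟨q, (s + t) q⟩).2) =ᶠ[𝓝 p]
        (fun q => (trivializationAt F V p ⟨q, s q⟩).2) +
          fun q => (trivializationAt F V p ⟨q, t q⟩).2 := by
      filter_upwards [(trivializationAt F V p).open_baseSet.mem_nhds
        (mem_baseSet_trivializationAt F V p)] with q hq
      exact ((trivializationAt F V p).linear ℝ hq).1 (s q) (t q)
    have h2 := (h.mfderiv_eq (I := 𝓘(ℝ, B)) (I' := 𝓘(ℝ, F))).trans
      (mfderiv_add (mdifferentiableAt_section_coord p s) (mdifferentiableAt_section_coord p t))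
    ext w
    exact (congrArg (fun T : B →L[ℝ] F =>
      (VectorBundle.continuousLinearEquivAt ℝ F V p).symm (T w)) h2).trans (map_add _ _ _)
  map_smul' c s := by
    have h : (fun q => (trivializationAt F V p ⟨q, (c • s) q⟩).2) =ᶠ[𝓝 p]
        c • (fun q => (trivializationAt F V p ⟨q, s q⟩).2) := by
      filter_upwards [(trivializationAt F V p).open_baseSet.mem_nhds
        (mem_baseSet_trivializationAt F V p)] with q hq
      exact ((trivializationAt F V p).linear ℝ hq).2 c (s q)
    have h2 := (h.mfderiv_eq (I := 𝓘(ℝ, B)) (I' := 𝓘(ℝ, F))).trans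
      (const_smul_mfderiv (mdifferentiableAt_section_coord p s) c)
    ext w
    exact (congrArg (fun T : B →L[ℝ] F =>
      (VectorBundle.continuousLinearEquivAt ℝ F V p).symm (T w)) h2).trans (map_smul _ _ _)

end Extension

namespace AlmostLodayAlgebroid

/-- The vector field `ρ(α)` of a section `α`. -/
def anchorSection (A : AlmostLodayAlgebroid B F V) :
    SmoothSection B F V →ₗ[ℝ] SmoothSection B B (TangentSpace 𝓘(ℝ, B) : M → Type _) where
  toFun α := ⟨fun x => A.anchor x (α x), A.smooth_anchor.comp α.contMDiff⟩
  map_add' α β := by ext x; exact map_add (A.anchor x) (α x) (β x)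
  map_smul' c α := by ext x; exact map_smul (A.anchor x) c (α x)

lemma differential_add (f g : SmoothFun B M) (x : M) :
    differential (f + g) x = differential f x + differential (B := B) g x := by
  have hf : MDifferentiableAt 𝓘(ℝ, B) 𝓘(ℝ, ℝ) f x := f.contMDiff.mdifferentiable (by simp) x
  have hg : MDifferentiableAt 𝓘(ℝ, B) 𝓘(ℝ, ℝ) g x := g.contMDiff.mdifferentiable (by simp) x
  exact mfderiv_add hf hg

lemma differential_smul (c : ℝ) (f : SmoothFun B M) (x : M) :
    differential (c • f) x = c • differential (B := B) f x := by
  have hf : MDifferentiableAt 𝓘(ℝ, B) 𝓘(ℝ, ℝ) f x := f.contMDiff.mdifferentiable (by simp) x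
  exact const_smul_mfderiv hf c

/-- The section `λ(df ⊗ α ⊗ β)`. -/
def coanchorSection (A : AlmostLodayAlgebroid B F V) :
    SmoothFun B M →ₗ[ℝ] SmoothSection B F V →ₗ[ℝ] SmoothSection B F V →ₗ[ℝ]
      SmoothSection B F V where
  toFun f := LinearMap.mk₂ ℝ
    (fun α β => ⟨fun x => A.coanchor x (differential f x) (α x) (β x), A.smooth_coanchor f α β⟩)
    (fun α α' β => by
      ext x; exact LinearMap.map_add₂ (A.coanchor x (differential f x)) (α x) (α' x) (β x))
    (fun c α β => by
      ext x; exact LinearMap.map_smul₂ (A.coanchor x (differential f x)) c (α x) (β x))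
    (fun α β β' => by
      ext x; exact map_add (A.coanchor x (differential f x) (α x)) (β x) (β' x))
    (fun c α β => by
      ext x; exact map_smul (A.coanchor x (differential f x) (α x)) c (β x))
  map_add' f g := by
    ext α β x
    change A.coanchor x (differential (⇑(f + g)) x) (α x) (β x) = _
    rw [differential_add, map_add]; rfl
  map_smul' c f := by
    ext α β x
    change A.coanchor x (differential (⇑(c • f)) x) (α x) (β x) = _
    rw [differential_smul, map_smul]; rfl

section LinearPart

variable [FiniteDimensional ℝ B] [T2Space M] [ContMDiffVectorBundle ∞ F V 𝓘(ℝ, B)]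

/-- `ρ^L : E_p → End(T_p M)`, `ρ^L(u) x = ∑ⱼ (∑ₖ ∂ₖ θⱼ(p) xₖ) ∂ⱼ` if `ρ(e) = ∑ⱼ θⱼ ∂ⱼ` for the frame
section `e` with `e(p) = u`. -/
def linearAnchor (A : AlmostLodayAlgebroid B F V) (p : M) : V p →ₗ[ℝ] Module.End ℝ (Tan B p) :=
  (sectionLinearPart B B (TangentSpace 𝓘(ℝ, B) : M → Type _) p).comp
    (A.anchorSection.comp (extSection B F V p))

/-- `𝔞^L : E_p × E_p → E_p`, `𝔞^L(u, w) = [e, e'](p)` for the frame sections `e`, `e'` with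
`e(p) = u`, `e'(p) = w`. -/
def linearBracket (A : AlmostLodayAlgebroid B F V) (p : M) : V p →ₗ[ℝ] V p →ₗ[ℝ] V p :=
  (A.bracket.compl₁₂ (extSection B F V p) (extSection B F V p)).compr₂
    { toFun := fun s => s p, map_add' := fun _ _ => rfl, map_smul' := fun _ _ => rfl }

/-- `λ^L : T_p^*M × E_p × E_p → Hom(T_p M, E_p)`: the linear part at `p` of the section
`λ(dx_ξ ⊗ e ⊗ e')` for the coordinate form `dx_ξ` with value `ξ` at `p` and the frame sections `e`,
`e'` with `e(p) = u`, `e'(p) = w`. -/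
def linearCoanchor (A : AlmostLodayAlgebroid B F V) (p : M) :
    Cotan B p →ₗ[ℝ] V p →ₗ[ℝ] V p →ₗ[ℝ] Tan B p →ₗ[ℝ] V p where
  toFun ξ := ((A.coanchorSection (extFun B p ξ)).compl₁₂
    (extSection B F V p) (extSection B F V p)).compr₂ (sectionLinearPart B F V p)
  map_add' ξ η := by ext; simp
  map_smul' c ξ := by ext; simp

end LinearPart

end AlmostLodayAlgebroid

section Tensorial

variable [FiniteDimensional ℝ B] [FiniteDimensional ℝ F] [T2Space M]
  [ContMDiffVectorBundle ∞ F V 𝓘(ℝ, B)]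

lemma differential_extFun (p : M) (ξ : Cotan B p) : differential (extFun B p ξ) p = ξ := by
  let L : B →L[ℝ] ℝ := ξ
  have h : (extFun B p ξ : M → ℝ) =ᶠ[𝓝 p] fun q =>
      L (extChartAt 𝓘(ℝ, B) p q - extChartAt 𝓘(ℝ, B) p p) := by
    filter_upwards [(bump B B (TangentSpace 𝓘(ℝ, B) : M → Type _) p).eventuallyEq_one] with q hq
    change (bump B B (TangentSpace 𝓘(ℝ, B) : M → Type _) p q : ℝ) * L _ = L _
    rw [hq]; exact one_mul _
  have hd : HasMFDerivAt 𝓘(ℝ, B) 𝓘(ℝ, ℝ) (extFun B p ξ : M → ℝ) p ξ := by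
    refine HasMFDerivAt.congr_of_eventuallyEq ?_ h
    refine ⟨?_, ?_⟩
    · exact L.continuous.continuousAt.comp
        ((continuousAt_extChartAt (I := 𝓘(ℝ, B)) p).sub continuousAt_const)
    · refine HasFDerivWithinAt.congr_of_eventuallyEq
        (f := fun y => L (y - extChartAt 𝓘(ℝ, B) p p)) ?_ ?_ (by simp only [writtenInExtChartAt, Function.comp,
          PartialEquiv.left_inv _ (mem_extChartAt_source (I := 𝓘(ℝ, B)) p)]; rfl)
      · have h1 : HasFDerivAt (fun y : B => y - extChartAt 𝓘(ℝ, B) p p)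
            (ContinuousLinearMap.id ℝ B) (extChartAt 𝓘(ℝ, B) p p) :=
          (hasFDerivAt_id _).sub_const _
        exact (L.hasFDerivAt.comp _ h1).hasFDerivWithinAt
      · refine mem_nhdsWithin_of_mem_nhds ?_
        filter_upwards [extChartAt_target_mem_nhds (I := 𝓘(ℝ, B)) p] with y hy
        simp only [writtenInExtChartAt, Function.comp]
        rw [(extChartAt 𝓘(ℝ, B) p).right_inv hy]; rfl
  exact hd.mfderiv

/-- A linear map on sections that is `C^∞(M)`-linear over evaluation at `p` vanishes on sections
that vanish at `p`. -/
lemma eq_zero_of_tensorial {W : Type*} [AddCommGroup W] [Module ℝ W] {p : M}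
    (T : SmoothSection B F V →ₗ[ℝ] W)
    (hT : ∀ (f : SmoothFun B M) (α : SmoothSection B F V), T (f.smulSection α) = f p • T α)
    (α : SmoothSection B F V) (hα : α p = 0) : T α = 0 := by
  set e := trivializationAt F V p with he
  set χ := bump B F V p with hχ
  let b := finBasis ℝ F
  let χ' : SmoothFun B M := ⟨fun q => χ q * χ q, χ.contMDiff.mul χ.contMDiff⟩
  have hsm : ∀ i, ContMDiff 𝓘(ℝ, B) 𝓘(ℝ, ℝ) ∞
      (fun q => χ q • b.coord i (e ⟨q, α q⟩).2) := by
    intro i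
    refine contMDiff_of_tsupport fun q hq => ?_
    have hq' : q ∈ e.baseSet := tsupport_bump B F V p (tsupport_smul_subset_left _ _ hq)
    have h1 : ContMDiffAt 𝓘(ℝ, B) 𝓘(ℝ, F) ∞ (fun q => (e ⟨q, α q⟩).2) q :=
      (e.contMDiffAt_section_iff hq').1 (α.contMDiff q)
    have h2 : ContMDiff 𝓘(ℝ, F) 𝓘(ℝ, ℝ) ∞ (b.coord i).toContinuousLinearMap :=
      (b.coord i).toContinuousLinearMap.contMDiff
    exact χ.contMDiffAt.smul (h2.contMDiffAt.comp q h1)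
  let c : Fin (finrank ℝ F) → SmoothFun B M := fun i => ⟨_, hsm i⟩
  have key : χ'.smulSection α = ∑ i, (c i).smulSection (frameSection B F V p (b i)) := by
    ext q
    have h0 : (∑ i, (c i).smulSection (frameSection B F V p (b i)) : SmoothSection B F V) q =
        ∑ i, (χ q • b.coord i (e ⟨q, α q⟩).2) • (χ q • e.symmₗ ℝ q (b i)) := by
      have := map_sum (ContMDiffSection.coeAddHom 𝓘(ℝ, B) F ∞ V)
        (fun i => (c i).smulSection (frameSection B F V p (b i))) Finset.univ
      exact (congrFun this q).trans (Finset.sum_apply _ _ _)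
    rw [h0]
    change (χ q * χ q) • α q = _
    by_cases hq : q ∈ e.baseSet
    · have h3 : α q = e.symmₗ ℝ q (e ⟨q, α q⟩).2 := by
        rw [Trivialization.symmₗ_apply _ hq, e.symm_apply_apply_mk hq]
      conv_lhs => rw [h3, ← b.sum_repr (e ⟨q, α q⟩).2, map_sum, Finset.smul_sum]
      refine Finset.sum_congr rfl fun i _ => ?_
      rw [map_smul, smul_smul, smul_smul]
      congr 1
      simp only [Basis.coord_apply, smul_eq_mul]; ring
    · have : χ q = 0 := by
        by_contra h
        exact hq (tsupport_bump B F V p (subset_tsupport _ h))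
      simp [this]
  have h1 : T (χ'.smulSection α) = T α := by
    rw [hT]
    change (χ p * χ p) • T α = _
    rw [hχ, SmoothBumpFunction.eq_one]; simp
  rw [← h1, key, map_sum]
  refine Finset.sum_eq_zero fun i _ => ?_
  rw [hT]
  have : c i p = 0 := by
    change χ p • b.coord i (e ⟨p, α p⟩).2 = 0
    rw [hα]
    have : (e (⟨p, 0⟩ : TotalSpace F V)).2 = 0 := by
      have := e.zeroSection ℝ (mem_baseSet_trivializationAt F V p)
      exact congrArg Prod.snd this
    rw [this]; simp
  rw [this, zero_smul]

end Tensorial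

namespace LodayAlgebroid

variable [FiniteDimensional ℝ B] [FiniteDimensional ℝ F] [T2Space M]
  [ContMDiffVectorBundle ∞ F V 𝓘(ℝ, B)]

lemma symmetrization_apply (A : LodayAlgebroid B F V) (hA : A.IsLie ∨ A.IsCourant) {p : M}
    (hp : ∀ e : V p, A.anchor p e = 0) (α β : SmoothSection B F V) :
    A.bracket α β p + A.bracket β α p = 0 := by
  rcases hA with h | ⟨⟨g⟩⟩
  · exact congrArg (fun s : SmoothSection B F V => s p) (h α β)
  · refine g.nondegenerate p _ fun w => ?_
    rw [g.symmetrization, hp, map_zero]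

/-- `𝔞^L` does not depend on the choice of extensions: `[α, β](p) = 𝔞^L(α(p), β(p))`. -/
lemma bracket_apply (A : LodayAlgebroid B F V) (hA : A.IsLie ∨ A.IsCourant) {p : M}
    (hp : ∀ e : V p, A.anchor p e = 0) (α β : SmoothSection B F V) :
    A.bracket α β p = A.linearBracket p (α p) (β p) := by
  let ev : SmoothSection B F V →ₗ[ℝ] V p :=
    { toFun := fun s => s p, map_add' := fun _ _ => rfl, map_smul' := fun _ _ => rfl }
  have hr : ∀ α β : SmoothSection B F V, β p = 0 → A.bracket α β p = 0 := fun α β hβ =>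
    eq_zero_of_tensorial (ev.comp (A.bracket α)) (fun f β => by
      change A.bracket α (f.smulSection β) p = f p • A.bracket α β p
      rw [A.leibniz_right, hp, map_zero, zero_smul, add_zero]) β hβ
  have hl : ∀ α β : SmoothSection B F V, α p = 0 → A.bracket α β p = 0 := fun α β hα => by
    have := A.symmetrization_apply hA hp α β
    rwa [hr β α hα, add_zero] at this
  have h1 := hl (α - extSection B F V p (α p)) β
    ((congrArg (fun t => α p - t) (extSection_self p (α p))).trans (sub_self _))
  have h2 := hr (extSection B F V p (α p)) (β - extSection B F V p (β p))
    ((congrArg (fun t => β p - t) (extSection_self p (β p))).trans (sub_self _))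
  rw [map_sub, LinearMap.sub_apply] at h1
  rw [map_sub] at h2
  exact (sub_eq_zero.1 h1).trans (sub_eq_zero.1 h2)

lemma linearBracket_jacobi (A : LodayAlgebroid B F V) (hA : A.IsLie ∨ A.IsCourant) {p : M}
    (hp : ∀ e : V p, A.anchor p e = 0) (u v w : V p) :
    A.linearBracket p u (A.linearBracket p v w) =
      A.linearBracket p (A.linearBracket p u v) w +
        A.linearBracket p v (A.linearBracket p u w) := by
  have h := congrArg (fun s : SmoothSection B F V => s p)
    (A.jacobi (extSection B F V p u) (extSection B F V p v) (extSection B F V p w))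
  have h' : A.bracket (A.bracket (extSection B F V p u) (extSection B F V p v))
        (extSection B F V p w) p +
      A.bracket (extSection B F V p v)
        (A.bracket (extSection B F V p u) (extSection B F V p w)) p -
      A.bracket (extSection B F V p u)
        (A.bracket (extSection B F V p v) (extSection B F V p w)) p = 0 := h
  simp only [A.bracket_apply hA hp, extSection_self] at h'
  exact (sub_eq_zero.1 h').symm

/-- The isotropy Lie algebra `𝔤 = (E_p, 𝔞^L)` of a Lie or Courant algebroid at a point `p` where the
anchor vanishes. -/
def Isotropy (A : LodayAlgebroid B F V) (_hA : A.IsLie ∨ A.IsCourant) (p : M)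
    (_hp : ∀ e : V p, A.anchor p e = 0) : Type _ := V p

section Isotropy

variable (A : LodayAlgebroid B F V) (hA : A.IsLie ∨ A.IsCourant) (p : M)
  (hp : ∀ e : V p, A.anchor p e = 0)

instance : AddCommGroup (A.Isotropy hA p hp) := inferInstanceAs (AddCommGroup (V p))

instance : Module ℝ (A.Isotropy hA p hp) := inferInstanceAs (Module ℝ (V p))

instance : LieRing (A.Isotropy hA p hp) where
  bracket u w := A.linearBracket p u w
  add_lie u v w := LinearMap.map_add₂ (A.linearBracket p) u v w
  lie_add u v w := map_add (A.linearBracket p u) v w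
  lie_self u := by
    have h := A.symmetrization_apply hA hp (extSection B F V p u) (extSection B F V p u)
    have h2 : (2 : ℝ) • A.linearBracket p u u = 0 := by rw [two_smul]; exact h
    exact (smul_eq_zero.1 h2).resolve_left two_ne_zero
  leibniz_lie u v w := A.linearBracket_jacobi hA hp u v w

instance : LieAlgebra ℝ (A.Isotropy hA p hp) where
  lie_smul c u v := map_smul (A.linearBracket p u) c v

/-- `ρ^L` as a linear map `𝔤 → End(T_p M)`. -/
def isotropyAction : A.Isotropy hA p hp →ₗ[ℝ] Module.End ℝ (Tan B p) := A.linearAnchor p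

end Isotropy

end LodayAlgebroid

end Algebroids

/-! ### Linear Loday algebroids on `B × F → B` -/

section LinearModel

variable {B F : Type*} [NormedAddCommGroup B] [NormedSpace ℝ B] [FiniteDimensional ℝ B]
  [NormedAddCommGroup F] [NormedSpace ℝ F] [FiniteDimensional ℝ F]

lemma contDiff_linear_apply {E G : Type*} [NormedAddCommGroup E] [NormedSpace ℝ E]
    [FiniteDimensional ℝ E] [NormedAddCommGroup G] [NormedSpace ℝ G]
    (T : B → E →ₗ[ℝ] G) (hT : ∀ e, ContDiff ℝ ∞ fun x => T x e) {f : B → E}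
    (hf : ContDiff ℝ ∞ f) : ContDiff ℝ ∞ fun x => T x (f x) := by
  let b := finBasis ℝ E
  have h : (fun x => T x (f x)) = fun x => ∑ i, b.coord i (f x) • T x (b i) := by
    ext x
    conv_lhs => rw [← b.sum_repr (f x), map_sum]
    simp
  rw [h]
  refine ContDiff.sum fun i _ => ContDiff.smul ?_ (hT _)
  exact (b.coord i).toContinuousLinearMap.contDiff.comp hf

lemma contDiff_linear_apply_prod (T : F →ₗ[ℝ] B →ₗ[ℝ] B) :
    ContDiff ℝ ∞ fun z : B × F => T z.2 z.1 := by
  let S : F →ₗ[ℝ] B →L[ℝ] B := LinearMap.toContinuousLinearMap.toLinearMap.comp T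
  exact (S.toContinuousLinearMap.contDiff.comp contDiff_snd).clm_apply contDiff_fst

lemma contDiff_section (s : SmoothSection B F (Trivial B F)) : ContDiff ℝ ∞ (fun x => (s x : F)) := by
  rw [← contMDiff_iff_contDiff]
  intro x
  exact (contMDiffAt_section x).1 (s.contMDiff x)

/-- A smooth map `B → F` as a section of the trivial bundle. -/
def sectionOfContDiff (f : B → F) (hf : ContDiff ℝ ∞ f) : SmoothSection B F (Trivial B F) :=
  ⟨f, fun x => (contMDiffAt_section x).2 hf.contMDiff.contMDiffAt⟩

variable (aL : F →ₗ[ℝ] F →ₗ[ℝ] F) (rL : F →ₗ[ℝ] B →ₗ[ℝ] B)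
  (lL : (B →L[ℝ] ℝ) →ₗ[ℝ] F →ₗ[ℝ] F →ₗ[ℝ] B →ₗ[ℝ] F)

/-- For `D = ∑ᵢ Dᵢ ⊗ eᵢ : B → F` with covectors `Dᵢ` and the basis `(eᵢ)` of `F`, the vector
`∑ᵢ λ^L(Dᵢ, eᵢ, b) x`. -/
def linearModelContraction (D : B →L[ℝ] F) (b : F) (x : B) : F :=
  ∑ i, lL (((finBasis ℝ F).coord i).toContinuousLinearMap.comp D) (finBasis ℝ F i) b x

/-- The extension of `𝔞^L` from constant sections to all sections `α, β : B → F` that is forced by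
the Leibniz rules: for `α = ∑ᵢ αᵢ eᵢ`, with `ρ(u)_x = ρ^L(u) x` and `λ(ξ, u, w)_x = λ^L(ξ, u, w) x`,
`[α, β] = 𝔞^L(α, β) + dβ(ρ(α)) - dα(ρ(β)) + ∑ᵢ λ(dαᵢ, eᵢ, β)`. -/
def linearModelBracketFun (α β : B → F) (x : B) : F :=
  aL (α x) (β x) + fderiv ℝ β x (rL (α x) x) - fderiv ℝ α x (rL (β x) x)
    + linearModelContraction lL (fderiv ℝ α x) (β x) x

lemma contDiff_linearModelBracketFun {α β : B → F} (hα : ContDiff ℝ ∞ α) (hβ : ContDiff ℝ ∞ β) :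
    ContDiff ℝ ∞ (linearModelBracketFun aL rL lL α β) := by
  have hr : ∀ {γ : B → F}, ContDiff ℝ ∞ γ → ContDiff ℝ ∞ fun x => rL (γ x) x := fun hγ =>
    contDiff_linear_apply (fun x => rL.flip x) (fun e => (rL e).toContinuousLinearMap.contDiff) hγ
  have hd : ∀ {γ : B → F}, ContDiff ℝ ∞ γ → ContDiff ℝ ∞ (fderiv ℝ γ) := fun hγ =>
    hγ.fderiv_right (by simp)
  refine ContDiff.add (ContDiff.sub (ContDiff.add ?_ ((hd hβ).clm_apply (hr hα)))
    ((hd hα).clm_apply (hr hβ))) ?_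
  · refine contDiff_linear_apply (fun x => aL (α x)) (fun e => ?_) hβ
    exact (aL.flip e).toContinuousLinearMap.contDiff.comp hα
  · refine ContDiff.sum fun i _ => ?_
    refine contDiff_linear_apply (fun x => lL _ (finBasis ℝ F i) (β x)) (fun e => ?_) contDiff_id
    refine contDiff_linear_apply (fun x => (lL _ (finBasis ℝ F i)).flip e) (fun u => ?_) hβ
    refine contDiff_linear_apply (fun x => ((lL.flip (finBasis ℝ F i)).flip u).flip e)
      (fun η => contDiff_const) ?_
    exact contDiff_const.clm_comp (hd hα)

lemma linearModelBracketFun_add_left {α α' : B → F} (β : B → F) (hα : ContDiff ℝ ∞ α)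
    (hα' : ContDiff ℝ ∞ α') (x : B) :
    linearModelBracketFun aL rL lL (α + α') β x =
      linearModelBracketFun aL rL lL α β x + linearModelBracketFun aL rL lL α' β x := by
  have h := fderiv_add (hα.differentiable (by simp) x) (hα'.differentiable (by simp) x)
  simp only [linearModelBracketFun, linearModelContraction, h, ContinuousLinearMap.comp_add,
    map_add, LinearMap.add_apply, add_apply, Pi.add_apply, Finset.sum_add_distrib]
  abel

lemma linearModelBracketFun_add_right (α : B → F) {β β' : B → F} (hβ : ContDiff ℝ ∞ β)
    (hβ' : ContDiff ℝ ∞ β') (x : B) :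
    linearModelBracketFun aL rL lL α (β + β') x =
      linearModelBracketFun aL rL lL α β x + linearModelBracketFun aL rL lL α β' x := by
  have h := fderiv_add (hβ.differentiable (by simp) x) (hβ'.differentiable (by simp) x)
  simp only [linearModelBracketFun, linearModelContraction, h,
    map_add, LinearMap.add_apply, add_apply, Pi.add_apply, Finset.sum_add_distrib]
  abel

lemma linearModelBracketFun_smul_left {f : B → ℝ} {α : B → F} (β : B → F)
    (hf : ContDiff ℝ ∞ f) (hα : ContDiff ℝ ∞ α) (x : B) :
    linearModelBracketFun aL rL lL (fun y => f y • α y) β x =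
      f x • linearModelBracketFun aL rL lL α β x - fderiv ℝ f x (rL (β x) x) • α x
        + lL (fderiv ℝ f x) (α x) (β x) x := by
  have h := fderiv_fun_smul (hf.differentiable (by simp) x) (hα.differentiable (by simp) x)
  have h2 : linearModelContraction lL ((fderiv ℝ f x).smulRight (α x)) (β x) x =
      lL (fderiv ℝ f x) (α x) (β x) x := by
    have h3 : ∀ i, ((finBasis ℝ F).coord i).toContinuousLinearMap.comp
        ((fderiv ℝ f x).smulRight (α x)) = (finBasis ℝ F).coord i (α x) • fderiv ℝ f x := by
      intro i; ext w; simp [mul_comm]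
    conv_rhs => rw [← (finBasis ℝ F).sum_repr (α x)]
    simp only [linearModelContraction, h3, map_smul, LinearMap.smul_apply, map_sum,
      LinearMap.sum_apply, Basis.coord_apply]
  have h4 : linearModelContraction lL (f x • fderiv ℝ α x + (fderiv ℝ f x).smulRight (α x))
      (β x) x = f x • linearModelContraction lL (fderiv ℝ α x) (β x) x +
        linearModelContraction lL ((fderiv ℝ f x).smulRight (α x)) (β x) x := by
    simp only [linearModelContraction, ContinuousLinearMap.comp_add,
      ContinuousLinearMap.comp_smul, map_add, map_smul, LinearMap.add_apply,
      LinearMap.smul_apply, Finset.sum_add_distrib, Finset.smul_sum]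
  simp only [linearModelBracketFun, h, h4, h2, map_smul, LinearMap.smul_apply, add_apply,
    smul_apply, ContinuousLinearMap.smulRight_apply]
  module

lemma linearModelBracketFun_smul_right {f : B → ℝ} (α : B → F) {β : B → F}
    (hf : ContDiff ℝ ∞ f) (hβ : ContDiff ℝ ∞ β) (x : B) :
    linearModelBracketFun aL rL lL α (fun y => f y • β y) x =
      f x • linearModelBracketFun aL rL lL α β x + fderiv ℝ f x (rL (α x) x) • β x := by
  have h := fderiv_fun_smul (hf.differentiable (by simp) x) (hβ.differentiable (by simp) x)
  simp only [linearModelBracketFun, linearModelContraction, h, map_smul, LinearMap.smul_apply,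
    add_apply, smul_apply, ContinuousLinearMap.smulRight_apply,
    ← Finset.smul_sum]
  module

lemma differential_eq_fderiv (f : B → ℝ) (x : B) :
    differential (B := B) f x = (fderiv ℝ f x : B →L[ℝ] ℝ) := by
  unfold differential
  rw [mfderiv_eq_fderiv]

lemma contDiff_smoothFun (f : SmoothFun B B) : ContDiff ℝ ∞ f :=
  contMDiff_iff_contDiff.1 f.contMDiff

/-- The linear almost Loday algebroid on the trivial bundle `B × F → B` with anchor `ρ^L`, co-anchor
`λ^L`, and bracket `𝔞^L` on constant sections. -/
def linearModel : AlmostLodayAlgebroid B F (Trivial B F) where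
  bracket := LinearMap.mk₂ ℝ
    (fun α β => sectionOfContDiff (linearModelBracketFun aL rL lL α β)
      (contDiff_linearModelBracketFun aL rL lL (contDiff_section α) (contDiff_section β)))
    (fun α α' β => by
      ext x
      exact linearModelBracketFun_add_left aL rL lL β (contDiff_section α)
        (contDiff_section α') x)
    (fun c α β => by
      ext x
      refine (linearModelBracketFun_smul_left aL rL lL (f := fun _ => c) β contDiff_const
        (contDiff_section α) x).trans ?_
      simp; rfl)
    (fun α β β' => by
      ext x
      exact linearModelBracketFun_add_right aL rL lL α (contDiff_section β)
        (contDiff_section β') x)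
    (fun c α β => by
      ext x
      refine (linearModelBracketFun_smul_right aL rL lL (f := fun _ => c) α contDiff_const
        (contDiff_section β) x).trans ?_
      simp; rfl)
  anchor x := rL.flip x
  coanchor x :=
    { toFun := fun ξ => (lL ξ).compr₂ (LinearMap.applyₗ x)
      map_add' := fun ξ η => by
        ext a b; exact congrArg (fun T : F →ₗ[ℝ] F →ₗ[ℝ] B →ₗ[ℝ] F => T a b x) (map_add lL ξ η)
      map_smul' := fun c ξ => by
        ext a b
        exact congrArg (fun T : F →ₗ[ℝ] F →ₗ[ℝ] B →ₗ[ℝ] F => T a b x) (map_smul lL c ξ) }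
  smooth_anchor := by
    intro e
    have h0 := contMDiffAt_totalSpace.1 (contMDiffAt_id (I := 𝓘(ℝ, B).prod 𝓘(ℝ, F)) (n := ∞)
      (x := e))
    have h1 : ContMDiffAt (𝓘(ℝ, B).prod 𝓘(ℝ, F)) 𝓘(ℝ, B) ∞
      (fun e : TotalSpace F (Trivial B F) => e.1) e := h0.1
    have h2 : ContMDiffAt (𝓘(ℝ, B).prod 𝓘(ℝ, F)) 𝓘(ℝ, F) ∞
      (fun e : TotalSpace F (Trivial B F) => (e.2 : F)) e := h0.2
    have h3 : ContDiff ℝ ∞ fun z : B × F => rL z.2 z.1 :=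
      contDiff_linear_apply_prod rL
    refine contMDiffAt_totalSpace.2 ⟨h1, ?_⟩
    have h4 := h3.contMDiff.contMDiffAt.comp e (h1.prodMk_space h2)
    refine h4.congr_of_eventuallyEq (Eventually.of_forall fun e' => ?_)
    simp [trivializationAt_model_space_apply]
    rfl
  smooth_coanchor f α β := by
    have h : ContDiff ℝ ∞ fun x => lL (fderiv ℝ f x) (α x : F) (β x : F) x := by
      refine contDiff_linear_apply (fun x => lL _ (α x : F) (β x : F)) (fun e => ?_) contDiff_id
      refine contDiff_linear_apply (fun x => (lL _ (α x : F)).flip e) (fun u => ?_)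
        (contDiff_section β)
      refine contDiff_linear_apply (fun x => ((lL _).flip u).flip e) (fun w => ?_)
        (contDiff_section α)
      exact contDiff_linear_apply (fun x => ((lL.flip w).flip u).flip e)
        (fun η => contDiff_const) ((contDiff_smoothFun f).fderiv_right (by simp))
    refine (sectionOfContDiff _ h).contMDiff.congr fun x => ?_
    rw [differential_eq_fderiv]; rfl
  leibniz_right α β f x := by
    rw [differential_eq_fderiv]
    exact linearModelBracketFun_smul_right aL rL lL α (contDiff_smoothFun f)
      (contDiff_section β) x
  leibniz_left α β f x := by
    rw [differential_eq_fderiv]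
    exact linearModelBracketFun_smul_left aL rL lL β (contDiff_smoothFun f)
      (contDiff_section α) x

end LinearModel

/-! ### Local isomorphisms and linearizability -/

section LocalIso

variable {B : Type*} [NormedAddCommGroup B] [NormedSpace ℝ B]
  {M : Type*} [TopologicalSpace M] [ChartedSpace B M] [IsManifold 𝓘(ℝ, B) ∞ M]
  {F : Type*} [NormedAddCommGroup F] [NormedSpace ℝ F]
  {V : M → Type*} [TopologicalSpace (TotalSpace F V)] [∀ x, TopologicalSpace (V x)]
  [∀ x, AddCommGroup (V x)] [∀ x, Module ℝ (V x)] [FiberBundle F V] [VectorBundle ℝ F V]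
  {B' : Type*} [NormedAddCommGroup B'] [NormedSpace ℝ B']
  {M' : Type*} [TopologicalSpace M'] [ChartedSpace B' M'] [IsManifold 𝓘(ℝ, B') ∞ M']
  {F' : Type*} [NormedAddCommGroup F'] [NormedSpace ℝ F']
  {V' : M' → Type*} [TopologicalSpace (TotalSpace F' V')] [∀ x, TopologicalSpace (V' x)]
  [∀ x, AddCommGroup (V' x)] [∀ x, Module ℝ (V' x)] [FiberBundle F' V'] [VectorBundle ℝ F' V']

/-- A local isomorphism of almost Loday algebroids: a diffeomorphism `φ : U → U'` of open sets
`U ⊆ M`, `U' ⊆ M'`, covered by a smooth isomorphism of vector bundles `Φ : E|_U → E'|_U'` that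
intertwines anchors, co-anchors and brackets.

Brackets are local operators and every germ of a smooth section extends to a global section, so
that `Φ` intertwines the restricted brackets iff for all `q ∈ U`: if the germ of `α` at `q`
corresponds to the germ of `α'` at `φ(q)` under `Φ`, and likewise for `β`, `β'`, then `Φ` maps
`[α, β](q)` to `[α', β'](φ(q))`. -/
structure AlmostLodayAlgebroid.LocalIso (A : AlmostLodayAlgebroid B F V)
    (A' : AlmostLodayAlgebroid B' F' V') where
  /-- The diffeomorphism `φ : U → U'`, with `U = base.source`, `U' = base.target`. -/
  base : OpenPartialHomeomorph M M'
  /-- The map `Φ` of total spaces. -/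
  total : OpenPartialHomeomorph (TotalSpace F V) (TotalSpace F' V')
  /-- The linear maps `Φ_q : E_q → E'_φ(q)` (only relevant for `q ∈ U`). -/
  fiber : ∀ q : M, V q →ₗ[ℝ] V' (base q)
  total_source : total.source = TotalSpace.proj ⁻¹' base.source
  total_target : total.target = TotalSpace.proj ⁻¹' base.target
  total_apply : ∀ q ∈ base.source, ∀ e : V q, total ⟨q, e⟩ = ⟨base q, fiber q e⟩
  smooth_base : ContMDiffOn 𝓘(ℝ, B) 𝓘(ℝ, B') ∞ base base.source
  smooth_base_symm : ContMDiffOn 𝓘(ℝ, B') 𝓘(ℝ, B) ∞ base.symm base.target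
  smooth_total : ContMDiffOn (𝓘(ℝ, B).prod 𝓘(ℝ, F)) (𝓘(ℝ, B').prod 𝓘(ℝ, F')) ∞ total total.source
  smooth_total_symm :
    ContMDiffOn (𝓘(ℝ, B').prod 𝓘(ℝ, F')) (𝓘(ℝ, B).prod 𝓘(ℝ, F)) ∞ total.symm total.target
  anchor_comm : ∀ q ∈ base.source, ∀ e : V q,
    A'.anchor (base q) (fiber q e) = mfderiv 𝓘(ℝ, B) 𝓘(ℝ, B') base q (A.anchor q e)
  coanchor_comm : ∀ q ∈ base.source, ∀ (ξ : Cotan B' (base q)) (e₁ e₂ : V q),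
    A'.coanchor (base q) ξ (fiber q e₁) (fiber q e₂) =
      fiber q (A.coanchor q (ξ.comp (mfderiv 𝓘(ℝ, B) 𝓘(ℝ, B') base q)) e₁ e₂)
  bracket_comm : ∀ q ∈ base.source, ∀ (α β : SmoothSection B F V) (α' β' : SmoothSection B' F' V'),
    (∀ᶠ r in 𝓝 q, fiber r (α r) = α' (base r)) → (∀ᶠ r in 𝓝 q, fiber r (β r) = β' (base r)) →
      fiber q (A.bracket α β q) = A'.bracket α' β' (base q)

variable [FiniteDimensional ℝ B] [FiniteDimensional ℝ F] [T2Space M]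
  [ContMDiffVectorBundle ∞ F V 𝓘(ℝ, B)]

/-- The linearization of `A` at `p` (to be used where anchor and co-anchor vanish): the linear
almost Loday algebroid on `T_p M × E_p → T_p M` given by `𝔞^L`, `ρ^L`, `λ^L`. The vector space
`T_p M` is `B` by definition, and `E_p` is identified with `F` by the linear isomorphism of the
preferred trivialization at `p`. -/
def AlmostLodayAlgebroid.linearization (A : AlmostLodayAlgebroid B F V) (p : M) :
    AlmostLodayAlgebroid B F (Trivial B F) :=
  let τ : V p ≃ₗ[ℝ] F := (VectorBundle.continuousLinearEquivAt ℝ F V p).toLinearEquiv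
  linearModel
    (((A.linearBracket p).compl₁₂ τ.symm.toLinearMap τ.symm.toLinearMap).compr₂ τ.toLinearMap)
    ((A.linearAnchor p).comp τ.symm.toLinearMap)
    { toFun := fun ξ => ((A.linearCoanchor p ξ).compl₁₂ τ.symm.toLinearMap
        τ.symm.toLinearMap).compr₂ (LinearMap.compRight ℝ τ.toLinearMap)
      map_add' := fun ξ η => by
        ext u w x
        exact (congrArg (fun T : V p →ₗ[ℝ] V p →ₗ[ℝ] Tan B p →ₗ[ℝ] V p =>
          τ (T (τ.symm u) (τ.symm w) x)) (map_add (A.linearCoanchor p) ξ η)).trans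
            (map_add τ _ _)
      map_smul' := fun c ξ => by
        ext u w x
        exact (congrArg (fun T : V p →ₗ[ℝ] V p →ₗ[ℝ] Tan B p →ₗ[ℝ] V p =>
          τ (T (τ.symm u) (τ.symm w) x)) (map_smul (A.linearCoanchor p) c ξ)).trans
            (map_smul τ _ _) }

/-- `A` is linearizable around `p`: there is a local isomorphism from a neighbourhood of `p` to a
neighbourhood of `0` in the linearization of `A` at `p` that takes `p` to `0`. -/
def AlmostLodayAlgebroid.IsLinearizableAt (A : AlmostLodayAlgebroid B F V) (p : M) : Prop :=
  ∃ Φ : A.LocalIso (A.linearization p), p ∈ Φ.base.source ∧ Φ.base p = 0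

end LocalIso

end

/-! Extend v to a section α and put X = ρ(α). Since ρ^L(v) = id, X vanishes at p with linear part
the identity. All eigenvalues are 1, so there are no resonances, and X is the Euler vector field E
in suitable smooth coordinates (`exists_euler_coordinates`).

For Lie and Courant algebroids the symmetric part of the bracket vanishes wherever the anchor does,
so at p the bracket depends only on the values of the two sections, and centrality of v says that
[α, ·] vanishes at p. On components in a frame, [α, ·] therefore acts as E + a with a matrix a that
is zero at the origin. A change of frame k with E k = -a k and k(0) = id gives a frame that commutes
with α (`exists_commuting_frame`).

Now the Jacobi identity turns [α, ·] into a grading. For members e, e' of this frame and a linear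
coordinate x one gets [α, [e, e']] = 0, X(ρ(e)x) = ρ(e)x and [α, λ(dx ⊗ e ⊗ e')] = λ(dx ⊗ e ⊗ e').
So the components of bracket, anchor and co-anchor are smooth functions near the origin that are
homogeneous of degree 0, 1 and 1, hence constant, linear and linear (`coeff_bracket_sec`,
`vectorDifferential_anchor_sec`, `coeff_coanchor_sec`). The Leibniz rules determine the bracket of
all other sections, which gives the local isomorphism with the linear model
(`IsLinearInFrame.localIso`). The new coordinates are tangent to the preferred chart and the new
frame agrees with the preferred one at p, so the linear model is exactly the linearization.

The coordinates and the frame both come from an equation that is singular at the origin, of the form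
dN(y) y = f(1, y, N(y)) + j N(y). By homogeneity of f, the substitution N(ty) = t^j w(t) on each ray
turns it into the regular equation w' = f(t, y, w), w(0) = 0 (`exists_radial_solution`). Smoothness
in y follows from the implicit function theorem for the integral equation in the Banach space of
paths on [0, 1], once composition with a smooth map is known to be a smooth operator on paths. -/

noncomputable section

set_option synthInstance.maxHeartbeats 200000
set_option linter.unusedSectionVars false

/-! ### Smoothness of composition operators -/

section CompositionOperator

universe u v w

variable {K : Type*} [TopologicalSpace K] [CompactSpace K]

/-- Pointwise evaluation of a path of operators on a path of vectors. -/
def pointwiseApply (K : Type*) [TopologicalSpace K] [CompactSpace K]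
    (E G : Type*) [NormedAddCommGroup E] [NormedSpace ℝ E]
    [NormedAddCommGroup G] [NormedSpace ℝ G] :
    C(K, E →L[ℝ] G) →L[ℝ] C(K, E) →L[ℝ] C(K, G) :=
  LinearMap.mkContinuous₂
    (LinearMap.mk₂ ℝ (fun (T : C(K, E →L[ℝ] G)) (h : C(K, E)) =>
        (⟨fun t => T t (h t), T.continuous.clm_apply h.continuous⟩ : C(K, G)))
      (fun T T' h => by ext t; rfl) (fun c T h => by ext t; rfl)
      (fun T h h' => by ext t; exact map_add (T t) _ _)
      (fun c T h => by ext t; exact map_smul (T t) _ _)) 1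
    (fun T h => by
      rw [one_mul]
      refine (ContinuousMap.norm_le _ (by positivity)).2 fun t => ?_
      exact (T t).le_of_opNorm_le_of_le (T.norm_coe_le_norm t) (h.norm_coe_le_norm t))

lemma pointwiseApply_apply {E G : Type*} [NormedAddCommGroup E] [NormedSpace ℝ E]
    [NormedAddCommGroup G] [NormedSpace ℝ G] (T : C(K, E →L[ℝ] G)) (h : C(K, E)) (t : K) :
    pointwiseApply K E G T h t = T t (h t) := rfl

/-- Since `K` is compact, u ↦ f' ∘ u is continuous for the sup norm, so one δ controls the variation
of f' near w t for all t at once. The mean value inequality on the segment from w t to w t + h t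
then bounds the remainder uniformly in t. -/
lemma hasFDerivAt_compositionOperator {E G : Type*} [NormedAddCommGroup E] [NormedSpace ℝ E]
    [NormedAddCommGroup G] [NormedSpace ℝ G] (f : C(E, G)) (f' : C(E, E →L[ℝ] G))
    (hf : ∀ x, HasFDerivAt f (f' x) x) (w : C(K, E)) :
    HasFDerivAt (fun u : C(K, E) => f.comp u) (pointwiseApply K E G (f'.comp w)) w := by
  rw [hasFDerivAt_iff_isLittleO_nhds_zero, Asymptotics.isLittleO_iff]
  intro c hc
  have hcont : Continuous fun u : C(K, E) => f'.comp u := f'.continuous_postcomp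
  obtain ⟨δ, hδ, hball⟩ := (Metric.continuousAt_iff (α := C(K, E))
    (β := C(K, E →L[ℝ] G)) (f := fun u => f'.comp u) (a := w)).1 hcont.continuousAt c hc
  filter_upwards [Metric.ball_mem_nhds (0 : C(K, E)) hδ] with h hh
  rw [mem_ball_zero_iff] at hh
  refine (ContinuousMap.norm_le _ (by positivity)).2 fun t => ?_
  have key : ‖f (w t + h t) - f (w t) - f' (w t) ((w t + h t) - w t)‖ ≤ c * ‖(w t + h t) - w t‖ := by
    refine (convex_segment (w t) (w t + h t)).norm_image_sub_le_of_norm_hasFDerivWithin_le'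
      (f' := f') (fun x _ => (hf x).hasFDerivWithinAt) ?_ (left_mem_segment ..)
      (right_mem_segment ..)
    intro x hx
    rw [segment_eq_image'] at hx
    obtain ⟨s, hs, rfl⟩ := hx
    have h1 : dist (w + s • h) w < δ := by
      rw [dist_eq_norm, add_sub_cancel_left, norm_smul]
      refine lt_of_le_of_lt ?_ hh
      refine mul_le_of_le_one_left (norm_nonneg _) ?_
      rw [Real.norm_of_nonneg hs.1]; exact hs.2
    have h2 := (ContinuousMap.dist_apply_le_dist (f := f'.comp (w + s • h)) (g := f'.comp w) t).trans
      (hball h1).le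
    rw [dist_eq_norm] at h2
    simpa using h2
  rw [add_sub_cancel_left] at key
  exact key.trans (mul_le_mul_of_nonneg_left (h.norm_coe_le_norm t) hc.le)

/-- The derivative of the operator of f is the operator of f' followed by a bounded linear map, so
the order of differentiability goes up by induction. The induction replaces `G` by `E →L[ℝ] G`; the
universe `max u v` is stable under this. -/
lemma contDiff_compositionOperator_aux {E : Type u} [NormedAddCommGroup E] [NormedSpace ℝ E] (n : ℕ) :
    ∀ {G : Type (max u v)} [NormedAddCommGroup G] [NormedSpace ℝ G] (f : C(E, G)),
      ContDiff ℝ ∞ f → ContDiff ℝ n (fun u : C(K, E) => f.comp u) := by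
  induction n with
  | zero =>
    intro G _ _ f hf
    exact contDiff_zero.2 f.continuous_postcomp
  | succ n ih =>
    intro G _ _ f hf
    have hd : ContDiff ℝ ∞ (fderiv ℝ f) := hf.fderiv_right (by simp)
    refine contDiff_succ_iff_hasFDerivAt.2
      ⟨_, (pointwiseApply K E G).contDiff.comp (ih ⟨fderiv ℝ f, hd.continuous⟩ hd), fun w => ?_⟩
    exact hasFDerivAt_compositionOperator f ⟨fderiv ℝ f, hd.continuous⟩
      (fun x => (hf.differentiable (by simp) x).hasFDerivAt) w

/-- Composition with a smooth map is a smooth operator on continuous functions. -/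
lemma contDiff_compositionOperator {E : Type u} {G : Type v} [NormedAddCommGroup E]
    [NormedSpace ℝ E] [NormedAddCommGroup G] [NormedSpace ℝ G] (f : C(E, G))
    (hf : ContDiff ℝ ∞ f) : ContDiff ℝ ∞ (fun u : C(K, E) => f.comp u) := by
  refine contDiff_infty.2 fun n => ?_
  -- Lifting `G` puts it in the universe that the induction requires.
  let up : G ≃L[ℝ] ULift.{u} G := ContinuousLinearEquiv.ulift.symm
  have h := contDiff_compositionOperator_aux.{u, v} (K := K) n
    (⟨fun x => up (f x), up.continuous.comp f.continuous⟩ : C(E, ULift.{u} G))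
    (up.contDiff.comp hf)
  exact (up.symm.toContinuousLinearMap.compLeftContinuous ℝ K).contDiff.comp h

end CompositionOperator

/-! ### Primitives of paths -/

section Primitive

variable {E : Type*} [NormedAddCommGroup E] [NormedSpace ℝ E]

/-- The primitive `t ↦ ∫₀ᵗ u` of a path `u` on the unit interval. -/
def pathPrimitive (E : Type*) [NormedAddCommGroup E] [NormedSpace ℝ E] :
    C(unitInterval, E) →L[ℝ] C(unitInterval, E) :=
  LinearMap.mkContinuous
    { toFun := fun u => ⟨fun t => ∫ s in (0 : ℝ)..t, Set.IccExtend zero_le_one u s,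
        (intervalIntegral.continuous_primitive
          (fun _ _ => (u.continuous.Icc_extend' (h := zero_le_one)).intervalIntegrable _ _) 0).comp
            continuous_subtype_val⟩
      map_add' := fun u w => by
        ext t
        exact intervalIntegral.integral_add
          ((u.continuous.Icc_extend' (h := zero_le_one)).intervalIntegrable _ _)
          ((w.continuous.Icc_extend' (h := zero_le_one)).intervalIntegrable _ _)
      map_smul' := fun c u => by
        ext t
        exact intervalIntegral.integral_smul c _ } 1
    (fun u => by
      rw [one_mul]
      refine (ContinuousMap.norm_le _ (norm_nonneg _)).2 fun t => ?_
      have h := intervalIntegral.norm_integral_le_of_norm_le_const (a := 0) (b := (t : ℝ))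
        (f := Set.IccExtend zero_le_one u) (C := ‖u‖) (fun s _ => u.norm_coe_le_norm _)
      refine h.trans (mul_le_of_le_one_right (norm_nonneg _) ?_)
      rw [sub_zero, abs_of_nonneg t.2.1]; exact t.2.2)

lemma pathPrimitive_apply (u : C(unitInterval, E)) (t : unitInterval) :
    pathPrimitive E u t = ∫ s in (0 : ℝ)..t, Set.IccExtend zero_le_one u s := rfl

end Primitive

/-! ### Smoothness of implicit functions near the base point -/

section ImplicitFunction

variable {P E G : Type*} [NormedAddCommGroup P] [NormedSpace ℝ P] [CompleteSpace P]
  [NormedAddCommGroup E] [NormedSpace ℝ E] [CompleteSpace E]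
  [NormedAddCommGroup G] [NormedSpace ℝ G] [CompleteSpace G]

/-- The implicit function of a smooth equation is smooth at all points near the base point. -/
lemma eventually_contDiffAt_implicitFunction {f : P × E → G} (hf : ContDiff ℝ ∞ f) {u : P × E}
    (hi : (fderiv ℝ f u ∘L .inr ℝ P E).IsInvertible) :
    ∀ᶠ x in 𝓝 u.1, ContDiffAt ℝ ∞ (hf.contDiffAt.implicitFunction (by simp) hi) x := by
  set W := hf.contDiffAt.implicitFunction (u := u) (by simp) hi with hW
  have hWc : ContinuousAt W u.1 :=
    (hf.contDiffAt.contDiffAt_implicitFunction (by simp) hi).continuousAt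
  have hWu : W u.1 = u.2 := hf.contDiffAt.implicitFunction_apply_self (by simp) hi
  have hpair : Tendsto (fun x => (x, W x)) (𝓝 u.1) (𝓝 u) := by
    have := continuousAt_id.prodMk hWc
    have h2 : ((id u.1, W u.1) : P × E) = u := by rw [hWu]; rfl
    rw [ContinuousAt, h2] at this
    exact this
  have h1 := hf.contDiffAt.eventually_apply_eq_iff_implicitFunction (by simp) hi
  have h2 := hf.contDiffAt.eventually_apply_implicitFunction (by simp) hi
  have h3 : ∀ᶠ v in 𝓝 u, (fderiv ℝ f v ∘L .inr ℝ P E).IsInvertible := by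
    obtain ⟨e, he⟩ := hi
    have hc : Continuous fun v => fderiv ℝ f v ∘L .inr ℝ P E :=
      (hf.continuous_fderiv (by simp)).clm_comp continuous_const
    have := hc.continuousAt (x := u) (he ▸ e.nhds)
    filter_upwards [this] with v hv
    exact hv
  filter_upwards [hpair.eventually (eventually_eventually_nhds.2 h1), h2, hpair.eventually h3]
    with x hx1 hx2 hx3
  -- `ContDiffAt` of order ∞ at one point allows the neighbourhood to shrink with the order, so
  -- smoothness at nearby x is a separate matter. The implicit function based at (x, W x) is smooth
  -- at x, and the local uniqueness at u shows that W agrees with it near x.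
  have hψ := hf.contDiffAt.contDiffAt_implicitFunction (by simp) hx3
  have hψx := hf.contDiffAt.implicitFunction_apply_self (by simp) hx3
  refine hψ.congr_of_eventuallyEq ?_
  have h4 := hf.contDiffAt.eventually_apply_implicitFunction (by simp) hx3
  have hpair2 := (continuousAt_id.prodMk hψ.continuousAt)
  rw [ContinuousAt] at hpair2
  simp only [id, hψx] at hpair2
  filter_upwards [h4, hpair2.eventually hx1] with y hy1 hy2
  exact hy2.1 (hy1.trans hx2)

end ImplicitFunction

/-! ### Singular radial equations, solved by a regular integral equation on paths -/

section Radial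

variable {P E : Type*} [NormedAddCommGroup P] [NormedSpace ℝ P]
  [NormedAddCommGroup E] [NormedSpace ℝ E]

variable (P E) in
/-- The linear part of the affine map `(p, w) ↦ (t ↦ (t, p, w t))`. -/
def graphPathLinear : P × C(unitInterval, E) →L[ℝ] C(unitInterval, ℝ × P × E) :=
  LinearMap.mkContinuous
    { toFun := fun z => ⟨fun t => (0, z.1, z.2 t), by fun_prop⟩
      map_add' := fun z z' => by ext t <;> simp
      map_smul' := fun c z => by ext t <;> simp } 1
    (fun z => by
      rw [one_mul]
      refine (ContinuousMap.norm_le _ (norm_nonneg _)).2 fun t => ?_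
      refine norm_prod_le_iff.2 ⟨by simp, norm_prod_le_iff.2 ⟨norm_fst_le z, ?_⟩⟩
      exact (z.2.norm_coe_le_norm t).trans (norm_snd_le z))

variable (P E) in
/-- The path `t ↦ (t, 0, 0)`. -/
def timePath : C(unitInterval, ℝ × P × E) := ⟨fun t => (t, 0, 0), by fun_prop⟩

lemma graphPath_apply (z : P × C(unitInterval, E)) (t : unitInterval) :
    (timePath P E + graphPathLinear P E z) t = ((t : ℝ), z.1, z.2 t) := by
  change ((t : ℝ), (0 : P), (0 : E)) + (0, z.1, z.2 t) = _
  simp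

/-- The map whose zeros `(p, w)` are the solutions on `[0, 1]` of `w' = f(t, p, w)`, `w(0) = 0`. -/
def integralEquation (f : C(ℝ × P × E, E)) (z : P × C(unitInterval, E)) : C(unitInterval, E) :=
  z.2 - pathPrimitive E (f.comp (timePath P E + graphPathLinear P E z))

lemma contDiff_integralEquation {f : C(ℝ × P × E, E)} (hf : ContDiff ℝ ∞ f) :
    ContDiff ℝ ∞ (integralEquation f) :=
  contDiff_snd.sub ((pathPrimitive E).contDiff.comp ((contDiff_compositionOperator f hf).comp
    (contDiff_const.add (graphPathLinear P E).contDiff)))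

/-- The partial derivative in w is the identity minus the primitive of ∂f/∂e along the path (t, 0,
0), and `h1` kills the second term. This is the invertibility needed for the implicit function
theorem at the origin. -/
lemma fderiv_integralEquation_inr {f : C(ℝ × P × E, E)} (hf : ContDiff ℝ ∞ f)
    (h1 : ∀ t e, fderiv ℝ f (t, 0, 0) (0, 0, e) = 0) :
    fderiv ℝ (integralEquation f) 0 ∘L .inr ℝ P C(unitInterval, E) = .id ℝ _ := by
  have hd : ContDiff ℝ ∞ (fderiv ℝ f) := hf.fderiv_right (by simp)
  have hγ : HasFDerivAt (fun z => timePath P E + graphPathLinear P E z) (graphPathLinear P E) 0 :=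
    (graphPathLinear P E).hasFDerivAt.const_add _
  have hN := hasFDerivAt_compositionOperator f ⟨fderiv ℝ f, hd.continuous⟩
      (fun x => (hf.differentiable (by simp) x).hasFDerivAt)
      (timePath P E + graphPathLinear P E 0)
  have hG : HasFDerivAt (integralEquation f) _ 0 :=
    hasFDerivAt_snd.sub ((pathPrimitive E).hasFDerivAt.comp 0 (HasFDerivAt.comp
      (f := fun z => timePath P E + graphPathLinear P E z) 0 hN hγ))
  rw [hG.fderiv]
  ext1 w
  have h0 : pointwiseApply unitInterval (ℝ × P × E) E
      ((⟨fderiv ℝ f, hd.continuous⟩ : C(ℝ × P × E, ℝ × P × E →L[ℝ] E)).comp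
        (timePath P E + graphPathLinear P E 0)) (graphPathLinear P E (0, w)) = 0 := by
    ext t
    rw [pointwiseApply_apply, map_zero, add_zero]
    exact h1 t (w t)
  change w - pathPrimitive E _ = w
  erw [h0]
  rw [map_zero, sub_zero]

variable [CompleteSpace P] [CompleteSpace E]

/-- The singular equation `dN(y) y = f(1, y, N(y)) + j N(y)` for a right-hand side with the
homogeneity `f(t, s y, s^j e) = s^(j+1) f(s t, y, e)` has a smooth solution near `0`: its value at
`y` is the value at time `1` of the solution of the ordinary differential equation
`w' = f(t, y, w)`, `w(0) = 0`. -/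
theorem exists_radial_solution (j : ℕ) (f : ℝ × P × E → E) (hf : ContDiff ℝ ∞ f)
    (h0 : ∀ t, f (t, 0, 0) = 0) (h1 : ∀ t e, fderiv ℝ f (t, 0, 0) (0, 0, e) = 0)
    (hhom : ∀ s t y e, f (t, s • y, s ^ j • e) = s ^ (j + 1) • f (s * t, y, e)) :
    ∃ N : P → E, (∀ᶠ y in 𝓝 0, ContDiffAt ℝ ∞ N y) ∧ N 0 = 0 ∧
      (∀ᶠ y in 𝓝 0, fderiv ℝ N y y = f (1, y, N y) + (j : ℝ) • N y) ∧
      (j ≠ 0 → fderiv ℝ N 0 = 0) := by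
  let fc : C(ℝ × P × E, E) := ⟨f, hf.continuous⟩
  have hG : ContDiff ℝ ∞ (integralEquation fc) := contDiff_integralEquation hf
  have hi : (fderiv ℝ (integralEquation fc) 0 ∘L .inr ℝ P C(unitInterval, E)).IsInvertible :=
    ⟨.refl ℝ _, (fderiv_integralEquation_inr (f := fc) hf h1).symm⟩
  have hG0 : integralEquation fc 0 = 0 := by
    have : fc.comp (timePath P E + graphPathLinear P E 0) = 0 := by
      ext t
      rw [map_zero, add_zero]
      exact h0 t
    rw [integralEquation, this, map_zero]; exact sub_zero _
  let W := hG.contDiffAt.implicitFunction (by simp) hi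
  have hWs : ∀ᶠ x in 𝓝 (0 : P), ContDiffAt ℝ ∞ W x := eventually_contDiffAt_implicitFunction hG hi
  have hW0 : W 0 = 0 := hG.contDiffAt.implicitFunction_apply_self (by simp) hi
  have hu := hG.contDiffAt.eventually_apply_eq_iff_implicitFunction (by simp) hi
  have hz : ∀ᶠ x in 𝓝 (0 : P), integralEquation fc (x, W x) = 0 := by
    filter_upwards [hG.contDiffAt.eventually_apply_implicitFunction (by simp) hi] with x hx
    exact hx.trans hG0
  let ev : C(unitInterval, E) →L[ℝ] E := ContinuousMap.evalCLM ℝ (1 : unitInterval)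
  let N : P → E := fun y => W y 1
  have hNs : ∀ᶠ y in 𝓝 0, ContDiffAt ℝ ∞ N y := by
    filter_upwards [hWs] with y hy
    exact ev.contDiff.contDiffAt.comp y hy
  -- Within distance δ of the origin the path W y is the only solution for the parameter y. This
  -- uniqueness identifies the rescaled paths below.
  obtain ⟨δ, hδ, hball⟩ := Metric.eventually_nhds_iff.1 hu
  have hWsmall : ∀ᶠ y in 𝓝 (0 : P), ‖W y‖ < δ := by
    have := hWs.self_of_nhds.continuousAt.norm
    rw [ContinuousAt, hW0, norm_zero] at this
    exact this.eventually_lt_const hδ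
  have hysmall : ∀ᶠ y in 𝓝 (0 : P), ‖y‖ < δ := by
    filter_upwards [Metric.ball_mem_nhds (0 : P) hδ] with y hy using mem_ball_zero_iff.1 hy
  -- the solution along the ray through `y`
  have hray : ∀ᶠ y in 𝓝 (0 : P), ∃ h : ℝ → E, Continuous h ∧ h 1 = f (1, y, N y) ∧
      N y = ∫ s in (0 : ℝ)..1, h s ∧
      ∀ s ∈ Set.Icc (0 : ℝ) 1, N (s • y) = s ^ j • ∫ σ in (0 : ℝ)..s, h σ := by
    filter_upwards [hz, hWsmall, hysmall] with y hy hWy hyy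
    let k : C(unitInterval, E) := fc.comp (timePath P E + graphPathLinear P E (y, W y))
    have hk : ∀ t, k t = f ((t : ℝ), y, W y t) := fun t =>
      congrArg f (graphPath_apply (y, W y) t)
    let h : ℝ → E := Set.IccExtend zero_le_one k
    have hcont : Continuous h := k.continuous.Icc_extend' (h := zero_le_one)
    have hWy' : ∀ t : unitInterval, W y t = ∫ s in (0 : ℝ)..t, h s := by
      intro t
      have := congrArg (fun u : C(unitInterval, E) => u t) (sub_eq_zero.1 hy)
      exact this
    refine ⟨h, hcont, ?_, hWy' 1, fun s hs => ?_⟩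
    · change Set.IccExtend zero_le_one k 1 = _
      rw [Set.IccExtend_of_mem zero_le_one k (by simp : (1 : ℝ) ∈ Set.Icc 0 1), hk]; rfl
    -- The path t ↦ s^j W_y(st) is a candidate for the parameter s y: its derivative is s^(j+1)
    -- f(st, y, W_y(st)), which by homogeneity is f(t, s y, s^j W_y(st)). It is no longer than W_y
    -- in norm, so uniqueness applies; evaluation at t = 1 gives N(s y) = s^j W_y(s).
    · let us : C(unitInterval, E) :=
        ⟨fun t => s ^ j • W y (⟨s, hs⟩ * t), by fun_prop⟩
      have husn : ‖us‖ < δ := by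
        refine lt_of_le_of_lt ((ContinuousMap.norm_le _ (norm_nonneg _)).2 fun t => ?_) hWy
        change ‖s ^ j • W y (⟨s, hs⟩ * t)‖ ≤ _
        rw [norm_smul, norm_pow, Real.norm_of_nonneg hs.1]
        exact (mul_le_of_le_one_left (norm_nonneg _) (pow_le_one₀ hs.1 hs.2)).trans
          ((W y).norm_coe_le_norm _)
      have hus : integralEquation fc (s • y, us) = 0 := by
        rw [integralEquation, sub_eq_zero]
        ext t
        rw [pathPrimitive_apply]
        have e1 : ∀ τ ∈ Set.uIcc (0 : ℝ) t,
            Set.IccExtend zero_le_one (fc.comp (timePath P E + graphPathLinear P E (s • y, us))) τ =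
              s ^ (j + 1) • h (s * τ) := by
          intro τ hτ
          rw [Set.uIcc_of_le t.2.1] at hτ
          have hτ' : τ ∈ Set.Icc (0 : ℝ) 1 := ⟨hτ.1, hτ.2.trans t.2.2⟩
          have hsτ : s * τ ∈ Set.Icc (0 : ℝ) 1 := (⟨s, hs⟩ * ⟨τ, hτ'⟩ : unitInterval).2
          rw [Set.IccExtend_of_mem zero_le_one _ hτ']
          change _ = s ^ (j + 1) • Set.IccExtend zero_le_one k (s * τ)
          rw [Set.IccExtend_of_mem zero_le_one k hsτ, hk, ← hhom]
          exact congrArg f (graphPath_apply (s • y, us) ⟨τ, hτ'⟩)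
        rw [intervalIntegral.integral_congr e1]
        change s ^ j • W y (⟨s, hs⟩ * t) = _
        rw [hWy', intervalIntegral.integral_smul, pow_succ, mul_smul,
          intervalIntegral.smul_integral_comp_mul_left]
        simp
      have hd : dist (s • y, us) (0 : P × C(unitInterval, E)) < δ := by
        rw [dist_zero_right]
        refine max_lt ?_ husn
        change ‖s • y‖ < δ
        rw [norm_smul, Real.norm_of_nonneg hs.1]
        exact lt_of_le_of_lt (mul_le_of_le_one_left (norm_nonneg _) hs.2) hyy
      have hWs' : W (s • y) = us := (hball hd).1 (hus.trans hG0.symm)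
      have h2 : N (s • y) = us 1 := congrArg (fun u : C(unitInterval, E) => u 1) hWs'
      rw [h2]
      change s ^ j • W y (⟨s, hs⟩ * 1) = _
      rw [mul_one, hWy']
  have hderiv : ∀ (h : ℝ → E), Continuous h → ∀ s : ℝ,
      HasDerivAt (fun s : ℝ => s ^ j • ∫ σ in (0 : ℝ)..s, h σ)
        (s ^ j • h s + (j * s ^ (j - 1) : ℝ) • ∫ σ in (0 : ℝ)..s, h σ) s := fun h hh s =>
    (hasDerivAt_pow j s).smul (intervalIntegral.integral_hasDerivAt_right
      (hh.intervalIntegrable _ _) hh.aestronglyMeasurable.stronglyMeasurableAtFilter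
      hh.continuousAt)
  have hNderiv : ∀ (y : P) (s : ℝ), DifferentiableAt ℝ N (s • y) →
      HasDerivAt (fun s : ℝ => N (s • y)) (fderiv ℝ N (s • y) y) s := by
    intro y s hN
    have h2 : HasDerivAt (fun s : ℝ => s • y) y s := by
      simpa using (hasDerivAt_id s).smul_const y
    exact hN.hasFDerivAt.comp_hasDerivAt s h2
  have hcompare : ∀ (y : P) (h : ℝ → E), Continuous h →
      (∀ s ∈ Set.Icc (0 : ℝ) 1, N (s • y) = s ^ j • ∫ σ in (0 : ℝ)..s, h σ) →
      ∀ s ∈ Set.Icc (0 : ℝ) 1, DifferentiableAt ℝ N (s • y) →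
        fderiv ℝ N (s • y) y = s ^ j • h s + (j * s ^ (j - 1) : ℝ) • ∫ σ in (0 : ℝ)..s, h σ := by
    intro y h hh hN s hs hd
    -- The formula for N(s y) is known only for s in [0, 1], so derivatives within this interval are
    -- compared. The endpoint s = 1 gives the singular equation, the endpoint s = 0 the derivative
    -- of N at the origin.
    have h3 := ((hderiv h hh s).hasDerivWithinAt (s := Set.Icc 0 1)).congr hN (hN s hs)
    exact (uniqueDiffOn_Icc_zero_one s hs).eq_deriv _ (hNderiv y s hd).hasDerivWithinAt h3
  refine ⟨N, hNs, ?_, ?_, fun hj => ?_⟩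
  · change W 0 1 = 0
    rw [hW0]; rfl
  · filter_upwards [hray, hNs] with y ⟨h, hh, hh1, hN1, hNs⟩ hd
    have := hcompare y h hh hNs 1 (by simp)
      (by rw [one_smul]; exact hd.differentiableAt (by simp))
    simpa [hh1, ← hN1] using this
  -- At s = 0 the integral vanishes, and so does s^j because j ≠ 0. A linear map that is zero near
  -- the origin is zero.
  · have h4 : ∀ᶠ y in 𝓝 (0 : P), fderiv ℝ N 0 y = 0 := by
      filter_upwards [hray] with y ⟨h, hh, _, _, hNs'⟩
      have := hcompare y h hh hNs' 0 (by simp)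
        (by rw [zero_smul]; exact hNs.self_of_nhds.differentiableAt (by simp))
      simpa [hj] using this
    ext y
    have h5 : Tendsto (fun c : ℝ => c • y) (𝓝[≠] 0) (𝓝 0) := by
      have : Tendsto (fun c : ℝ => c • y) (𝓝 0) (𝓝 ((0 : ℝ) • y)) :=
        (continuous_id.smul continuous_const).continuousAt
      rw [zero_smul] at this
      exact this.mono_left nhdsWithin_le_nhds
    obtain ⟨c, hc, hc0⟩ := ((h5.eventually h4).and self_mem_nhdsWithin).exists
    rw [map_smul] at hc
    exact (smul_eq_zero.1 hc).resolve_left hc0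

end Radial

/-! ### Hadamard's lemma and globalization of smooth germs -/

section Hadamard

variable {B G : Type*} [NormedAddCommGroup B] [NormedSpace ℝ B]
  [NormedAddCommGroup G] [NormedSpace ℝ G]

/-- Hadamard's lemma. -/
lemma exists_contDiff_eq_apply_self [CompleteSpace G] {h : B → G} (hh : ContDiff ℝ ∞ h)
    (h0 : h 0 = 0) :
    ∃ C : B → B →L[ℝ] G, ContDiff ℝ ∞ C ∧ C 0 = fderiv ℝ h 0 ∧ ∀ x, h x = C x x := by
  have hd : ContDiff ℝ ∞ (fderiv ℝ h) := hh.fderiv_right (by simp)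
  let f : C(B, B →L[ℝ] G) := ⟨fderiv ℝ h, hd.continuous⟩
  let R : B →L[ℝ] C(unitInterval, B) := LinearMap.mkContinuous
    { toFun := fun x => ⟨fun t => (t : ℝ) • x, by fun_prop⟩
      map_add' := fun x y => by ext t; exact smul_add _ _ _
      map_smul' := fun c x => by ext t; exact smul_comm _ _ _ } 1
    (fun x => by
      rw [one_mul]
      refine (ContinuousMap.norm_le _ (norm_nonneg _)).2 fun t => ?_
      change ‖(t : ℝ) • x‖ ≤ _
      rw [norm_smul, Real.norm_of_nonneg t.2.1]
      exact mul_le_of_le_one_left (norm_nonneg _) t.2.2)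
  let ev : C(unitInterval, B →L[ℝ] G) →L[ℝ] (B →L[ℝ] G) :=
    ContinuousMap.evalCLM ℝ (1 : unitInterval)
  -- This is ∫₀¹ dh(tx) dt, written as a composition of bounded linear maps with a composition
  -- operator, so that its smoothness needs no differentiation under the integral.
  let C : B → B →L[ℝ] G := fun x => ev (pathPrimitive (B →L[ℝ] G) (f.comp (R x)))
  have hCs : ContDiff ℝ ∞ C :=
    (ev ∘L pathPrimitive (B →L[ℝ] G)).contDiff.comp
      ((contDiff_compositionOperator f hd).comp R.contDiff)
  have hC : ∀ x, C x = ∫ t in (0 : ℝ)..1, fderiv ℝ h (t • x) := by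
    intro x
    refine intervalIntegral.integral_congr fun t ht => ?_
    replace ht : t ∈ Set.uIcc (0 : ℝ) 1 := ht
    rw [Set.uIcc_of_le zero_le_one] at ht
    exact Set.IccExtend_of_mem zero_le_one _ ht
  refine ⟨C, hCs, ?_, fun x => ?_⟩
  · rw [hC]; simp
  · have hder : ∀ t : ℝ, HasDerivAt (fun t : ℝ => h (t • x)) (fderiv ℝ h (t • x) x) t := by
      intro t
      have h2 : HasDerivAt (fun s : ℝ => s • x) x t := by
        simpa using (hasDerivAt_id t).smul_const x
      exact (hh.differentiable (by simp) _).hasFDerivAt.comp_hasDerivAt t h2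
    have hcont : Continuous fun t : ℝ => fderiv ℝ h (t • x) :=
      hd.continuous.comp (by fun_prop)
    have h3 := intervalIntegral.integral_eq_sub_of_hasDerivAt (a := 0) (b := 1)
      (fun t _ => hder t) ((hcont.clm_apply continuous_const).intervalIntegrable _ _)
    rw [hC, ContinuousLinearMap.intervalIntegral_apply (hcont.intervalIntegrable _ _), h3]
    simp [h0]

/-- A map that is smooth near a point agrees near the point with a smooth map. -/
lemma exists_contDiff_eventuallyEq [FiniteDimensional ℝ B] {h : B → G} {a : B}
    (hh : ∀ᶠ x in 𝓝 a, ContDiffAt ℝ ∞ h x) : ∃ g : B → G, ContDiff ℝ ∞ g ∧ g =ᶠ[𝓝 a] h := by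
  obtain ⟨r, hr, hball⟩ := Metric.eventually_nhds_iff_ball.1 hh
  let χ : ContDiffBump a := ⟨r / 4, r / 2, by linarith, by linarith⟩
  refine ⟨fun x => χ x • h x, contDiff_iff_contDiffAt.2 fun x => ?_, ?_⟩
  · by_cases hx : x ∈ tsupport χ
    · rw [χ.tsupport_eq] at hx
      exact χ.contDiffAt.smul (hball x (Metric.closedBall_subset_ball (by simp [χ]; linarith) hx))
    · refine (contDiffAt_const (c := (0 : G))).congr_of_eventuallyEq ?_
      filter_upwards [notMem_tsupport_iff_eventuallyEq.1 hx] with y hy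
      rw [hy]; exact zero_smul _ _
  · filter_upwards [χ.eventuallyEq_one] with x hx
    rw [hx]; exact one_smul _ _

end Hadamard

/-! ### Smooth functions homogeneous of degree zero and one -/

section Euler

variable {B G : Type*} [NormedAddCommGroup B] [NormedSpace ℝ B]
  [NormedAddCommGroup G] [NormedSpace ℝ G]

lemma hasDerivAt_comp_smul {h : B → G} {y : B} {s : ℝ} (hd : DifferentiableAt ℝ h (s • y)) :
    HasDerivAt (fun s : ℝ => h (s • y)) (fderiv ℝ h (s • y) y) s := by
  have h2 : HasDerivAt (fun s : ℝ => s • y) y s := by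
    simpa using (hasDerivAt_id s).smul_const y
  exact hd.hasFDerivAt.comp_hasDerivAt s h2

lemma smul_mem_ball_zero {y : B} {r s : ℝ} (hy : y ∈ Metric.ball (0 : B) r)
    (hs : s ∈ Set.Icc (0 : ℝ) 1) : s • y ∈ Metric.ball (0 : B) r := by
  rw [mem_ball_zero_iff] at hy ⊢
  rw [norm_smul, Real.norm_of_nonneg hs.1]
  exact lt_of_le_of_lt (mul_le_of_le_one_left (norm_nonneg _) hs.2) hy

/-- A function annihilated by the Euler vector field is constant. -/
lemma eq_apply_zero_of_euler_eq_zero {h : B → G} {r : ℝ}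
    (hd : ∀ y ∈ Metric.ball (0 : B) r, DifferentiableAt ℝ h y)
    (he : ∀ y ∈ Metric.ball (0 : B) r, fderiv ℝ h y y = 0) {y : B}
    (hy : y ∈ Metric.ball (0 : B) r) : h y = h 0 := by
  have h0mem : (0 : B) ∈ Metric.ball (0 : B) r := by
    simpa using smul_mem_ball_zero hy (s := 0) (by simp)
  -- For t > 0 the derivative of t ↦ h(ty) is 1/t times the Euler derivative at ty, hence zero;
  -- continuity then gives the limit c → 0.
  have hconst : ∀ᶠ c in 𝓝[>] (0 : ℝ), h (c • y) = h y := by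
    filter_upwards [Ioo_mem_nhdsGT (zero_lt_one' ℝ)] with c hc
    have hpos : ∀ t ∈ Set.Icc c 1, 0 < t := fun t ht => hc.1.trans_le ht.1
    have hmem : ∀ t ∈ Set.Icc c 1, t • y ∈ Metric.ball (0 : B) r := fun t ht =>
      smul_mem_ball_zero hy ⟨(hpos t ht).le, ht.2⟩
    have h5 := (convex_Icc c 1).norm_image_sub_le_of_norm_hasDerivWithin_le (C := 0)
      (f := fun t => h (t • y)) (f' := fun t => fderiv ℝ h (t • y) y)
      (fun t ht => (hasDerivAt_comp_smul (hd _ (hmem t ht))).hasDerivWithinAt) (fun t ht => ?_)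
      (Set.left_mem_Icc.2 hc.2.le) (Set.right_mem_Icc.2 hc.2.le)
    · rw [zero_mul, norm_le_zero_iff, sub_eq_zero] at h5
      simpa using h5.symm
    · have h6 := he _ (hmem t ht)
      rw [map_smul, smul_eq_zero] at h6
      rw [h6.resolve_left (hpos t ht).ne', norm_zero]
  have hc : Tendsto (fun c : ℝ => h (c • y)) (𝓝 0) (𝓝 (h ((0 : ℝ) • y))) :=
    (hasDerivAt_comp_smul (h := h) (y := y) (s := 0)
      (by rw [zero_smul]; exact hd 0 h0mem)).continuousAt
  rw [zero_smul] at hc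
  exact tendsto_nhds_unique (tendsto_const_nhds.congr' (hconst.mono fun _ h => h.symm))
    (hc.mono_left nhdsWithin_le_nhds)

/-- A smooth function that is homogeneous of degree one is linear. -/
lemma eq_fderiv_zero_of_euler_eq_self {h : B → G} {r : ℝ}
    (hd : ∀ y ∈ Metric.ball (0 : B) r, DifferentiableAt ℝ h y)
    (he : ∀ y ∈ Metric.ball (0 : B) r, fderiv ℝ h y y = h y) {y : B}
    (hy : y ∈ Metric.ball (0 : B) r) : h y = fderiv ℝ h 0 y := by
  have h0mem : (0 : B) ∈ Metric.ball (0 : B) r := by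
    simpa using smul_mem_ball_zero hy (s := 0) (by simp)
  have h0 : h 0 = 0 := by simpa using (he 0 h0mem).symm
  have hd0 : HasDerivAt (fun s : ℝ => h (s • y)) (fderiv ℝ h 0 y) 0 := by
    have := hasDerivAt_comp_smul (h := h) (y := y) (s := 0) (by rw [zero_smul]; exact hd 0 h0mem)
    rwa [zero_smul] at this
  have hslope := hasDerivAt_iff_tendsto_slope_zero.1 hd0
  simp only [zero_add, zero_smul, h0, sub_zero] at hslope
  -- By the Euler equation h(ty)/t is constant for t in (0, 1], and its limit at t = 0 is the
  -- derivative of h at 0 in the direction y.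
  have hconst : ∀ᶠ c in 𝓝[>] (0 : ℝ), c⁻¹ • h (c • y) = h y := by
    filter_upwards [Ioo_mem_nhdsGT (zero_lt_one' ℝ)] with c hc
    have hpos : ∀ t ∈ Set.Icc c 1, 0 < t := fun t ht => hc.1.trans_le ht.1
    have hmem : ∀ t ∈ Set.Icc c 1, t • y ∈ Metric.ball (0 : B) r := fun t ht =>
      smul_mem_ball_zero hy ⟨(hpos t ht).le, ht.2⟩
    have h5 := (convex_Icc c 1).norm_image_sub_le_of_norm_hasDerivWithin_le (C := 0)
      (f := fun t => t⁻¹ • h (t • y)) (f' := fun _ => 0)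
      (fun t ht => ?_) (fun t ht => by simp)
      (Set.left_mem_Icc.2 hc.2.le) (Set.right_mem_Icc.2 hc.2.le)
    · rw [zero_mul, norm_le_zero_iff, sub_eq_zero] at h5
      simpa using h5.symm
    · have h6 := ((hasDerivAt_inv (hpos t ht).ne').smul
        (hasDerivAt_comp_smul (hd _ (hmem t ht)))).hasDerivWithinAt (s := Set.Icc c 1)
      convert! h6 using 1
      have h7 := he _ (hmem t ht)
      rw [map_smul] at h7
      rw [← h7, smul_smul, ← add_smul]
      have : t⁻¹ + -(t ^ 2)⁻¹ * t = 0 := by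
        have := (hpos t ht).ne'
        field_simp; ring
      rw [this, zero_smul]
  exact (tendsto_nhds_unique (hslope.mono_left (nhdsGT_le_nhdsNE 0))
    (tendsto_const_nhds.congr' (hconst.mono fun _ h => h.symm))).symm

end Euler

/-! ### Linearization of a vector field and of a connection along it, in a vector space -/

section EulerCoordinates

variable {B : Type*} [NormedAddCommGroup B] [NormedSpace ℝ B] [FiniteDimensional ℝ B]
  {G : Type*} [NormedAddCommGroup G] [NormedSpace ℝ G] [FiniteDimensional ℝ G]

/-- A vector field with linear part the identity is the image of the Euler vector field under the
germ of a smooth map tangent to the identity. -/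
lemma exists_euler_parametrization {X : B → B} (hX : ∀ᶠ x in 𝓝 0, ContDiffAt ℝ ∞ X x)
    (hX0 : X 0 = 0) (hXd : fderiv ℝ X 0 = .id ℝ B) :
    ∃ ψ : B → B, (∀ᶠ y in 𝓝 0, ContDiffAt ℝ ∞ ψ y) ∧ ψ 0 = 0 ∧
      fderiv ℝ ψ 0 = .id ℝ B ∧ ∀ᶠ y in 𝓝 0, fderiv ℝ ψ y y = X (ψ y) := by
  have := FiniteDimensional.complete ℝ B
  obtain ⟨X', hX', hXX'⟩ := exists_contDiff_eventuallyEq hX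
  have hX'0 : X' 0 = 0 := hXX'.eq_of_nhds.trans hX0
  have hX'd : fderiv ℝ X' 0 = .id ℝ B := hXX'.fderiv_eq.trans hXd
  -- Hadamard's lemma is used twice, first for X' - id and then for A, whose value at 0 is zero. The
  -- result is X'(x) = x + C(x)(x)(x).
  obtain ⟨A, hA, hA0, hAx⟩ := exists_contDiff_eq_apply_self
    (h := fun x => X' x - x) (hX'.sub contDiff_id) (by simp [hX'0])
  have hA0' : A 0 = 0 := by
    rw [hA0, fderiv_fun_sub (hX'.differentiable (by simp) 0) differentiableAt_fun_id, hX'd]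
    simp
  obtain ⟨C, hC, -, hCx⟩ := exists_contDiff_eq_apply_self hA hA0'
  have hw : ContDiff ℝ ∞ fun z : ℝ × B × B => z.2.1 + z.2.2 := by fun_prop
  have hT : ContDiff ℝ ∞ fun z : ℝ × B × B => C (z.1 • (z.2.1 + z.2.2)) (z.2.1 + z.2.2) :=
    (hC.comp (contDiff_fst.smul hw)).clm_apply hw
  -- With ψ = id + N, the equation dψ(y) y = X'(ψ(y)) reads dN(y) y = N + C(y + N)(y + N)(y + N),
  -- which is the case j = 1. The factor t inside C makes the right-hand side homogeneous of degree
  -- j + 1 = 2.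
  obtain ⟨N, hN, hN0, hNe, hNd⟩ := exists_radial_solution 1
    (fun z : ℝ × B × B => C (z.1 • (z.2.1 + z.2.2)) (z.2.1 + z.2.2) (z.2.1 + z.2.2))
    (hT.clm_apply hw) (fun t => by simp) (fun t e => by
      rw [fderiv_clm_apply (hT.differentiable (by simp) _) (hw.differentiable (by simp) _)]
      simp)
    (fun s t y e => by
      simp only [pow_one, ← smul_add, map_smul, smul_apply, smul_smul]
      rw [mul_comm t s]; congr 1; ring)
  have hψd : ∀ᶠ y in 𝓝 0, fderiv ℝ (fun y => y + N y) y = .id ℝ B + fderiv ℝ N y := by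
    filter_upwards [hN] with y hy
    rw [fderiv_fun_add differentiableAt_fun_id (hy.differentiableAt (by simp))]
    simp
  have hcont : Tendsto (fun y => y + N y) (𝓝 0) (𝓝 0) := by
    have : ContinuousAt (fun y => y + N y) 0 :=
      continuousAt_id.add hN.self_of_nhds.continuousAt
    simpa [ContinuousAt, hN0] using this
  refine ⟨fun y => y + N y, hN.mono fun y hy => contDiffAt_id.add hy, by simp [hN0], ?_, ?_⟩
  · rw [hψd.self_of_nhds, hNd one_ne_zero, add_zero]
  · filter_upwards [hψd, hNe, hcont.eventually hXX'] with y h1 h2 h3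
    rw [h1, ← h3, add_apply, h2, one_smul, ← hCx, ← hAx, Nat.cast_one, one_smul]
    simp only [ContinuousLinearMap.id_apply]
    abel

/-- Sternberg's theorem for a vector field with linear part the identity: there are smooth
coordinates in which it is the Euler vector field. -/
theorem exists_euler_chart {X : B → B} (hX : ∀ᶠ x in 𝓝 0, ContDiffAt ℝ ∞ X x)
    (hX0 : X 0 = 0) (hXd : fderiv ℝ X 0 = .id ℝ B) :
    ∃ φ : OpenPartialHomeomorph B B, 0 ∈ φ.source ∧ φ 0 = 0 ∧ ContDiffOn ℝ ∞ φ φ.source ∧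
      ContDiffOn ℝ ∞ φ.symm φ.target ∧ fderiv ℝ φ 0 = .id ℝ B ∧
      ∀ x ∈ φ.source, fderiv ℝ φ x (X x) = φ x := by
  have := FiniteDimensional.complete ℝ B
  obtain ⟨ψ, hψ, hψ0, hψd, hψe⟩ := exists_euler_parametrization hX hX0 hXd
  have hψ' : HasFDerivAt ψ ((ContinuousLinearEquiv.refl ℝ B : B ≃L[ℝ] B) : B →L[ℝ] B) 0 := by
    have := (hψ.self_of_nhds.differentiableAt (by simp)).hasFDerivAt
    rw [hψd] at this
    exact this
  let e := hψ.self_of_nhds.toOpenPartialHomeomorph ψ hψ' (by simp)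
  have he : ⇑e = ψ := hψ.self_of_nhds.toOpenPartialHomeomorph_coe hψ' (by simp)
  have he0 : (0 : B) ∈ e.source := hψ.self_of_nhds.mem_toOpenPartialHomeomorph_source hψ' (by simp)
  have hinv : ∀ᶠ y in 𝓝 (0 : B), (fderiv ℝ ψ y).IsInvertible := by
    have hc : ContinuousAt (fderiv ℝ ψ) 0 :=
      (hψ.self_of_nhds.fderiv_right (m := 0) (by simp)).continuousAt
    have h1 := (ContinuousLinearEquiv.refl ℝ B).nhds
    have := hc (by rw [hψd]; exact h1)
    filter_upwards [this] with y hy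
    exact hy
  -- The local inverse is restricted to points where ψ is smooth with invertible derivative, so that
  -- the inverse map is smooth on all of its domain.
  obtain ⟨S, hS, hSo, h0S⟩ := eventually_nhds_iff.1 (hψ.and (hψe.and hinv))
  let e' := e.restrOpen S hSo
  have he' : ⇑e' = ψ := he
  have hmem : ∀ y ∈ e'.source, y ∈ S := fun y hy => hy.2
  have h0e' : (0 : B) ∈ e'.source := ⟨he0, h0S⟩
  have hψat : ∀ x ∈ e'.target, ContDiffAt ℝ ∞ e'.symm x := by
    intro x hx
    obtain ⟨h1, -, T, hT⟩ := hS _ (hmem _ (e'.map_target hx))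
    refine e'.contDiffAt_symm (f₀' := T) hx ?_ (by rw [he']; exact h1)
    rw [he', hT]
    exact (h1.differentiableAt (by simp)).hasFDerivAt
  have hcompd : ∀ y ∈ e'.source, fderiv ℝ e'.symm (ψ y) ∘L fderiv ℝ ψ y = .id ℝ B := by
    intro y hy
    have h1 := (hψat (ψ y) (by rw [← he']; exact e'.map_source hy)).differentiableAt (by simp)
    have h2 := (hS _ (hmem _ hy)).1.differentiableAt (by simp)
    rw [← fderiv_comp y h1 h2]
    have h3 : e'.symm ∘ ψ =ᶠ[𝓝 y] id := by
      filter_upwards [e'.open_source.mem_nhds hy] with z hz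
      rw [← he']; exact e'.left_inv hz
    rw [h3.fderiv_eq, fderiv_id]
  refine ⟨e'.symm, ?_, ?_, fun x hx => (hψat x hx).contDiffWithinAt, fun y hy => ?_, ?_,
    fun x hx => ?_⟩
  · have := e'.map_source h0e'
    rwa [he', hψ0] at this
  · have := e'.left_inv h0e'
    rwa [he', hψ0] at this
  · rw [OpenPartialHomeomorph.symm_symm, he']
    exact (hS _ (hmem _ hy)).1.contDiffWithinAt
  · have := hcompd 0 h0e'
    rw [hψd, hψ0] at this
    exact this
  · have hy := e'.map_target hx
    have hxy : ψ (e'.symm x) = x := by rw [← he']; exact e'.right_inv hx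
    -- With y the preimage of x, X(x) = dψ(y) y, so the derivative of the inverse map sends X(x) to
    -- y.
    have h1 := congrArg (fun T : B →L[ℝ] B => T (e'.symm x)) (hcompd _ hy)
    simp only [ContinuousLinearMap.comp_apply, (hS _ (hmem _ hy)).2.1, hxy] at h1
    exact h1

/-- A linear connection-like equation along the Euler vector field, `dk(y) y = -a(y) k(y)`, with
`a(0) = 0`, has a smooth fundamental solution near `0`. -/
theorem exists_euler_frame {a : B → G →L[ℝ] G} (ha : ∀ᶠ x in 𝓝 0, ContDiffAt ℝ ∞ a x)
    (ha0 : a 0 = 0) :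
    ∃ k : B → G →L[ℝ] G, (∀ᶠ y in 𝓝 0, ContDiffAt ℝ ∞ k y) ∧ k 0 = .id ℝ G ∧
      ∀ᶠ y in 𝓝 0, fderiv ℝ k y y = -(a y ∘L k y) := by
  have := FiniteDimensional.complete ℝ B
  have := FiniteDimensional.complete ℝ G
  obtain ⟨a', ha', haa'⟩ := exists_contDiff_eventuallyEq ha
  obtain ⟨C, hC, -, hCx⟩ := exists_contDiff_eq_apply_self ha' (haa'.eq_of_nhds.trans ha0)
  have hT : ContDiff ℝ ∞ fun z : ℝ × B × (G →L[ℝ] G) => C (z.1 • z.2.1) z.2.1 :=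
    (hC.comp (contDiff_fst.smul contDiff_snd.fst)).clm_apply contDiff_snd.fst
  have hU : ContDiff ℝ ∞ fun z : ℝ × B × (G →L[ℝ] G) => -(.id ℝ G + z.2.2) := by fun_prop
  have hTd : ∀ (t : ℝ) (e : G →L[ℝ] G),
      fderiv ℝ (fun z : ℝ × B × (G →L[ℝ] G) => C (z.1 • z.2.1) z.2.1) (t, 0, 0) (0, 0, e) = 0 := by
    intro t e
    have h1 : HasFDerivAt (fun z : ℝ × B × (G →L[ℝ] G) => z.2.1)
        ((ContinuousLinearMap.fst ℝ B (G →L[ℝ] G)).comp (.snd ℝ ℝ _)) (t, 0, 0) :=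
      (hasFDerivAt_snd (p := (t, (0 : B), (0 : G →L[ℝ] G)))).fst
    have h2 : ContDiff ℝ ∞ fun z : ℝ × B × (G →L[ℝ] G) => C (z.1 • z.2.1) :=
      hC.comp (contDiff_fst.smul contDiff_snd.fst)
    rw [((h2.differentiable (by simp) (t, 0, 0)).hasFDerivAt.clm_apply h1).fderiv]
    simp
  -- With k = id + N and a(y) = C(y) y, the equation becomes dN(y) y = -(C(y) y)(id + N), which is
  -- the case j = 0.
  obtain ⟨N, hN, hN0, hNe, -⟩ := exists_radial_solution 0
    (fun z : ℝ × B × (G →L[ℝ] G) => (C (z.1 • z.2.1) z.2.1) ∘L (-(.id ℝ G + z.2.2)))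
    (hT.clm_comp hU) (fun t => by simp) (fun t e => by
      rw [((hT.differentiable (by simp) (t, 0, 0)).hasFDerivAt.clm_comp
        (hU.differentiable (by simp) (t, 0, 0)).hasFDerivAt).fderiv]
      simp [hTd])
    (fun s t y e => by
      simp only [pow_zero, one_smul, zero_add, pow_one, map_smul, smul_smul, mul_comm t s,
        ContinuousLinearMap.smul_comp])
  refine ⟨fun y => .id ℝ G + N y, hN.mono fun y hy => contDiffAt_const.add hy, by simp [hN0], ?_⟩
  filter_upwards [hN, hNe, haa'] with y h1 h2 h3
  rw [fderiv_const_add, h2, ← h3, hCx]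
  simp

end EulerCoordinates

/-! ### Calculus of sections and of vector-valued functions on a manifold -/

section SectionCalculus

variable {B : Type*} [NormedAddCommGroup B] [NormedSpace ℝ B]
  {M : Type*} [TopologicalSpace M] [ChartedSpace B M] [IsManifold 𝓘(ℝ, B) ∞ M]
  {F : Type*} [NormedAddCommGroup F] [NormedSpace ℝ F]
  {V : M → Type*} [TopologicalSpace (TotalSpace F V)] [∀ x, TopologicalSpace (V x)]
  [∀ x, AddCommGroup (V x)] [∀ x, Module ℝ (V x)] [FiberBundle F V] [VectorBundle ℝ F V]

lemma SmoothFun.smulSection_apply (f : SmoothFun B M) (s : SmoothSection B F V) (q : M) :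
    f.smulSection s q = f q • s q := rfl

lemma SmoothFun.mdifferentiableAt (f : SmoothFun B M) (q : M) :
    MDifferentiableAt 𝓘(ℝ, B) 𝓘(ℝ, ℝ) f q :=
  f.contMDiff.mdifferentiable (by simp) q

lemma smoothSection_sum_apply {ι : Type*} (t : Finset ι) (s : ι → SmoothSection B F V) (q : M) :
    (∑ i ∈ t, s i) q = ∑ i ∈ t, s i q := by
  have := map_sum (ContMDiffSection.coeAddHom 𝓘(ℝ, B) F ∞ V) s t
  exact (congrFun this q).trans (Finset.sum_apply _ _ _)

lemma SmoothFun.smooth_derivAlong (f : SmoothFun B M)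
    (Y : SmoothSection B B (TangentSpace 𝓘(ℝ, B) : M → Type _)) :
    ContMDiff 𝓘(ℝ, B) 𝓘(ℝ, ℝ) ∞ (fun q => differential (B := B) f q (Y q)) :=
  (contMDiff_snd_tangentBundle_modelSpace ℝ 𝓘(ℝ, ℝ)).comp
    ((f.contMDiff.contMDiff_tangentMap (m := ∞) (by simp)).comp Y.contMDiff)

/-- The derivative of a smooth function along a smooth vector field. -/
def SmoothFun.derivAlong (f : SmoothFun B M)
    (Y : SmoothSection B B (TangentSpace 𝓘(ℝ, B) : M → Type _)) : SmoothFun B M :=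
  ⟨_, f.smooth_derivAlong Y⟩

lemma differential_congr {f g : M → ℝ} {q : M} (h : f =ᶠ[𝓝 q] g) :
    differential (B := B) f q = differential g q := h.mfderiv_eq

/-- The differential of a vector-valued map. -/
def vectorDifferential (g : M → F) (q : M) : Tan B q →L[ℝ] F := mfderiv 𝓘(ℝ, B) 𝓘(ℝ, F) g q

lemma vectorDifferential_congr {f g : M → F} {q : M} (h : f =ᶠ[𝓝 q] g) :
    vectorDifferential (B := B) f q = vectorDifferential g q := h.mfderiv_eq

/-- The differential of a product of a function and a vector-valued map. -/
lemma vectorDifferential_smul_apply {f : M → ℝ} {g : M → F} {q : M}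
    (hf : MDifferentiableAt 𝓘(ℝ, B) 𝓘(ℝ, ℝ) f q) (hg : MDifferentiableAt 𝓘(ℝ, B) 𝓘(ℝ, F) g q)
    (w : Tan B q) :
    vectorDifferential (fun r => f r • g r) q w =
      f q • vectorDifferential g q w + differential f q w • g q := by
  let f' : Tan B q →L[ℝ] ℝ := differential f q
  let T : Tan B q →L[ℝ] F := f q • vectorDifferential g q + f'.smulRight (g q)
  have h : HasMFDerivAt 𝓘(ℝ, B) 𝓘(ℝ, F) (fun r => f r • g r) q T := by
    have hf' := hf.hasMFDerivAt
    have hg' := hg.hasMFDerivAt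
    refine ⟨hf'.1.smul hg'.1, ?_⟩
    have h2 := hf'.2.smul hg'.2
    have h3 : (extChartAt 𝓘(ℝ, B) q).symm (extChartAt 𝓘(ℝ, B) q q) = q :=
      extChartAt_to_inv q
    simp only [writtenInExtChartAt, Function.comp, h3, extChartAt_model_space_eq_id,
      PartialEquiv.refl_coe, id] at h2 ⊢
    exact h2
  exact congrArg (fun T : Tan B q →L[ℝ] F => T w) h.mfderiv

/-- The differential of a linear map composed with a vector-valued map. -/
lemma vectorDifferential_linear_comp {G : Type*} [NormedAddCommGroup G] [NormedSpace ℝ G]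
    (L : F →L[ℝ] G) {g : M → F} {q : M} (hg : MDifferentiableAt 𝓘(ℝ, B) 𝓘(ℝ, F) g q) :
    vectorDifferential (B := B) (fun r => L (g r)) q = L ∘L vectorDifferential g q :=
  ((L.hasMFDerivAt (x := g q)).comp q hg.hasMFDerivAt).mfderiv

section

variable [FiniteDimensional ℝ B] [T2Space M]

lemma exists_smoothFun_tsupport_subset {q : M} {S : Set M} (hS : S ∈ 𝓝 q) :
    ∃ χ : SmoothFun B M, (∀ᶠ r in 𝓝 q, χ r = 1) ∧ tsupport χ ⊆ S := by
  obtain ⟨χ, -, h⟩ := (SmoothBumpFunction.nhds_basis_tsupport (I := 𝓘(ℝ, B)) q).mem_iff.1 hS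
  exact ⟨⟨χ, χ.contMDiff⟩, χ.eventuallyEq_one, h⟩

variable [ContMDiffVectorBundle ∞ F V 𝓘(ℝ, B)]

lemma sectionLinearPart_congr {p : M} {s t : SmoothSection B F V} (h : ∀ᶠ q in 𝓝 p, s q = t q) :
    sectionLinearPart B F V p s = sectionLinearPart B F V p t := by
  have h1 : (fun q => (trivializationAt F V p ⟨q, s q⟩).2) =ᶠ[𝓝 p]
      (fun q => (trivializationAt F V p ⟨q, t q⟩).2) := by
    filter_upwards [h] with q hq
    rw [hq]
  ext w
  exact congrArg (fun T : B →L[ℝ] F =>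
    (VectorBundle.continuousLinearEquivAt ℝ F V p).symm (T w)) h1.mfderiv_eq

/-- The product rule for linear parts of sections. -/
lemma sectionLinearPart_smulSection (p : M) (f : SmoothFun B M) (s : SmoothSection B F V)
    (w : Tan B p) :
    sectionLinearPart B F V p (f.smulSection s) w =
      f p • sectionLinearPart B F V p s w + differential f p w • s p := by
  have h : (fun q => (trivializationAt F V p ⟨q, f.smulSection s q⟩).2) =ᶠ[𝓝 p]
      fun q => f q • (trivializationAt F V p ⟨q, s q⟩).2 := by
    filter_upwards [(trivializationAt F V p).open_baseSet.mem_nhds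
      (mem_baseSet_trivializationAt F V p)] with q hq
    exact ((trivializationAt F V p).linear ℝ hq).2 (f q) (s q)
  have h2 := (congrArg (fun T => T w) (vectorDifferential_congr (B := B) h)).trans
    (vectorDifferential_smul_apply (f.mdifferentiableAt p)
      (mdifferentiableAt_section_coord p s) w)
  have h3 : (VectorBundle.continuousLinearEquivAt ℝ F V p).symm
      (trivializationAt F V p ⟨p, s p⟩).2 = s p :=
    (VectorBundle.continuousLinearEquivAt ℝ F V p).symm_apply_apply (s p)
  refine (congrArg (VectorBundle.continuousLinearEquivAt ℝ F V p).symm h2).trans ?_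
  rw [map_add, map_smul, map_smul, h3]
  rfl

end

end SectionCalculus

/-! ### Locality of the bracket -/

namespace AlmostLodayAlgebroid

section Locality

variable {B : Type*} [NormedAddCommGroup B] [NormedSpace ℝ B]
  {M : Type*} [TopologicalSpace M] [ChartedSpace B M] [IsManifold 𝓘(ℝ, B) ∞ M]
  {F : Type*} [NormedAddCommGroup F] [NormedSpace ℝ F]
  {V : M → Type*} [TopologicalSpace (TotalSpace F V)] [∀ x, TopologicalSpace (V x)]
  [∀ x, AddCommGroup (V x)] [∀ x, Module ℝ (V x)] [FiberBundle F V] [VectorBundle ℝ F V]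

/-- The derivative `ρ(α) f`. -/
def anchorDeriv (A : AlmostLodayAlgebroid B F V) (α : SmoothSection B F V) (f : SmoothFun B M) :
    SmoothFun B M :=
  f.derivAlong (A.anchorSection α)

lemma anchorDeriv_apply (A : AlmostLodayAlgebroid B F V) (α : SmoothSection B F V)
    (f : SmoothFun B M) (q : M) :
    A.anchorDeriv α f q = differential (B := B) f q (A.anchor q (α q)) := rfl

lemma bracket_smulSection_right (A : AlmostLodayAlgebroid B F V) (α β : SmoothSection B F V)
    (f : SmoothFun B M) :
    A.bracket α (f.smulSection β) =
      f.smulSection (A.bracket α β) + (A.anchorDeriv α f).smulSection β := by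
  ext q
  exact A.leibniz_right α β f q

/-- The left Leibniz rule solved for the co-anchor. In this form the Jacobi identity applies to the
co-anchor too. -/
lemma coanchorSection_eq (A : AlmostLodayAlgebroid B F V) (α β : SmoothSection B F V)
    (f : SmoothFun B M) :
    A.coanchorSection f α β = A.bracket (f.smulSection α) β - f.smulSection (A.bracket α β) +
      (A.anchorDeriv β f).smulSection α := by
  ext q
  have h := A.leibniz_left α β f q
  change A.coanchor q (differential f q) (α q) (β q) =
    A.bracket (f.smulSection α) β q - f q • A.bracket α β q +
      differential (B := B) f q (A.anchor q (β q)) • α q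
  rw [h]
  abel

variable [FiniteDimensional ℝ B] [T2Space M]

/-- Take χ equal to 1 near q and supported where β vanishes. Then χβ = 0, and the Leibniz rule for
[α, χβ] at q leaves only [α, β](q), as β(q) = 0. -/
lemma bracket_apply_eq_zero_of_eventually_right (A : AlmostLodayAlgebroid B F V)
    (α : SmoothSection B F V) {β : SmoothSection B F V} {q : M} (h : ∀ᶠ r in 𝓝 q, β r = 0) :
    A.bracket α β q = 0 := by
  obtain ⟨χ, h1, h2⟩ := exists_smoothFun_tsupport_subset (B := B) h
  have h3 : χ.smulSection β = 0 := by
    ext r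
    change χ r • β r = 0
    by_cases hr : r ∈ tsupport χ
    · rw [show β r = 0 from h2 hr, smul_zero]
    · rw [image_eq_zero_of_notMem_tsupport hr, zero_smul]
  have h4 := A.leibniz_right α β χ q
  rw [h3, map_zero, h1.self_of_nhds, h.self_of_nhds, one_smul, smul_zero, add_zero] at h4
  exact h4.symm

lemma bracket_apply_eq_zero_of_eventually_left (A : AlmostLodayAlgebroid B F V)
    {α : SmoothSection B F V} (β : SmoothSection B F V) {q : M} (h : ∀ᶠ r in 𝓝 q, α r = 0) :
    A.bracket α β q = 0 := by
  obtain ⟨χ, h1, h2⟩ := exists_smoothFun_tsupport_subset (B := B) h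
  have h3 : χ.smulSection α = 0 := by
    ext r
    change χ r • α r = 0
    by_cases hr : r ∈ tsupport χ
    · rw [show α r = 0 from h2 hr, smul_zero]
    · rw [image_eq_zero_of_notMem_tsupport hr, zero_smul]
  have h4 := A.leibniz_left α β χ q
  rw [h3, map_zero, h1.self_of_nhds, h.self_of_nhds, one_smul, smul_zero, sub_zero, map_zero,
    LinearMap.zero_apply, LinearMap.zero_apply, add_zero] at h4
  exact h4.symm

lemma bracket_congr_right (A : AlmostLodayAlgebroid B F V) (α : SmoothSection B F V)
    {β β' : SmoothSection B F V} {q : M} (h : ∀ᶠ r in 𝓝 q, β r = β' r) :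
    A.bracket α β q = A.bracket α β' q := by
  have h1 := A.bracket_apply_eq_zero_of_eventually_right α (β := β - β') (q := q)
    (h.mono fun r hr => sub_eq_zero.2 hr)
  rw [map_sub] at h1
  exact sub_eq_zero.1 h1

lemma bracket_congr_left (A : AlmostLodayAlgebroid B F V) {α α' : SmoothSection B F V}
    (β : SmoothSection B F V) {q : M} (h : ∀ᶠ r in 𝓝 q, α r = α' r) :
    A.bracket α β q = A.bracket α' β q := by
  have h1 := A.bracket_apply_eq_zero_of_eventually_left (α := α - α') β (q := q)
    (h.mono fun r hr => sub_eq_zero.2 hr)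
  rw [map_sub] at h1
  exact sub_eq_zero.1 h1

end Locality

end AlmostLodayAlgebroid

/-! ### Local frames made of global sections -/

section LocalFrames

variable {B : Type*} [NormedAddCommGroup B] [NormedSpace ℝ B]
  {M : Type*} [TopologicalSpace M] [ChartedSpace B M] [IsManifold 𝓘(ℝ, B) ∞ M]
  {F : Type*} [NormedAddCommGroup F] [NormedSpace ℝ F]
  {V : M → Type*} [TopologicalSpace (TotalSpace F V)] [∀ x, TopologicalSpace (V x)]
  [∀ x, AddCommGroup (V x)] [∀ x, Module ℝ (V x)] [FiberBundle F V] [VectorBundle ℝ F V]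

variable (B F V) in
/-- A local frame of `V` on a neighbourhood of `p`, by smooth sections of `V` over all of `M`,
together with globally defined smooth functions that on this neighbourhood are the components of a
section in this frame. -/
structure LocalFrame [FiniteDimensional ℝ F] (p : M) where
  /-- The neighbourhood of `p`. -/
  domain : Set M
  isOpen_domain : IsOpen domain
  mem_domain : p ∈ domain
  /-- The components of a vector. -/
  coeff : ∀ q, V q →ₗ[ℝ] F
  /-- The section with given constant components. -/
  sec : F →ₗ[ℝ] SmoothSection B F V
  coeff_sec : ∀ q ∈ domain, ∀ w, coeff q (sec w q) = w
  sec_coeff : ∀ q ∈ domain, ∀ e, sec (coeff q e) q = e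
  smooth_coeff : ContMDiffOn (𝓘(ℝ, B).prod 𝓘(ℝ, F)) 𝓘(ℝ, F) ∞
    (fun z : TotalSpace F V => coeff z.1 z.2) (TotalSpace.proj ⁻¹' domain)
  /-- The components of a section in a basis of `F`. -/
  comp : Fin (finrank ℝ F) → SmoothSection B F V → SmoothFun B M
  comp_apply : ∀ q ∈ domain, ∀ i s, comp i s q = (finBasis ℝ F).coord i (coeff q (s q))

variable [FiniteDimensional ℝ F]

namespace LocalFrame

variable {p : M} (Θ : LocalFrame B F V p)

lemma eventually_mem {q : M} (hq : q ∈ Θ.domain) : ∀ᶠ r in 𝓝 q, r ∈ Θ.domain :=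
  Θ.isOpen_domain.mem_nhds hq

lemma sum_coord_smul_sec {q : M} (hq : q ∈ Θ.domain) (e : V q) :
    ∑ i, (finBasis ℝ F).coord i (Θ.coeff q e) • Θ.sec (finBasis ℝ F i) q = e := by
  conv_rhs => rw [← Θ.sec_coeff q hq e, ← (finBasis ℝ F).sum_repr (Θ.coeff q e), map_sum,
    smoothSection_sum_apply]
  refine Finset.sum_congr rfl fun i _ => ?_
  rw [map_smul]; rfl

lemma sum_comp_smul_sec {q : M} (hq : q ∈ Θ.domain) (s : SmoothSection B F V) :
    (∑ i, (Θ.comp i s).smulSection (Θ.sec (finBasis ℝ F i)) : SmoothSection B F V) q = s q := by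
  rw [smoothSection_sum_apply, ← Θ.sum_coord_smul_sec hq (s q)]
  refine Finset.sum_congr rfl fun i _ => ?_
  rw [SmoothFun.smulSection_apply, Θ.comp_apply q hq]

lemma coord_sum_smul_sec {q : M} (hq : q ∈ Θ.domain) (c : Fin (finrank ℝ F) → ℝ)
    (i : Fin (finrank ℝ F)) :
    (finBasis ℝ F).coord i (Θ.coeff q (∑ j, c j • Θ.sec (finBasis ℝ F j) q)) = c i := by
  simp only [map_sum, map_smul, Θ.coeff_sec q hq]
  simp [Finsupp.single_apply]

/-- The vector with given components depends smoothly on the components and the base point. -/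
lemma smooth_sec [ContMDiffVectorBundle ∞ F V 𝓘(ℝ, B)] :
    ContMDiff (𝓘(ℝ, B).prod 𝓘(ℝ, F)) (𝓘(ℝ, B).prod 𝓘(ℝ, F)) ∞
      (fun z : M × F => (⟨z.1, Θ.sec z.2 z.1⟩ : TotalSpace F V)) := by
  intro z
  let e := trivializationAt F V z.1
  refine contMDiffAt_totalSpace.2 ⟨contMDiffAt_fst, ?_⟩
  have h1 : ContMDiffAt (𝓘(ℝ, B).prod 𝓘(ℝ, F)) 𝓘(ℝ, F) ∞ (fun y : M × F =>
      ∑ i, (finBasis ℝ F).coord i y.2 • (e ⟨y.1, Θ.sec (finBasis ℝ F i) y.1⟩).2) z := by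
    have h2 (i) : ContMDiffAt (𝓘(ℝ, B).prod 𝓘(ℝ, F)) 𝓘(ℝ, F) ∞ (fun y : M × F =>
        (finBasis ℝ F).coord i y.2 • (e ⟨y.1, Θ.sec (finBasis ℝ F i) y.1⟩).2) z :=
      (((finBasis ℝ F).coord i).toContinuousLinearMap.contMDiff.contMDiffAt.comp z
        contMDiffAt_snd).smul
        (((contMDiffAt_section z.1).1 ((Θ.sec (finBasis ℝ F i)).contMDiff z.1)).comp z
          contMDiffAt_fst)
    exact contMDiffAt_finsetSum fun i _ => h2 i
  refine h1.congr_of_eventuallyEq ?_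
  filter_upwards [continuousAt_fst.preimage_mem_nhds (e.open_baseSet.mem_nhds
    (mem_baseSet_trivializationAt F V z.1))] with y hy
  have h2 : ∀ v : V y.1, (e ⟨y.1, v⟩).2 = e.linearMapAt ℝ y.1 v := fun v =>
    (congrFun (e.coe_linearMapAt_of_mem hy) v).symm
  change (e ⟨y.1, Θ.sec y.2 y.1⟩).2 = _
  simp only [h2]
  conv_lhs => rw [← (finBasis ℝ F).sum_repr y.2, map_sum, smoothSection_sum_apply, map_sum]
  refine Finset.sum_congr rfl fun i _ => ?_
  rw [map_smul]
  exact map_smul (e.linearMapAt ℝ y.1) _ _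

variable [FiniteDimensional ℝ B] [T2Space M] [ContMDiffVectorBundle ∞ F V 𝓘(ℝ, B)]

/-- The differential at `p` of the components of a section that vanishes at `p`. -/
lemma differential_comp_apply {s : SmoothSection B F V} (hs : s p = 0) (i : Fin (finrank ℝ F))
    (w : Tan B p) :
    differential (Θ.comp i s) p w =
      (finBasis ℝ F).coord i (Θ.coeff p (sectionLinearPart B F V p s w)) := by
  have h1 := sectionLinearPart_congr ((Θ.eventually_mem Θ.mem_domain).mono fun q hq =>
    (Θ.sum_comp_smul_sec hq s).symm)
  rw [h1, map_sum, LinearMap.sum_apply]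
  simp only [sectionLinearPart_smulSection, Θ.comp_apply p Θ.mem_domain, hs, map_zero, zero_smul,
    zero_add]
  rw [Θ.coord_sum_smul_sec Θ.mem_domain]

end LocalFrame

variable [FiniteDimensional ℝ B] [T2Space M] [ContMDiffVectorBundle ∞ F V 𝓘(ℝ, B)]

variable (V) in
/-- The local frame obtained from the preferred trivialization by a matrix of smooth functions. -/
lemma exists_localFrame {p : M} {K : M → F →L[ℝ] F}
    (hK : ∀ᶠ q in 𝓝 p, ContMDiffAt 𝓘(ℝ, B) 𝓘(ℝ, F →L[ℝ] F) ∞ K q)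
    (hinv : ∀ᶠ q in 𝓝 p, (K q).IsInvertible) :
    ∃ Θ : LocalFrame B F V p, ∀ q ∈ Θ.domain, q ∈ (trivializationAt F V p).baseSet ∧
      ContMDiffAt 𝓘(ℝ, B) 𝓘(ℝ, F →L[ℝ] F) ∞ K q ∧ (K q).IsInvertible ∧
      (∀ e : V q, Θ.coeff q e = (K q).inverse (trivializationAt F V p ⟨q, e⟩).2) ∧
      ∀ w : F, Θ.sec w q = (trivializationAt F V p).symmₗ ℝ q (K q w) := by
  have := FiniteDimensional.complete ℝ F
  let e := trivializationAt F V p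
  obtain ⟨S, hS, hSo, hpS⟩ := eventually_nhds_iff.1 (hK.and (hinv.and
    (e.open_baseSet.mem_nhds (mem_baseSet_trivializationAt F V p))))
  obtain ⟨χ, hχ1, hχS⟩ := exists_smoothFun_tsupport_subset (B := B) (hSo.mem_nhds hpS)
  -- Sections and components are cut off by χ to be globally smooth; the frame identities hold on D,
  -- where χ = 1.
  obtain ⟨D, hD, hDo, hpD⟩ := eventually_nhds_iff.1 (hχ1.and (hSo.mem_nhds hpS))
  have hbase : S ⊆ e.baseSet := fun q hq => (hS q hq).2.2
  let Kinv : M → F →L[ℝ] F := fun q => (K q).inverse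
  have hKinv : ∀ q ∈ S, ContMDiffAt 𝓘(ℝ, B) 𝓘(ℝ, F →L[ℝ] F) ∞ Kinv q := fun q hq =>
    ((hS q hq).2.1.contDiffAt_map_inverse (n := ∞)).contMDiffAt.comp q (hS q hq).1
  have hKK : ∀ q ∈ S, ∀ w, Kinv q (K q w) = w := fun q hq w => by
    change (K q).inverse (K q w) = w
    obtain ⟨T, hT⟩ := (hS q hq).2.1
    rw [← hT, ContinuousLinearMap.inverse_equiv]; simp
  have hKK' : ∀ q ∈ S, ∀ w, K q (Kinv q w) = w := fun q hq w => by
    change K q ((K q).inverse w) = w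
    obtain ⟨T, hT⟩ := (hS q hq).2.1
    rw [← hT, ContinuousLinearMap.inverse_equiv]; simp
  have hsec : ∀ w : F, ContMDiff 𝓘(ℝ, B) (𝓘(ℝ, B).prod 𝓘(ℝ, F)) ∞
      (fun q => (⟨q, χ q • e.symmₗ ℝ q (K q w)⟩ : TotalSpace F V)) := by
    intro w
    refine ContMDiffOn.smul_section_of_tsupport (ψ := χ)
      (s := fun q => e.symmₗ ℝ q (K q w)) χ.contMDiff.contMDiffOn hSo hχS ?_
    rw [e.contMDiffOn_section_iff hSo hbase]
    have h1 : ContMDiffOn 𝓘(ℝ, B) 𝓘(ℝ, F) ∞ (fun q => K q w) S := fun q hq =>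
      ((hS q hq).1.clm_apply contMDiffAt_const).contMDiffWithinAt
    refine h1.congr fun q hq => ?_
    rw [Trivialization.symmₗ_apply _ (hbase hq), Trivialization.apply_mk_symm _ (hbase hq)]
  have hcomp : ∀ (i : Fin (finrank ℝ F)) (s : SmoothSection B F V), ContMDiff 𝓘(ℝ, B) 𝓘(ℝ, ℝ) ∞
      (fun q => χ q • (finBasis ℝ F).coord i (Kinv q (e ⟨q, s q⟩).2)) := by
    intro i s
    refine contMDiff_of_tsupport fun q hq => ?_
    have hq' : q ∈ S := hχS (tsupport_smul_subset_left _ _ hq)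
    have h1 : ContMDiffAt 𝓘(ℝ, B) 𝓘(ℝ, F) ∞ (fun q => (e ⟨q, s q⟩).2) q :=
      (e.contMDiffAt_section_iff (hbase hq')).1 (s.contMDiff q)
    have h2 : ContMDiff 𝓘(ℝ, F) 𝓘(ℝ, ℝ) ∞ ((finBasis ℝ F).coord i).toContinuousLinearMap :=
      ((finBasis ℝ F).coord i).toContinuousLinearMap.contMDiff
    exact χ.contMDiff.contMDiffAt.smul
      (h2.contMDiffAt.comp q ((hKinv q hq').clm_apply h1))
  have hDS : ∀ q ∈ D, q ∈ S := fun q hq => (hD q hq).2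
  have hsym : ∀ q ∈ D, ∀ w, e.linearMapAt ℝ q (e.symmₗ ℝ q w) = w := fun q hq w =>
    e.linearMapAt_symmₗ (hbase (hDS q hq)) w
  let Θ : LocalFrame B F V p :=
    { domain := D
      isOpen_domain := hDo
      mem_domain := hpD
      coeff := fun q => (Kinv q).toLinearMap.comp (e.linearMapAt ℝ q)
      sec :=
        { toFun := fun w => ⟨fun q => χ q • e.symmₗ ℝ q (K q w), hsec w⟩
          map_add' := fun u w => by
            ext q
            change χ q • e.symmₗ ℝ q (K q (u + w)) =
              χ q • e.symmₗ ℝ q (K q u) + χ q • e.symmₗ ℝ q (K q w)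
            rw [map_add, map_add, smul_add]
          map_smul' := fun c w => by
            ext q
            change χ q • e.symmₗ ℝ q (K q (c • w)) = c • χ q • e.symmₗ ℝ q (K q w)
            rw [map_smul, map_smul, smul_comm] }
      coeff_sec := fun q hq w => by
        change Kinv q (e.linearMapAt ℝ q (χ q • e.symmₗ ℝ q (K q w))) = w
        rw [(hD q hq).1, one_smul, hsym q hq, hKK q (hDS q hq)]
      sec_coeff := fun q hq v => by
        change χ q • e.symmₗ ℝ q (K q (Kinv q (e.linearMapAt ℝ q v))) = v
        rw [(hD q hq).1, one_smul, hKK' q (hDS q hq),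
          e.symmₗ_linearMapAt (hbase (hDS q hq))]
      smooth_coeff := fun z hz => by
        have hzS : z.1 ∈ S := hDS z.1 hz
        have h1 : ContMDiffAt (𝓘(ℝ, B).prod 𝓘(ℝ, F)) 𝓘(ℝ, F) ∞ (fun z => (e z).2) z :=
          ((e.contMDiffOn (IB := 𝓘(ℝ, B)) (n := ∞)).contMDiffAt (e.open_source.mem_nhds
            (e.mem_source.2 (hbase hzS)))).snd
        have h2 := ((hKinv z.1 hzS).comp z (contMDiffAt_proj V)).clm_apply h1
        refine (h2.congr_of_eventuallyEq ?_).contMDiffWithinAt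
        filter_upwards [(FiberBundle.continuous_proj F V).continuousAt.preimage_mem_nhds
          (hSo.mem_nhds hzS)] with y hy
        change Kinv y.1 (e.linearMapAt ℝ y.1 y.2) = Kinv y.1 (e y).2
        rw [e.coe_linearMapAt_of_mem (hbase hy)]
      comp := fun i s => ⟨_, hcomp i s⟩
      comp_apply := fun q hq i s => by
        change χ q • (finBasis ℝ F).coord i (Kinv q (e ⟨q, s q⟩).2) =
          (finBasis ℝ F).coord i (Kinv q (e.linearMapAt ℝ q (s q)))
        rw [(hD q hq).1, one_smul, e.coe_linearMapAt_of_mem (hbase (hDS q hq))] }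
  refine ⟨Θ, fun q hq => ⟨hbase (hDS q hq), (hS q (hDS q hq)).1, (hS q (hDS q hq)).2.1,
    fun v => ?_, fun w => ?_⟩⟩
  · change Kinv q (e.linearMapAt ℝ q v) = _
    rw [e.coe_linearMapAt_of_mem (hbase (hDS q hq))]
  · change χ q • e.symmₗ ℝ q (K q w) = _
    rw [(hD q hq).1, one_smul]

variable (B F V) in
/-- The local frame of the preferred trivialization. -/
lemma exists_localFrame_trivializationAt (p : M) :
    ∃ Θ : LocalFrame B F V p, ∀ q ∈ Θ.domain, q ∈ (trivializationAt F V p).baseSet ∧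
      (∀ e : V q, Θ.coeff q e = (trivializationAt F V p ⟨q, e⟩).2) ∧
      ∀ w : F, Θ.sec w q = (trivializationAt F V p).symmₗ ℝ q w := by
  obtain ⟨Θ, hΘ⟩ := exists_localFrame (B := B) V (p := p) (K := fun _ => .id ℝ F)
    (Eventually.of_forall fun _ => contMDiffAt_const)
    (Eventually.of_forall fun _ => ⟨.refl ℝ F, rfl⟩)
  refine ⟨Θ, fun q hq => ?_⟩
  obtain ⟨h1, -, -, h2, h3⟩ := hΘ q hq
  exact ⟨h1, fun v => by rw [h2, ContinuousLinearMap.inverse_id]; rfl, h3⟩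

end LocalFrames

/-! ### Coordinate functions and frames of vector fields -/

section LinearParts

variable {B : Type*} [NormedAddCommGroup B] [NormedSpace ℝ B]
  {M : Type*} [TopologicalSpace M] [ChartedSpace B M] [IsManifold 𝓘(ℝ, B) ∞ M]
  {F : Type*} [NormedAddCommGroup F] [NormedSpace ℝ F]
  {V : M → Type*} [TopologicalSpace (TotalSpace F V)] [∀ x, TopologicalSpace (V x)]
  [∀ x, AddCommGroup (V x)] [∀ x, Module ℝ (V x)] [FiberBundle F V] [VectorBundle ℝ F V]

variable [FiniteDimensional ℝ B] [T2Space M]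

lemma trivializationAt_tangent_apply {p q : M} (hq : q ∈ (chartAt B p).source) (w : Tan B q) :
    (trivializationAt B (TangentSpace 𝓘(ℝ, B) : M → Type _) p ⟨q, w⟩).2 =
      vectorDifferential (extChartAt 𝓘(ℝ, B) p) q w := by
  have h := TangentBundle.continuousLinearMapAt_trivializationAt (I := 𝓘(ℝ, B)) hq
  have h2 := congrArg (fun T : Tan B q →L[ℝ] B => T w) h
  refine Eq.trans ?_ h2
  have h3 := (trivializationAt B (TangentSpace 𝓘(ℝ, B) : M → Type _) p).coe_linearMapAt_of_mem
    (R := ℝ) (b := q) (by simpa using hq)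
  exact (congrFun h3 w).symm

lemma mdifferentiableAt_extChartAt_model {p q : M} (hq : q ∈ (chartAt B p).source) :
    MDifferentiableAt 𝓘(ℝ, B) 𝓘(ℝ, B) (extChartAt 𝓘(ℝ, B) p) q :=
  mdifferentiableAt_extChartAt hq

lemma differential_extFun_eventually (p : M) :
    ∀ᶠ q in 𝓝 p, ∀ (ξ : Cotan B p) (w : Tan B q), differential (extFun B p ξ) q w =
      ξ (trivializationAt B (TangentSpace 𝓘(ℝ, B) : M → Type _) p ⟨q, w⟩).2 := by
  have h1 := (bump B B (TangentSpace 𝓘(ℝ, B) : M → Type _) p).eventuallyEq_one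
  filter_upwards [eventually_eventually_nhds.2 h1,
    (chartAt B p).open_source.mem_nhds (mem_chart_source B p)] with q hq1 hq ξ w
  let L : B →L[ℝ] ℝ := ξ
  have h2 : (extFun B p ξ : M → ℝ) =ᶠ[𝓝 q]
      fun r => L (extChartAt 𝓘(ℝ, B) p r) + -L (extChartAt 𝓘(ℝ, B) p p) := by
    filter_upwards [hq1] with r hr
    change (bump B B (TangentSpace 𝓘(ℝ, B) : M → Type _) p r : ℝ) *
      L (extChartAt 𝓘(ℝ, B) p r - extChartAt 𝓘(ℝ, B) p p) = _
    rw [hr, map_sub, ← sub_eq_add_neg]; exact one_mul _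
  have h3 : HasMFDerivAt 𝓘(ℝ, B) 𝓘(ℝ, ℝ)
      (fun r => L (extChartAt 𝓘(ℝ, B) p r) + -L (extChartAt 𝓘(ℝ, B) p p)) q
      (L ∘L vectorDifferential (extChartAt 𝓘(ℝ, B) p) q) := by
    have h4 := (L.hasMFDerivAt (x := extChartAt 𝓘(ℝ, B) p q)).comp q
      (mdifferentiableAt_extChartAt_model hq).hasMFDerivAt
    refine ⟨h4.1.add continuousAt_const, ?_⟩
    exact h4.2.add_const _
  rw [differential_congr h2, trivializationAt_tangent_apply hq]
  exact congrArg (fun T : Tan B q →L[ℝ] ℝ => T w) h3.mfderiv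

variable (B) in
/-- Coordinate functions and a dual frame of vector fields near `p`. -/
lemma exists_tangent_frame (p : M) :
    ∃ Θ : LocalFrame B B (TangentSpace 𝓘(ℝ, B) : M → Type _) p,
    ∃ x : Fin (finrank ℝ B) → SmoothFun B M, ∀ᶠ q in 𝓝 p, q ∈ Θ.domain ∧
      ∀ η : Cotan B q, η = ∑ i, η (Θ.sec (finBasis ℝ B i) q) • differential (x i) q := by
  obtain ⟨Θ, hΘ⟩ := exists_localFrame_trivializationAt B B (TangentSpace 𝓘(ℝ, B) : M → Type _) p
  let ξ : Fin (finrank ℝ B) → Cotan B p := fun i =>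
    ((finBasis ℝ B).coord i).toContinuousLinearMap
  refine ⟨Θ, fun i => extFun B p (ξ i), ?_⟩
  filter_upwards [Θ.eventually_mem Θ.mem_domain, differential_extFun_eventually (B := B) p]
    with q hq hx
  refine ⟨hq, fun η => ?_⟩
  ext w
  have h1 : ∀ i, differential (extFun B p (ξ i)) q w =
      (finBasis ℝ B).coord i (Θ.coeff q w) := fun i => by
    rw [hx, (hΘ q hq).2.1]; rfl
  conv_lhs => rw [← Θ.sum_coord_smul_sec hq w, map_sum]
  rw [sum_apply]
  refine Finset.sum_congr rfl fun i _ => ?_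
  rw [map_smul, smul_eq_mul, mul_comm, smul_apply, h1, smul_eq_mul]

end LinearParts

/-! ### Differential of the derivative along a vector field -/

section DerivAlong

variable {B : Type*} [NormedAddCommGroup B] [NormedSpace ℝ B]
  {M : Type*} [TopologicalSpace M] [ChartedSpace B M] [IsManifold 𝓘(ℝ, B) ∞ M]
  {F : Type*} [NormedAddCommGroup F] [NormedSpace ℝ F]
  {V : M → Type*} [TopologicalSpace (TotalSpace F V)] [∀ x, TopologicalSpace (V x)]
  [∀ x, AddCommGroup (V x)] [∀ x, Module ℝ (V x)] [FiberBundle F V] [VectorBundle ℝ F V]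

variable (B) in
/-- The differential at a point as a linear map on smooth functions. -/
def differentialLinear (q : M) : SmoothFun B M →ₗ[ℝ] Cotan B q where
  toFun f := differential f q
  map_add' f g := AlmostLodayAlgebroid.differential_add f g q
  map_smul' c f := AlmostLodayAlgebroid.differential_smul c f q

lemma differential_mul_apply (f g : SmoothFun B M) (q : M) (w : Tan B q) :
    differential (f * g) q w = f q * differential g q w + differential f q w * g q :=
  vectorDifferential_smul_apply (f.mdifferentiableAt q) (g.mdifferentiableAt q) w

lemma smoothFun_sum_apply {ι : Type*} (t : Finset ι) (f : ι → SmoothFun B M) (q : M) :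
    (∑ i ∈ t, f i) q = ∑ i ∈ t, f i q := by
  have := map_sum (ContMDiffMap.coeFnAddMonoidHom (I := 𝓘(ℝ, B)) (I' := 𝓘(ℝ, ℝ)) (N := M)
    (G := ℝ) (n := ∞)) f t
  exact (congrFun this q).trans (Finset.sum_apply _ _ _)

variable [FiniteDimensional ℝ B] [T2Space M]

/-- The differential of `Y f` at a zero of the vector field `Y`. -/
lemma differential_derivAlong_apply {p : M} (f : SmoothFun B M)
    {Y : SmoothSection B B (TangentSpace 𝓘(ℝ, B) : M → Type _)} (hY : Y p = 0) (w : Tan B p) :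
    differential (f.derivAlong Y) p w =
      differential f p (sectionLinearPart B B (TangentSpace 𝓘(ℝ, B) : M → Type _) p Y w) := by
  obtain ⟨Θ, -⟩ := exists_localFrame_trivializationAt B B (TangentSpace 𝓘(ℝ, B) : M → Type _) p
  let E := fun i => Θ.sec (finBasis ℝ B i)
  -- Write Y f = ∑ Y_i (E_i f) in a frame of vector fields. The Y_i vanish at p, so only their
  -- differentials contribute there.
  have h1 : (f.derivAlong Y : M → ℝ) =ᶠ[𝓝 p]
      (∑ i, Θ.comp i Y * f.derivAlong (E i) : SmoothFun B M) := by
    filter_upwards [Θ.eventually_mem Θ.mem_domain] with q hq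
    rw [smoothFun_sum_apply]
    change differential f q (Y q) = _
    conv_lhs => rw [← Θ.sum_coord_smul_sec hq (Y q), map_sum]
    refine Finset.sum_congr rfl fun i _ => ?_
    rw [map_smul, ← Θ.comp_apply q hq]
    rfl
  have h2 : differential (∑ i, Θ.comp i Y * f.derivAlong (E i) : SmoothFun B M) p w =
      ∑ i, differential (Θ.comp i Y * f.derivAlong (E i)) p w := by
    have := map_sum (differentialLinear B p) (fun i => Θ.comp i Y * f.derivAlong (E i)) Finset.univ
    exact (congrArg (fun T : Cotan B p => T w) this).trans (sum_apply _ _ _)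
  rw [differential_congr h1, h2]
  conv_rhs => rw [← Θ.sum_coord_smul_sec Θ.mem_domain
    (sectionLinearPart B B (TangentSpace 𝓘(ℝ, B) : M → Type _) p Y w), map_sum]
  refine Finset.sum_congr rfl fun i _ => ?_
  refine (differential_mul_apply _ _ p w).trans ?_
  rw [Θ.comp_apply p Θ.mem_domain, hY, map_zero, map_zero, zero_mul, zero_add,
    Θ.differential_comp_apply hY, map_smul]
  rfl

end DerivAlong

/-! ### Independence of the linear parts of anchor and co-anchor from extensions -/

section LinearPartsOfAlgebroids

variable {B : Type*} [NormedAddCommGroup B] [NormedSpace ℝ B]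
  {M : Type*} [TopologicalSpace M] [ChartedSpace B M] [IsManifold 𝓘(ℝ, B) ∞ M]
  {F : Type*} [NormedAddCommGroup F] [NormedSpace ℝ F]
  {V : M → Type*} [TopologicalSpace (TotalSpace F V)] [∀ x, TopologicalSpace (V x)]
  [∀ x, AddCommGroup (V x)] [∀ x, Module ℝ (V x)] [FiberBundle F V] [VectorBundle ℝ F V]
variable [FiniteDimensional ℝ B] [FiniteDimensional ℝ F] [T2Space M]
  [ContMDiffVectorBundle ∞ F V 𝓘(ℝ, B)]

/-- A linear map on sections that is `C^∞(M)`-linear over evaluation at `p` only depends on the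
value of the section at `p`. -/
lemma eq_of_tensorial {W : Type*} [AddCommGroup W] [Module ℝ W] {p : M}
    (T : SmoothSection B F V →ₗ[ℝ] W)
    (hT : ∀ (f : SmoothFun B M) (α : SmoothSection B F V), T (f.smulSection α) = f p • T α)
    {α β : SmoothSection B F V} (h : α p = β p) : T α = T β := by
  have := eq_zero_of_tensorial T hT (α - β) (sub_eq_zero.2 h)
  rwa [map_sub, sub_eq_zero] at this

namespace AlmostLodayAlgebroid

variable (A : AlmostLodayAlgebroid B F V) {p : M}

/-- In the linear part of ρ(fα) the term with df carries the factor ρ(α)(p) = 0, so the linear part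
of ρ(α) is tensorial in α. -/
lemma sectionLinearPart_anchorSection (hp : ∀ e : V p, A.anchor p e = 0)
    (α : SmoothSection B F V) :
    sectionLinearPart B B (TangentSpace 𝓘(ℝ, B) : M → Type _) p (A.anchorSection α) =
      A.linearAnchor p (α p) := by
  refine eq_of_tensorial ((sectionLinearPart B B (TangentSpace 𝓘(ℝ, B) : M → Type _) p).comp
    A.anchorSection) (fun f α => ?_) (β := extSection B F V p (α p)) (extSection_self p (α p)).symm
  have h : A.anchorSection (f.smulSection α) = f.smulSection (A.anchorSection α) := by
    ext q; exact map_smul (A.anchor q) (f q) (α q)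
  ext w
  change sectionLinearPart B B _ p (A.anchorSection (f.smulSection α)) w = _
  rw [h, sectionLinearPart_smulSection]
  change _ + _ • A.anchor p (α p) = _
  rw [hp, smul_zero, add_zero]
  rfl

/-- Expand df in coordinate differentials near p. Since λ vanishes at p, the derivatives of the
coefficients drop out and only df(p) matters. -/
lemma sectionLinearPart_coanchorSection_congr_fun
    (hp : ∀ (ξ : Cotan B p) (u w : V p), A.coanchor p ξ u w = 0) {f g : SmoothFun B M}
    (h : differential (B := B) f p = differential g p) (α β : SmoothSection B F V) :
    sectionLinearPart B F V p (A.coanchorSection f α β) =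
      sectionLinearPart B F V p (A.coanchorSection g α β) := by
  obtain ⟨Θ, x, hx⟩ := exists_tangent_frame B p
  let E := fun i => Θ.sec (finBasis ℝ B i)
  have key : ∀ f : SmoothFun B M, sectionLinearPart B F V p (A.coanchorSection f α β) =
      ∑ i, differential (B := B) f p (E i p) •
        sectionLinearPart B F V p (A.coanchorSection (x i) α β) := by
    intro f
    have h1 : ∀ᶠ q in 𝓝 p, A.coanchorSection f α β q =
        (∑ i, (f.derivAlong (E i)).smulSection (A.coanchorSection (x i) α β) :
          SmoothSection B F V) q := by
      filter_upwards [hx] with q hq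
      rw [smoothSection_sum_apply]
      change A.coanchor q (differential f q) (α q) (β q) = _
      conv_lhs => rw [hq.2 (differential f q), map_sum, LinearMap.sum_apply, LinearMap.sum_apply]
      refine Finset.sum_congr rfl fun i _ => ?_
      rw [map_smul]
      rfl
    rw [sectionLinearPart_congr h1, map_sum]
    refine Finset.sum_congr rfl fun i _ => ?_
    ext w
    rw [sectionLinearPart_smulSection]
    change _ + _ • A.coanchor p (differential (x i) p) (α p) (β p) = _
    rw [hp, smul_zero, add_zero]
    rfl
  rw [key f, key g, h]

lemma sectionLinearPart_coanchorSection
    (hp : ∀ (ξ : Cotan B p) (u w : V p), A.coanchor p ξ u w = 0) (f : SmoothFun B M)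
    (α β : SmoothSection B F V) :
    sectionLinearPart B F V p (A.coanchorSection f α β) =
      A.linearCoanchor p (differential f p) (α p) (β p) := by
  rw [A.sectionLinearPart_coanchorSection_congr_fun hp
    (differential_extFun p (differential f p)).symm]
  generalize differential (B := B) f p = ξ
  have hr : ∀ α β : SmoothSection B F V, ∀ β' : SmoothSection B F V, β p = β' p →
      sectionLinearPart B F V p (A.coanchorSection (extFun B p ξ) α β) =
        sectionLinearPart B F V p (A.coanchorSection (extFun B p ξ) α β') := fun α β β' h => by
    refine eq_of_tensorial ((sectionLinearPart B F V p).comp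
      (A.coanchorSection (extFun B p ξ) α)) (fun f β => ?_) h
    have h : A.coanchorSection (extFun B p ξ) α (f.smulSection β) =
        f.smulSection (A.coanchorSection (extFun B p ξ) α β) := by
      ext q; exact map_smul (A.coanchor q _ (α q)) (f q) (β q)
    ext w
    change sectionLinearPart B F V p (A.coanchorSection (extFun B p ξ) α (f.smulSection β)) w = _
    rw [h, sectionLinearPart_smulSection]
    change _ + _ • A.coanchor p (differential (extFun B p ξ) p) (α p) (β p) = _
    rw [hp, smul_zero, add_zero]
    rfl
  have hl : ∀ α β : SmoothSection B F V, ∀ α' : SmoothSection B F V, α p = α' p →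
      sectionLinearPart B F V p (A.coanchorSection (extFun B p ξ) α β) =
        sectionLinearPart B F V p (A.coanchorSection (extFun B p ξ) α' β) := fun α β α' h => by
    refine eq_of_tensorial ((sectionLinearPart B F V p).comp
      ((A.coanchorSection (extFun B p ξ)).flip β)) (fun f α => ?_) h
    have h : A.coanchorSection (extFun B p ξ) (f.smulSection α) β =
        f.smulSection (A.coanchorSection (extFun B p ξ) α β) := by
      ext q; exact LinearMap.map_smul₂ (A.coanchor q _) (f q) (α q) (β q)
    ext w
    change sectionLinearPart B F V p (A.coanchorSection (extFun B p ξ) (f.smulSection α) β) w = _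
    rw [h, sectionLinearPart_smulSection]
    change _ + _ • A.coanchor p (differential (extFun B p ξ) p) (α p) (β p) = _
    rw [hp, smul_zero, add_zero]
    rfl
  exact (hl α β _ (extSection_self p (α p)).symm).trans (hr _ β _ (extSection_self p (β p)).symm)

end AlmostLodayAlgebroid

namespace LodayAlgebroid

/-- At p the bracket is bilinear in the values of the sections, so in the left Leibniz rule f[α, β]
cancels against [fα, β]. The anchor term vanishes, which leaves λ(df ⊗ α ⊗ β) = 0, and every
covector at p is some df(p). -/
lemma coanchor_eq_zero (A : LodayAlgebroid B F V) (hA : A.IsLie ∨ A.IsCourant) {p : M}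
    (hp : ∀ e : V p, A.anchor p e = 0) (ξ : Cotan B p) (u w : V p) : A.coanchor p ξ u w = 0 := by
  have h := A.leibniz_left (extSection B F V p u) (extSection B F V p w) (extFun B p ξ) p
  rw [A.bracket_apply hA hp, A.bracket_apply hA hp, hp, map_zero, zero_smul, sub_zero,
    differential_extFun, SmoothFun.smulSection_apply, extSection_self, extSection_self,
    LinearMap.map_smul₂] at h
  exact (left_eq_add.1 h)

end LodayAlgebroid

end LinearPartsOfAlgebroids

/-! ### Consequences of the Jacobi identity for a frame that commutes with α -/

namespace LodayAlgebroid

section Jacobi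

variable {B : Type*} [NormedAddCommGroup B] [NormedSpace ℝ B]
  {M : Type*} [TopologicalSpace M] [ChartedSpace B M] [IsManifold 𝓘(ℝ, B) ∞ M]
  {F : Type*} [NormedAddCommGroup F] [NormedSpace ℝ F]
  {V : M → Type*} [TopologicalSpace (TotalSpace F V)] [∀ x, TopologicalSpace (V x)]
  [∀ x, AddCommGroup (V x)] [∀ x, Module ℝ (V x)] [FiberBundle F V] [VectorBundle ℝ F V]

variable (A : LodayAlgebroid B F V)

lemma bracket_bracket (α β γ : SmoothSection B F V) :
    A.bracket α (A.bracket β γ) = A.bracket (A.bracket α β) γ + A.bracket β (A.bracket α γ) :=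
  (sub_eq_zero.1 (A.jacobi α β γ)).symm

/-- The anchor is a morphism of brackets, where the bundle has positive rank. -/
lemma anchorDeriv_bracket_smul (α β γ : SmoothSection B F V) (f : SmoothFun B M) (q : M) :
    (A.anchorDeriv (A.bracket α β) f q - A.anchorDeriv α (A.anchorDeriv β f) q +
      A.anchorDeriv β (A.anchorDeriv α f) q) • γ q = 0 := by
  -- Expand the Jacobi identity for α, β, fγ and subtract f times the one for α, β, γ. The mixed
  -- first-order terms cancel.
  have h := A.bracket_bracket α β (f.smulSection γ)
  have h1 := A.bracket_bracket α β γ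
  simp only [AlmostLodayAlgebroid.bracket_smulSection_right, map_add] at h
  have h2 := congrArg (fun s : SmoothSection B F V => s q) h
  have h3 := congrArg (fun s : SmoothSection B F V => s q) h1
  simp only [ContMDiffSection.coe_add, Pi.add_apply, SmoothFun.smulSection_apply] at h2 h3
  rw [h3] at h2
  rw [← sub_eq_zero] at h2
  rw [← neg_eq_zero, ← h2]
  module

variable [FiniteDimensional ℝ B] [FiniteDimensional ℝ F] [T2Space M] {p : M}
  (Θ : LocalFrame B F V p) {U : Set M} {α : SmoothSection B F V}

/-- In a frame of sections that commute with `α`, the bracket with `α` is the derivative of the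
components along `ρ(α)`. -/
lemma differential_comp_anchor (hUΘ : U ⊆ Θ.domain)
    (hα : ∀ q ∈ U, ∀ w, A.bracket α (Θ.sec w) q = 0) {q : M} (hq : q ∈ U)
    (s : SmoothSection B F V) (i : Fin (finrank ℝ F)) :
    A.anchorDeriv α (Θ.comp i s) q =
      (finBasis ℝ F).coord i (Θ.coeff q (A.bracket α s q)) := by
  have h1 := A.bracket_congr_right α (β := s)
    (β' := ∑ i, (Θ.comp i s).smulSection (Θ.sec (finBasis ℝ F i))) (q := q)
    ((Θ.eventually_mem (hUΘ hq)).mono fun r hr => (Θ.sum_comp_smul_sec hr s).symm)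
  rw [h1, map_sum, smoothSection_sum_apply]
  have h2 : ∀ j, A.bracket α ((Θ.comp j s).smulSection (Θ.sec (finBasis ℝ F j))) q =
      A.anchorDeriv α (Θ.comp j s) q • Θ.sec (finBasis ℝ F j) q := fun j => by
    rw [A.leibniz_right, hα q hq, smul_zero, zero_add]; rfl
  simp only [h2]
  rw [Θ.coord_sum_smul_sec (hUΘ hq)]

/-- By the Jacobi identity only brackets with [α, e] and [α, e'] remain. These sections vanish near
q and not just at q, so locality of the bracket applies. -/
lemma bracket_bracket_sec (hU : IsOpen U)
    (hα : ∀ q ∈ U, ∀ w, A.bracket α (Θ.sec w) q = 0) {q : M} (hq : q ∈ U) (u w : F) :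
    A.bracket α (A.bracket (Θ.sec u) (Θ.sec w)) q = 0 := by
  have h0 : ∀ w, ∀ᶠ r in 𝓝 q, A.bracket α (Θ.sec w) r = 0 := fun w =>
    (hU.eventually_mem hq).mono fun r hr => hα r hr w
  rw [A.bracket_bracket]
  change A.bracket (A.bracket α (Θ.sec u)) (Θ.sec w) q +
    A.bracket (Θ.sec u) (A.bracket α (Θ.sec w)) q = 0
  rw [A.bracket_apply_eq_zero_of_eventually_left _ (h0 u),
    A.bracket_apply_eq_zero_of_eventually_right _ (h0 w), add_zero]

/-- As [α, e] = 0, the vector fields ρ(α) and ρ(e) commute on functions. So ρ(e) preserves the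
eigenvalue 1 of ρ(α) on f: this makes the anchor coefficients homogeneous of degree one. -/
lemma anchorDeriv_anchorDeriv_sec (hU : IsOpen U) (hUΘ : U ⊆ Θ.domain)
    (hα : ∀ q ∈ U, ∀ w, A.bracket α (Θ.sec w) q = 0) {f : SmoothFun B M}
    (hf : ∀ q ∈ U, A.anchorDeriv α f q = f q) {q : M} (hq : q ∈ U) (w : F) :
    A.anchorDeriv α (A.anchorDeriv (Θ.sec w) f) q = A.anchorDeriv (Θ.sec w) f q := by
  -- That the anchor is a morphism of brackets is known only after multiplication with a section;
  -- for w ≠ 0 the frame section itself is nonzero at q and serves for this.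
  rcases eq_or_ne w 0 with rfl | hw
  · have h0 : A.anchorDeriv (Θ.sec 0) f = 0 := by
      ext r
      change differential f r (A.anchor r (Θ.sec 0 r)) = 0
      rw [map_zero]
      exact (congrArg _ (map_zero (A.anchor r))).trans (map_zero _)
    rw [h0]
    change differential (0 : SmoothFun B M) q _ = 0
    exact congrArg (fun T : Cotan B q => T (A.anchor q (α q))) (map_zero (differentialLinear B q))
  · have h1 := A.anchorDeriv_bracket_smul α (Θ.sec w) (Θ.sec w) f q
    have h2 : Θ.sec w q ≠ 0 := fun h => hw (by
      rw [← Θ.coeff_sec q (hUΘ hq) w, h, map_zero])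
    have h3 := (smul_eq_zero.1 h1).resolve_right h2
    have h4 : A.anchorDeriv (A.bracket α (Θ.sec w)) f q = 0 := by
      rw [AlmostLodayAlgebroid.anchorDeriv_apply, hα q hq, map_zero, map_zero]
    have h5 : A.anchorDeriv (Θ.sec w) (A.anchorDeriv α f) q = A.anchorDeriv (Θ.sec w) f q := by
      rw [AlmostLodayAlgebroid.anchorDeriv_apply, AlmostLodayAlgebroid.anchorDeriv_apply,
        differential_congr ((hU.eventually_mem hq).mono fun r hr => hf r hr)]
    rw [h4, h5] at h3
    linarith

/-- By `coanchorSection_eq` the section λ(df ⊗ e ⊗ e') is a combination of [fe, e'], f[e, e'] and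
(ρ(e')f)e. The operator [α, ·] fixes each of them, since it kills e, e' and [e, e'] while ρ(α) fixes
f and ρ(e')f. -/
lemma bracket_coanchorSection_sec (hU : IsOpen U) (hUΘ : U ⊆ Θ.domain)
    (hα : ∀ q ∈ U, ∀ w, A.bracket α (Θ.sec w) q = 0) {f : SmoothFun B M}
    (hf : ∀ q ∈ U, A.anchorDeriv α f q = f q) {q : M} (hq : q ∈ U) (u w : F) :
    A.bracket α (A.coanchorSection f (Θ.sec u) (Θ.sec w)) q =
      A.coanchorSection f (Θ.sec u) (Θ.sec w) q := by
  have h0 : ∀ w, ∀ᶠ r in 𝓝 q, A.bracket α (Θ.sec w) r = 0 := fun w =>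
    (hU.eventually_mem hq).mono fun r hr => hα r hr w
  have h1 : A.bracket α (A.bracket (f.smulSection (Θ.sec u)) (Θ.sec w)) q =
      A.bracket (f.smulSection (Θ.sec u)) (Θ.sec w) q := by
    rw [A.bracket_bracket]
    change A.bracket (A.bracket α (f.smulSection (Θ.sec u))) (Θ.sec w) q +
      A.bracket (f.smulSection (Θ.sec u)) (A.bracket α (Θ.sec w)) q = _
    rw [A.bracket_apply_eq_zero_of_eventually_right _ (h0 w), add_zero]
    refine A.bracket_congr_left _ ?_
    filter_upwards [hU.eventually_mem hq] with r hr
    rw [A.leibniz_right, hα r hr, smul_zero, zero_add]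
    exact congrArg (fun c : ℝ => c • Θ.sec u r) (hf r hr)
  have h2 : A.bracket α (f.smulSection (A.bracket (Θ.sec u) (Θ.sec w))) q =
      f.smulSection (A.bracket (Θ.sec u) (Θ.sec w)) q := by
    rw [A.leibniz_right, A.bracket_bracket_sec Θ hU hα hq, smul_zero, zero_add]
    exact congrArg (fun c : ℝ => c • A.bracket (Θ.sec u) (Θ.sec w) q) (hf q hq)
  have h3 : A.bracket α ((A.anchorDeriv (Θ.sec w) f).smulSection (Θ.sec u)) q =
      (A.anchorDeriv (Θ.sec w) f).smulSection (Θ.sec u) q := by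
    rw [A.leibniz_right, hα q hq, smul_zero, zero_add]
    exact congrArg (fun c : ℝ => c • Θ.sec u q)
      (A.anchorDeriv_anchorDeriv_sec Θ hU hUΘ hα hf hq w)
  rw [A.coanchorSection_eq, map_add, map_sub]
  simp only [ContMDiffSection.coe_add, ContMDiffSection.coe_sub, Pi.add_apply, Pi.sub_apply,
    h1, h2, h3]

end Jacobi

end LodayAlgebroid

/-! ### Euler coordinates around a point of the manifold -/

section EulerChart

variable {B : Type*} [NormedAddCommGroup B] [NormedSpace ℝ B]
  {M : Type*} [TopologicalSpace M] [ChartedSpace B M] [IsManifold 𝓘(ℝ, B) ∞ M]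
  {F : Type*} [NormedAddCommGroup F] [NormedSpace ℝ F]
  {V : M → Type*} [TopologicalSpace (TotalSpace F V)] [∀ x, TopologicalSpace (V x)]
  [∀ x, AddCommGroup (V x)] [∀ x, Module ℝ (V x)] [FiberBundle F V] [VectorBundle ℝ F V]

/-- The chain rule for a map into a vector space followed by a differentiable map. -/
lemma vectorDifferential_comp {G H : Type*} [NormedAddCommGroup G] [NormedSpace ℝ G]
    [NormedAddCommGroup H] [NormedSpace ℝ H] {h : G → H} {φ : M → G} {q : M}
    (hh : DifferentiableAt ℝ h (φ q)) (hφ : MDifferentiableAt 𝓘(ℝ, B) 𝓘(ℝ, G) φ q) :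
    vectorDifferential (B := B) (fun r => h (φ r)) q =
      fderiv ℝ h (φ q) ∘L vectorDifferential φ q := by
  have h1 : HasMFDerivAt 𝓘(ℝ, G) 𝓘(ℝ, H) h (φ q) (fderiv ℝ h (φ q)) :=
    hh.hasFDerivAt.hasMFDerivAt
  exact (h1.comp q hφ.hasMFDerivAt).mfderiv

/-- Smooth coordinates `φ` on a neighbourhood of `p` with values in a ball around `0`, tangent to
the preferred chart at `p`, in which the vector field `X` is the Euler vector field, together with
global smooth functions that agree on this neighbourhood with the components of `φ`. -/
structure EulerChart (X : ∀ q : M, Tan B q) (p : M) where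
  base : OpenPartialHomeomorph M B
  radius : ℝ
  mem_source : p ∈ base.source
  base_apply : base p = 0
  target_eq : base.target = Metric.ball 0 radius
  smooth_base : ContMDiffOn 𝓘(ℝ, B) 𝓘(ℝ, B) ∞ base base.source
  smooth_base_symm : ContMDiffOn 𝓘(ℝ, B) 𝓘(ℝ, B) ∞ base.symm base.target
  vectorDifferential_base : ∀ w : Tan B p, vectorDifferential base p w = w
  euler : ∀ q ∈ base.source, vectorDifferential base q (X q) = base q
  coord : (B →L[ℝ] ℝ) → SmoothFun B M
  coord_apply : ∀ q ∈ base.source, ∀ ξ, coord ξ q = ξ (base q)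

namespace EulerChart

variable {X : ∀ q : M, Tan B q} {p : M} (φ : EulerChart X p)

lemma eventually_mem {q : M} (hq : q ∈ φ.base.source) : ∀ᶠ r in 𝓝 q, r ∈ φ.base.source :=
  φ.base.open_source.mem_nhds hq

lemma mdifferentiableAt {q : M} (hq : q ∈ φ.base.source) :
    MDifferentiableAt 𝓘(ℝ, B) 𝓘(ℝ, B) φ.base q :=
  ((φ.smooth_base q hq).contMDiffAt (φ.base.open_source.mem_nhds hq)).mdifferentiableAt (by simp)

lemma differential_coord {q : M} (hq : q ∈ φ.base.source) (ξ : B →L[ℝ] ℝ) :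
    differential (φ.coord ξ) q = (ξ ∘L vectorDifferential φ.base q : Tan B q →L[ℝ] ℝ) := by
  rw [differential_congr ((φ.eventually_mem hq).mono fun r hr => φ.coord_apply r hr ξ)]
  exact vectorDifferential_linear_comp ξ (φ.mdifferentiableAt hq)

lemma differentiableAt_comp_symm (f : SmoothFun B M) {y : B} (hy : y ∈ φ.base.target) :
    DifferentiableAt ℝ (fun y => f (φ.base.symm y)) y := by
  have h := f.contMDiff.contMDiffAt.comp y
    ((φ.smooth_base_symm y hy).contMDiffAt (φ.base.open_target.mem_nhds hy))
  exact (contMDiffAt_iff_contDiffAt.1 h).differentiableAt (by simp)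

lemma fderiv_comp_symm (f : SmoothFun B M) {q : M} (hq : q ∈ φ.base.source) (w : Tan B q) :
    fderiv ℝ (fun y => f (φ.base.symm y)) (φ.base q) (vectorDifferential φ.base q w) =
      differential f q w := by
  have h1 : (f : M → ℝ) =ᶠ[𝓝 q] fun r => (fun y => f (φ.base.symm y)) (φ.base r) := by
    filter_upwards [φ.eventually_mem hq] with r hr
    rw [φ.base.left_inv hr]
  rw [differential_congr h1]
  exact (congrArg (fun T : Tan B q →L[ℝ] ℝ => T w) (vectorDifferential_comp
    (φ.differentiableAt_comp_symm f (φ.base.map_source hq)) (φ.mdifferentiableAt hq))).symm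

/-- This translates derivatives along X into radial derivatives, to which the homogeneity lemmas on
a ball apply. -/
lemma fderiv_comp_symm_self (f : SmoothFun B M) {y : B} (hy : y ∈ φ.base.target) :
    fderiv ℝ (fun y => f (φ.base.symm y)) y y =
      differential f (φ.base.symm y) (X (φ.base.symm y)) := by
  have hq := φ.base.map_target hy
  rw [← φ.fderiv_comp_symm f hq, φ.euler _ hq, φ.base.right_inv hy]

lemma symm_zero : φ.base.symm 0 = p := by
  rw [← φ.base_apply, φ.base.left_inv φ.mem_source]

/-- A function annihilated by the Euler vector field is constant. -/
lemma eq_apply_of_deriv_eq_zero (f : SmoothFun B M)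
    (hf : ∀ q ∈ φ.base.source, differential f q (X q) = 0) {q : M} (hq : q ∈ φ.base.source) :
    f q = f p := by
  have h := eq_apply_zero_of_euler_eq_zero (h := fun y => f (φ.base.symm y)) (r := φ.radius)
    (fun y hy => φ.differentiableAt_comp_symm f (φ.target_eq ▸ hy))
    (fun y hy => by
      have hy' : y ∈ φ.base.target := φ.target_eq ▸ hy
      rw [φ.fderiv_comp_symm_self f hy', hf _ (φ.base.map_target hy')])
    (y := φ.base q) (φ.target_eq ▸ φ.base.map_source hq)
  simpa only [φ.base.left_inv hq, φ.symm_zero] using h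

/-- A function on which the Euler vector field acts as the identity is linear. -/
lemma eq_differential_of_deriv_eq_self (f : SmoothFun B M)
    (hf : ∀ q ∈ φ.base.source, differential f q (X q) = f q) {q : M} (hq : q ∈ φ.base.source) :
    f q = differential f p (φ.base q : B) := by
  have h := eq_fderiv_zero_of_euler_eq_self (h := fun y => f (φ.base.symm y)) (r := φ.radius)
    (fun y hy => φ.differentiableAt_comp_symm f (φ.target_eq ▸ hy))
    (fun y hy => by
      have hy' : y ∈ φ.base.target := φ.target_eq ▸ hy
      rw [φ.fderiv_comp_symm_self f hy', hf _ (φ.base.map_target hy')])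
    (y := φ.base q) (φ.target_eq ▸ φ.base.map_source hq)
  simp only [φ.base.left_inv hq] at h
  rw [h]
  have h2 := φ.fderiv_comp_symm f φ.mem_source (φ.base q : B)
  rw [φ.base_apply] at h2
  rw [← h2]
  exact congrArg _ (φ.vectorDifferential_base (φ.base q : B)).symm

end EulerChart

end EulerChart

/-! ### The structure functions are constant or linear -/

namespace LodayAlgebroid

section StructureFunctions

variable {B : Type*} [NormedAddCommGroup B] [NormedSpace ℝ B]
  {M : Type*} [TopologicalSpace M] [ChartedSpace B M] [IsManifold 𝓘(ℝ, B) ∞ M]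
  {F : Type*} [NormedAddCommGroup F] [NormedSpace ℝ F]
  {V : M → Type*} [TopologicalSpace (TotalSpace F V)] [∀ x, TopologicalSpace (V x)]
  [∀ x, AddCommGroup (V x)] [∀ x, Module ℝ (V x)] [FiberBundle F V] [VectorBundle ℝ F V]
variable [FiniteDimensional ℝ B] [FiniteDimensional ℝ F] [T2Space M]
  [ContMDiffVectorBundle ∞ F V 𝓘(ℝ, B)]
  (A : LodayAlgebroid B F V) {p : M} {α : SmoothSection B F V}
  (φ : EulerChart (fun q => A.anchor q (α q)) p) (Θ : LocalFrame B F V p)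

/-- In a frame of sections that commute with `α`, the structure functions are constant. -/
lemma coeff_bracket_sec (hA : A.IsLie ∨ A.IsCourant) (hp : ∀ e : V p, A.anchor p e = 0)
    (hφΘ : φ.base.source ⊆ Θ.domain)
    (hα : ∀ q ∈ φ.base.source, ∀ w, A.bracket α (Θ.sec w) q = 0) {q : M}
    (hq : q ∈ φ.base.source) (u w : F) :
    Θ.coeff q (A.bracket (Θ.sec u) (Θ.sec w) q) =
      Θ.coeff p (A.linearBracket p (Θ.sec u p) (Θ.sec w p)) := by
  refine (finBasis ℝ F).ext_elem fun i => ?_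
  have h1 := φ.eq_apply_of_deriv_eq_zero (Θ.comp i (A.bracket (Θ.sec u) (Θ.sec w)))
    (fun r hr => by
      refine (A.differential_comp_anchor Θ hφΘ hα hr _ i).trans ?_
      rw [A.bracket_bracket_sec Θ φ.base.open_source hα hr, map_zero, map_zero]) hq
  rw [Θ.comp_apply q (hφΘ hq), Θ.comp_apply p Θ.mem_domain, A.bracket_apply hA hp] at h1
  exact h1

lemma anchorDeriv_coord {q : M} (hq : q ∈ φ.base.source) (ξ : B →L[ℝ] ℝ) :
    A.anchorDeriv α (φ.coord ξ) q = φ.coord ξ q := by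
  rw [AlmostLodayAlgebroid.anchorDeriv_apply, φ.differential_coord hq, φ.coord_apply q hq]
  exact congrArg ξ (φ.euler q hq)

/-- In Euler coordinates and a frame of sections that commute with `α`, the anchor is linear. -/
lemma vectorDifferential_anchor_sec (hp : ∀ e : V p, A.anchor p e = 0)
    (hφΘ : φ.base.source ⊆ Θ.domain)
    (hα : ∀ q ∈ φ.base.source, ∀ w, A.bracket α (Θ.sec w) q = 0) {q : M}
    (hq : q ∈ φ.base.source) (w : F) :
    vectorDifferential φ.base q (A.anchor q (Θ.sec w q)) =
      A.linearAnchor p (Θ.sec w p) (φ.base q : B) := by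
  refine (finBasis ℝ B).ext_elem fun i => ?_
  let ξ : B →L[ℝ] ℝ := ((finBasis ℝ B).coord i).toContinuousLinearMap
  let θ := A.anchorDeriv (Θ.sec w) (φ.coord ξ)
  have h1 := φ.eq_differential_of_deriv_eq_self θ (fun r hr =>
    A.anchorDeriv_anchorDeriv_sec Θ φ.base.open_source hφΘ hα
      (fun r hr => A.anchorDeriv_coord φ hr ξ) hr w) hq
  -- The coefficient θ equals its differential at p applied to the coordinates. As ρ(e) vanishes at
  -- p, this differential is that of the coordinate composed with ρ^L.
  have h2 : A.anchorSection (Θ.sec w) p = 0 := hp _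
  have h3 := differential_derivAlong_apply (φ.coord ξ) h2 (φ.base q : B)
  rw [A.sectionLinearPart_anchorSection hp, φ.differential_coord φ.mem_source] at h3
  have h4 : θ q = ξ (vectorDifferential φ.base q (A.anchor q (Θ.sec w q))) :=
    congrArg (fun T : Cotan B q => T (A.anchor q (Θ.sec w q))) (φ.differential_coord hq ξ)
  have h5 := φ.vectorDifferential_base (A.linearAnchor p (Θ.sec w p) (φ.base q : B))
  exact h4.symm.trans (h1.trans (h3.trans (congrArg ξ h5)))

/-- In Euler coordinates and a frame of sections that commute with `α`, the co-anchor is linear. -/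
lemma coeff_coanchor_sec (hA : A.IsLie ∨ A.IsCourant) (hp : ∀ e : V p, A.anchor p e = 0)
    (hφΘ : φ.base.source ⊆ Θ.domain)
    (hα : ∀ q ∈ φ.base.source, ∀ w, A.bracket α (Θ.sec w) q = 0) {q : M}
    (hq : q ∈ φ.base.source) (ξ : B →L[ℝ] ℝ) (u w : F) :
    Θ.coeff q (A.coanchor q (ξ ∘L vectorDifferential φ.base q) (Θ.sec u q) (Θ.sec w q)) =
      Θ.coeff p (A.linearCoanchor p ξ (Θ.sec u p) (Θ.sec w p) (φ.base q : B)) := by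
  refine (finBasis ℝ F).ext_elem fun i => ?_
  let s := A.coanchorSection (φ.coord ξ) (Θ.sec u) (Θ.sec w)
  have hp' := A.coanchor_eq_zero hA hp
  have hsp : s p = 0 := hp' _ _ _
  have h1 := φ.eq_differential_of_deriv_eq_self (Θ.comp i s) (fun r hr => by
    refine (A.differential_comp_anchor Θ hφΘ hα hr _ i).trans ?_
    rw [A.bracket_coanchorSection_sec Θ φ.base.open_source hφΘ hα
      (fun r hr => A.anchorDeriv_coord φ hr ξ) hr, Θ.comp_apply r (hφΘ hr)]) hq
  have h3 := Θ.differential_comp_apply hsp i (φ.base q : B)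
  rw [A.sectionLinearPart_coanchorSection hp', φ.differential_coord φ.mem_source] at h3
  replace h1 := h1.trans h3
  rw [Θ.comp_apply q (hφΘ hq)] at h1
  have h2 : (ξ ∘L vectorDifferential φ.base p : Cotan B p) = ξ := by
    ext w
    exact congrArg ξ (φ.vectorDifferential_base w)
  rw [h2] at h1
  rw [← φ.differential_coord hq]
  exact h1

end StructureFunctions

end LodayAlgebroid

/-! ### From linear structure functions to an isomorphism with the linear model -/

namespace AlmostLodayAlgebroid

section LinearInFrame

variable {B : Type*} [NormedAddCommGroup B] [NormedSpace ℝ B]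
  {M : Type*} [TopologicalSpace M] [ChartedSpace B M] [IsManifold 𝓘(ℝ, B) ∞ M]
  {F : Type*} [NormedAddCommGroup F] [NormedSpace ℝ F]
  {V : M → Type*} [TopologicalSpace (TotalSpace F V)] [∀ x, TopologicalSpace (V x)]
  [∀ x, AddCommGroup (V x)] [∀ x, Module ℝ (V x)] [FiberBundle F V] [VectorBundle ℝ F V]
variable [FiniteDimensional ℝ B] [FiniteDimensional ℝ F] [T2Space M]
  [ContMDiffVectorBundle ∞ F V 𝓘(ℝ, B)]

/-- The differential of the components of a section given in terms of coordinates `φ`. -/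
lemma _root_.LocalFrame.differential_comp {p q : M} (Θ : LocalFrame B F V p) (hq : q ∈ Θ.domain)
    {φ : M → B} (hφ : MDifferentiableAt 𝓘(ℝ, B) 𝓘(ℝ, B) φ q) {β : SmoothSection B F V}
    {b : B → F} (hβ : ∀ᶠ r in 𝓝 q, Θ.coeff r (β r) = b (φ r))
    (hb : DifferentiableAt ℝ b (φ q)) (i : Fin (finrank ℝ F)) :
    differential (Θ.comp i β) q =
      ((((finBasis ℝ F).coord i).toContinuousLinearMap ∘L fderiv ℝ b (φ q)) ∘L
        vectorDifferential φ q : Tan B q →L[ℝ] ℝ) := by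
  let L : F →L[ℝ] ℝ := ((finBasis ℝ F).coord i).toContinuousLinearMap
  have h1 : (Θ.comp i β : M → ℝ) =ᶠ[𝓝 q] fun r => (fun y => L (b y)) (φ r) := by
    filter_upwards [hβ, Θ.eventually_mem hq] with r hr hr'
    rw [Θ.comp_apply r hr', hr]; rfl
  rw [differential_congr h1]
  refine (vectorDifferential_comp (L.differentiableAt.comp _ hb) hφ).trans ?_
  rw [show fderiv ℝ (L ∘ b) (φ q) = L ∘L fderiv ℝ b (φ q) from
    (L.hasFDerivAt.comp _ hb.hasFDerivAt).fderiv]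

/-- The bracket with a section whose components are given in terms of coordinates `φ`. -/
lemma coeff_bracket_right (A : AlmostLodayAlgebroid B F V) {p q : M} (Θ : LocalFrame B F V p)
    (hq : q ∈ Θ.domain) {φ : M → B} (hφ : MDifferentiableAt 𝓘(ℝ, B) 𝓘(ℝ, B) φ q)
    (α : SmoothSection B F V) {β : SmoothSection B F V} {b : B → F}
    (hβ : ∀ᶠ r in 𝓝 q, Θ.coeff r (β r) = b (φ r)) (hb : DifferentiableAt ℝ b (φ q)) :
    Θ.coeff q (A.bracket α β q) =
      ∑ i, (finBasis ℝ F).coord i (b (φ q)) •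
        Θ.coeff q (A.bracket α (Θ.sec (finBasis ℝ F i)) q) +
      fderiv ℝ b (φ q) (vectorDifferential φ q (A.anchor q (α q))) := by
  rw [A.bracket_congr_right α ((Θ.eventually_mem hq).mono fun r hr =>
    (Θ.sum_comp_smul_sec hr β).symm), map_sum, smoothSection_sum_apply, map_sum]
  conv_rhs => rw [← (finBasis ℝ F).sum_repr
    (fderiv ℝ b (φ q) (vectorDifferential φ q (A.anchor q (α q)))), ← Finset.sum_add_distrib]
  refine Finset.sum_congr rfl fun i _ => ?_
  rw [A.leibniz_right, map_add, map_smul, map_smul, Θ.coeff_sec q hq,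
    Θ.comp_apply q hq, hβ.self_of_nhds, Θ.differential_comp hq hφ hβ hb]
  rfl

/-- The structure functions of `A` in the coordinates `φ` and the frame `Θ` are those of the linear
model with data `aL`, `rL`, `lL`. -/
structure IsLinearInFrame (A : AlmostLodayAlgebroid B F V) {p : M}
    (φ : OpenPartialHomeomorph M B) (Θ : LocalFrame B F V p) (aL : F →ₗ[ℝ] F →ₗ[ℝ] F)
    (rL : F →ₗ[ℝ] B →ₗ[ℝ] B) (lL : (B →L[ℝ] ℝ) →ₗ[ℝ] F →ₗ[ℝ] F →ₗ[ℝ] B →ₗ[ℝ] F) : Prop where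
  source_subset : φ.source ⊆ Θ.domain
  smooth : ContMDiffOn 𝓘(ℝ, B) 𝓘(ℝ, B) ∞ φ φ.source
  smooth_symm : ContMDiffOn 𝓘(ℝ, B) 𝓘(ℝ, B) ∞ φ.symm φ.target
  bracket : ∀ q ∈ φ.source, ∀ u w,
    Θ.coeff q (A.bracket (Θ.sec u) (Θ.sec w) q) = aL u w
  anchor : ∀ q ∈ φ.source, ∀ w,
    vectorDifferential φ q (A.anchor q (Θ.sec w q)) = rL w (φ q)
  coanchor : ∀ q ∈ φ.source, ∀ (ξ : B →L[ℝ] ℝ) (u w : F),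
    Θ.coeff q (A.coanchor q (ξ ∘L vectorDifferential φ q) (Θ.sec u q) (Θ.sec w q)) =
      lL ξ u w (φ q)

namespace IsLinearInFrame

variable {A : AlmostLodayAlgebroid B F V} {p : M} {φ : OpenPartialHomeomorph M B}
  {Θ : LocalFrame B F V p} {aL : F →ₗ[ℝ] F →ₗ[ℝ] F} {rL : F →ₗ[ℝ] B →ₗ[ℝ] B}
  {lL : (B →L[ℝ] ℝ) →ₗ[ℝ] F →ₗ[ℝ] F →ₗ[ℝ] B →ₗ[ℝ] F}

lemma mdifferentiableAt (h : A.IsLinearInFrame φ Θ aL rL lL) {q : M} (hq : q ∈ φ.source) :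
    MDifferentiableAt 𝓘(ℝ, B) 𝓘(ℝ, B) φ q :=
  ((h.smooth q hq).contMDiffAt (φ.open_source.mem_nhds hq)).mdifferentiableAt (by simp)

lemma coeff_bracket_sec_left (h : A.IsLinearInFrame φ Θ aL rL lL) {q : M} (hq : q ∈ φ.source)
    (u : F) {β : SmoothSection B F V} {b : B → F}
    (hβ : ∀ᶠ r in 𝓝 q, Θ.coeff r (β r) = b (φ r)) (hb : DifferentiableAt ℝ b (φ q)) :
    Θ.coeff q (A.bracket (Θ.sec u) β q) =
      aL u (b (φ q)) + fderiv ℝ b (φ q) (rL u (φ q)) := by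
  rw [A.coeff_bracket_right Θ (h.source_subset hq) (h.mdifferentiableAt hq) _ hβ hb]
  simp only [h.bracket q hq]
  conv_rhs => rw [← (finBasis ℝ F).sum_repr (b (φ q)), map_sum]
  congr 1
  · exact Finset.sum_congr rfl fun i _ => (map_smul _ _ _).symm
  · exact congrArg _ (h.anchor q hq u)

/-- Expand α in the frame by the left Leibniz rule, β having been expanded by the right one in
`coeff_bracket_sec_left`. The structure functions thus determine all brackets, by the same formula
that defines the linear model. -/
lemma coeff_bracket (h : A.IsLinearInFrame φ Θ aL rL lL) {q : M} (hq : q ∈ φ.source)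
    {α β : SmoothSection B F V} {a b : B → F}
    (hα : ∀ᶠ r in 𝓝 q, Θ.coeff r (α r) = a (φ r))
    (hβ : ∀ᶠ r in 𝓝 q, Θ.coeff r (β r) = b (φ r))
    (ha : DifferentiableAt ℝ a (φ q)) (hb : DifferentiableAt ℝ b (φ q)) :
    Θ.coeff q (A.bracket α β q) = linearModelBracketFun aL rL lL a b (φ q) := by
  have hqΘ := h.source_subset hq
  have hβq : β q = Θ.sec (b (φ q)) q := by
    rw [← Θ.sec_coeff q hqΘ (β q), hβ.self_of_nhds]
  rw [A.bracket_congr_left (β := β) ((Θ.eventually_mem hqΘ).mono fun r hr =>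
    (Θ.sum_comp_smul_sec hr α).symm), map_sum, LinearMap.sum_apply, smoothSection_sum_apply,
    map_sum]
  have key : ∀ i, Θ.coeff q
      (A.bracket ((Θ.comp i α).smulSection (Θ.sec (finBasis ℝ F i))) β q) =
      (finBasis ℝ F).coord i (a (φ q)) • (aL (finBasis ℝ F i) (b (φ q)) +
        fderiv ℝ b (φ q) (rL (finBasis ℝ F i) (φ q))) -
      (finBasis ℝ F).coord i (fderiv ℝ a (φ q) (rL (b (φ q)) (φ q))) • finBasis ℝ F i +
      lL (((finBasis ℝ F).coord i).toContinuousLinearMap.comp (fderiv ℝ a (φ q)))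
        (finBasis ℝ F i) (b (φ q)) (φ q) := by
    intro i
    have h1 := h.anchor q hq (b (φ q))
    rw [A.leibniz_left, map_add, map_sub, map_smul, map_smul,
      h.coeff_bracket_sec_left hq _ hβ hb, Θ.coeff_sec q hqΘ, Θ.comp_apply q hqΘ,
      hα.self_of_nhds, Θ.differential_comp hqΘ (h.mdifferentiableAt hq) hα ha, hβq]
    congr 1
    · congr 2
      exact congrArg (fun x => (finBasis ℝ F).coord i (fderiv ℝ a (φ q) x)) h1
    · exact h.coanchor q hq _ _ _
  simp only [key, Finset.sum_add_distrib, Finset.sum_sub_distrib, linearModelBracketFun,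
    linearModelContraction]
  congr 2
  · conv_rhs => rw [← (finBasis ℝ F).sum_repr (a (φ q))]
    simp only [map_sum, map_smul, LinearMap.sum_apply, LinearMap.smul_apply, smul_add,
      Finset.sum_add_distrib, Basis.coord_apply]
  · exact (finBasis ℝ F).sum_repr _

/-- The isomorphism of vector bundles given by coordinates and a frame. -/
def total (h : A.IsLinearInFrame φ Θ aL rL lL) :
    PartialEquiv (TotalSpace F V) (TotalSpace F (Trivial B F)) where
  toFun z := ⟨φ z.1, Θ.coeff z.1 z.2⟩
  invFun z := ⟨φ.symm z.1, Θ.sec z.2 (φ.symm z.1)⟩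
  source := TotalSpace.proj ⁻¹' φ.source
  target := TotalSpace.proj ⁻¹' φ.target
  map_source' z hz := φ.map_source hz
  map_target' z hz := φ.map_target hz
  left_inv' z hz := by
    obtain ⟨q, e⟩ := z
    have h1 : ∀ r, r = q → (⟨r, Θ.sec (Θ.coeff q e) r⟩ : TotalSpace F V) = ⟨q, e⟩ := by
      rintro _ rfl
      rw [Θ.sec_coeff _ (h.source_subset hz)]
    exact h1 _ (φ.left_inv hz)
  right_inv' z hz := by
    obtain ⟨y, w⟩ := z
    change (⟨φ (φ.symm y), Θ.coeff (φ.symm y) (Θ.sec w (φ.symm y))⟩ :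
      TotalSpace F (Trivial B F)) = ⟨y, w⟩
    rw [Θ.coeff_sec _ (h.source_subset (φ.map_target hz))]
    exact congrArg (fun y => (⟨y, w⟩ : TotalSpace F (Trivial B F))) (φ.right_inv hz)

lemma contMDiffOn_total (h : A.IsLinearInFrame φ Θ aL rL lL) :
    ContMDiffOn (𝓘(ℝ, B).prod 𝓘(ℝ, F)) (𝓘(ℝ, B).prod 𝓘(ℝ, F)) ∞ h.total h.total.source := by
  intro z hz
  refine (contMDiffWithinAt_totalSpace (F := F) (E := Trivial B F) (f := h.total)).2 ⟨?_, ?_⟩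
  · exact (h.smooth z.1 hz).comp z (contMDiff_proj V).contMDiffAt.contMDiffWithinAt
      (fun y hy => hy)
  · exact (Θ.smooth_coeff z (h.source_subset hz)).mono fun y hy => h.source_subset hy

lemma contMDiffOn_total_symm (h : A.IsLinearInFrame φ Θ aL rL lL) :
    ContMDiffOn (𝓘(ℝ, B).prod 𝓘(ℝ, F)) (𝓘(ℝ, B).prod 𝓘(ℝ, F)) ∞ h.total.symm
      h.total.target := by
  intro z hz
  have h0 := contMDiffAt_totalSpace.1 (contMDiffAt_id (I := 𝓘(ℝ, B).prod 𝓘(ℝ, F)) (n := ∞)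
    (x := z))
  have h1 : ContMDiffWithinAt (𝓘(ℝ, B).prod 𝓘(ℝ, F)) 𝓘(ℝ, B) ∞
      (fun z : TotalSpace F (Trivial B F) => φ.symm z.1) h.total.target z :=
    (h.smooth_symm z.1 hz).comp z h0.1.contMDiffWithinAt (fun y hy => hy)
  have h2 : ContMDiffAt (𝓘(ℝ, B).prod 𝓘(ℝ, F)) 𝓘(ℝ, F) ∞
      (fun z : TotalSpace F (Trivial B F) => (z.2 : F)) z := h0.2
  exact Θ.smooth_sec.contMDiffAt.comp_contMDiffWithinAt z (h1.prodMk h2.contMDiffWithinAt)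

/-- The local isomorphism with the linear model given by coordinates and a frame in which the
structure functions are linear. -/
def localIso (h : A.IsLinearInFrame φ Θ aL rL lL) : A.LocalIso (linearModel aL rL lL) where
  base := φ
  total :=
    { h.total with
      open_source := φ.open_source.preimage (FiberBundle.continuous_proj F V)
      open_target := φ.open_target.preimage (FiberBundle.continuous_proj F (Trivial B F))
      continuousOn_toFun := h.contMDiffOn_total.continuousOn
      continuousOn_invFun := h.contMDiffOn_total_symm.continuousOn }
  fiber q := Θ.coeff q
  total_source := rfl
  total_target := rfl
  total_apply _ _ _ := rfl
  smooth_base := h.smooth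
  smooth_base_symm := h.smooth_symm
  smooth_total := h.contMDiffOn_total
  smooth_total_symm := h.contMDiffOn_total_symm
  anchor_comm q hq e := by
    have h1 := h.anchor q hq (Θ.coeff q e)
    rw [Θ.sec_coeff q (h.source_subset hq)] at h1
    exact h1.symm
  coanchor_comm q hq ξ e₁ e₂ := by
    have h1 := h.coanchor q hq ξ (Θ.coeff q e₁) (Θ.coeff q e₂)
    rw [Θ.sec_coeff q (h.source_subset hq), Θ.sec_coeff q (h.source_subset hq)] at h1
    exact h1.symm
  bracket_comm q hq α β α' β' hα hβ :=
    h.coeff_bracket hq hα hβ ((contDiff_section α').differentiable (by simp) _)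
      ((contDiff_section β').differentiable (by simp) _)

end IsLinearInFrame

end LinearInFrame

end AlmostLodayAlgebroid

/-! ### Linearizability from Euler coordinates and a commuting frame -/

namespace LodayAlgebroid

section Linearizable

variable {B : Type*} [NormedAddCommGroup B] [NormedSpace ℝ B]
  {M : Type*} [TopologicalSpace M] [ChartedSpace B M] [IsManifold 𝓘(ℝ, B) ∞ M]
  {F : Type*} [NormedAddCommGroup F] [NormedSpace ℝ F]
  {V : M → Type*} [TopologicalSpace (TotalSpace F V)] [∀ x, TopologicalSpace (V x)]
  [∀ x, AddCommGroup (V x)] [∀ x, Module ℝ (V x)] [FiberBundle F V] [VectorBundle ℝ F V]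
variable [FiniteDimensional ℝ B] [FiniteDimensional ℝ F] [T2Space M]
  [ContMDiffVectorBundle ∞ F V 𝓘(ℝ, B)]

/-- A Lie or Courant algebroid is linearizable around a zero `p` of the anchor if there are a
section `α` such that `ρ(α)` is the Euler vector field of some coordinates, and a frame that
commutes with `α`. -/
lemma isLinearizableAt_of_eulerChart (A : LodayAlgebroid B F V) (hA : A.IsLie ∨ A.IsCourant)
    {p : M} (hp : ∀ e : V p, A.anchor p e = 0) {α : SmoothSection B F V}
    (φ : EulerChart (fun q => A.anchor q (α q)) p) (Θ : LocalFrame B F V p)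
    (hφΘ : φ.base.source ⊆ Θ.domain)
    (hα : ∀ q ∈ φ.base.source, ∀ w, A.bracket α (Θ.sec w) q = 0)
    (hΘp : ∀ e, Θ.coeff p e = VectorBundle.continuousLinearEquivAt ℝ F V p e) :
    A.toAlmostLodayAlgebroid.IsLinearizableAt p := by
  let τ : V p ≃ₗ[ℝ] F := (VectorBundle.continuousLinearEquivAt ℝ F V p).toLinearEquiv
  have hsec : ∀ w, Θ.sec w p = τ.symm w := fun w => by
    rw [LinearEquiv.eq_symm_apply]
    exact (hΘp _).symm.trans (Θ.coeff_sec p Θ.mem_domain w)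
  -- At p the frame is that of the preferred trivialization and φ has the identity as differential,
  -- so the constants found are literally the data of `linearization`.
  refine ⟨AlmostLodayAlgebroid.IsLinearInFrame.localIso (φ := φ.base) (Θ := Θ)
    { source_subset := hφΘ
      smooth := φ.smooth_base
      smooth_symm := φ.smooth_base_symm
      bracket := fun q hq u w => ?_
      anchor := fun q hq w => ?_
      coanchor := fun q hq ξ u w => ?_ }, φ.mem_source, φ.base_apply⟩
  · rw [A.coeff_bracket_sec φ Θ hA hp hφΘ hα hq, hsec, hsec]
    exact hΘp _
  · rw [A.vectorDifferential_anchor_sec φ Θ hp hφΘ hα hq, hsec]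
    rfl
  · rw [A.coeff_coanchor_sec φ Θ hA hp hφΘ hα hq, hsec, hsec]
    exact hΘp _

end Linearizable

end LodayAlgebroid

/-! ### Existence of Euler coordinates on the manifold -/

section EulerCoordinates

variable {B : Type*} [NormedAddCommGroup B] [NormedSpace ℝ B]
  {M : Type*} [TopologicalSpace M] [ChartedSpace B M] [IsManifold 𝓘(ℝ, B) ∞ M]
  {F : Type*} [NormedAddCommGroup F] [NormedSpace ℝ F]
  {V : M → Type*} [TopologicalSpace (TotalSpace F V)] [∀ x, TopologicalSpace (V x)]
  [∀ x, AddCommGroup (V x)] [∀ x, Module ℝ (V x)] [FiberBundle F V] [VectorBundle ℝ F V]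
variable (B) in
/-- The preferred chart at `p`, translated so that it takes `p` to `0`. -/
lemma exists_centered_chart (p : M) : ∃ ψ : OpenPartialHomeomorph M B,
    ψ.source = (chartAt B p).source ∧ ψ p = 0 ∧ ContMDiffOn 𝓘(ℝ, B) 𝓘(ℝ, B) ∞ ψ ψ.source ∧
      ContMDiffOn 𝓘(ℝ, B) 𝓘(ℝ, B) ∞ ψ.symm ψ.target ∧
      ∀ q ∈ ψ.source, vectorDifferential (B := B) ψ q =
        vectorDifferential (extChartAt 𝓘(ℝ, B) p) q := by
  let x₀ : B := chartAt B p p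
  let ψ := (chartAt B p).transHomeomorph (Homeomorph.subRight x₀)
  have h1 : ∀ q, ψ q = chartAt B p q - x₀ := fun q => rfl
  refine ⟨ψ, rfl, sub_self x₀, ?_, ?_, fun q hq => ?_⟩
  · exact (contMDiffOn_chart (I := 𝓘(ℝ, B)) (n := ∞) (x := p)).sub contMDiffOn_const
  · have h2 : ContMDiffOn 𝓘(ℝ, B) 𝓘(ℝ, B) ∞ (fun y : B => y + x₀) ψ.target :=
      (contDiff_id.add contDiff_const).contMDiff.contMDiffOn
    exact (contMDiffOn_chart_symm (I := 𝓘(ℝ, B)) (n := ∞) (x := p)).comp h2 fun y hy => hy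
  · have h3 : DifferentiableAt ℝ (fun y : B => y - x₀) (extChartAt 𝓘(ℝ, B) p q) :=
      differentiableAt_id.sub_const _
    refine (vectorDifferential_comp h3 (mdifferentiableAt_extChartAt hq)).trans ?_
    rw [fderiv_sub_const]
    exact (congrArg (fun T : B →L[ℝ] B => T ∘L vectorDifferential (extChartAt 𝓘(ℝ, B) p) q)
      fderiv_fun_id).trans (ContinuousLinearMap.id_comp _)

variable [FiniteDimensional ℝ B] [T2Space M]

/-- A vector field whose linear part at `p` is the identity is the Euler vector field of suitable
coordinates. -/
lemma exists_euler_coordinates {p : M}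
    (X : SmoothSection B B (TangentSpace 𝓘(ℝ, B) : M → Type _)) (hX0 : X p = 0)
    (hX : sectionLinearPart B B (TangentSpace 𝓘(ℝ, B) : M → Type _) p X = LinearMap.id) :
    ∃ φ : OpenPartialHomeomorph M B, p ∈ φ.source ∧ φ p = 0 ∧
      ContMDiffOn 𝓘(ℝ, B) 𝓘(ℝ, B) ∞ φ φ.source ∧
      ContMDiffOn 𝓘(ℝ, B) 𝓘(ℝ, B) ∞ φ.symm φ.target ∧
      (∀ w : Tan B p, vectorDifferential φ p w = w) ∧
      ∀ q ∈ φ.source, vectorDifferential φ q (X q) = φ q := by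
  obtain ⟨ψ, hs, hψ0, hψ, hψ', hd⟩ := exists_centered_chart B p
  have hps : p ∈ ψ.source := hs ▸ mem_chart_source B p
  have hmd : ∀ q ∈ ψ.source, MDifferentiableAt 𝓘(ℝ, B) 𝓘(ℝ, B) ψ q := fun q hq =>
    ((hψ q hq).contMDiffAt (ψ.open_source.mem_nhds hq)).mdifferentiableAt (by simp)
  have hdp : ∀ w : Tan B p, vectorDifferential ψ p w = w := fun w => by
    rw [hd p hps]
    exact congrArg (fun T : Tan B p →L[ℝ] B => T w) (mfderiv_extChartAt_self (I := 𝓘(ℝ, B)))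
  let e := trivializationAt B (TangentSpace 𝓘(ℝ, B) : M → Type _) p
  let g : M → B := fun q => (e ⟨q, X q⟩).2
  have hg : ∀ q ∈ ψ.source, g q = vectorDifferential ψ q (X q) := fun q hq => by
    rw [hd q hq]; exact trivializationAt_tangent_apply (hs ▸ hq) _
  -- Y is the vector field X read in the centered chart.
  let Y : B → B := fun y => g (ψ.symm y)
  have h0t : (0 : B) ∈ ψ.target := hψ0 ▸ ψ.map_source hps
  have hY : ∀ y ∈ ψ.target, ContDiffAt ℝ ∞ Y y := fun y hy => by
    have h1 : ContMDiffAt 𝓘(ℝ, B) 𝓘(ℝ, B) ∞ g (ψ.symm y) :=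
      (e.contMDiffAt_section_iff (by
        have := ψ.map_target hy
        rw [hs] at this
        simpa [e] using this)).1 (X.contMDiff _)
    exact contMDiffAt_iff_contDiffAt.1
      (h1.comp y ((hψ' y hy).contMDiffAt (ψ.open_target.mem_nhds hy)))
  have hYψ : ∀ q ∈ ψ.source, Y (ψ q) = vectorDifferential ψ q (X q) := fun q hq => by
    change g (ψ.symm (ψ q)) = _
    rw [ψ.left_inv hq, hg q hq]
  have hY0 : Y 0 = 0 := by
    rw [← hψ0, hYψ p hps, hX0, map_zero, hψ0]
  have hYd : fderiv ℝ Y 0 = .id ℝ B := by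
    ext w
    have h1 : g =ᶠ[𝓝 p] fun q => Y (ψ q) := by
      filter_upwards [ψ.open_source.mem_nhds hps] with q hq
      rw [hYψ q hq, hg q hq]
    have h2 : vectorDifferential (B := B) g p = fderiv ℝ Y 0 ∘L vectorDifferential ψ p := by
      rw [vectorDifferential_congr h1, vectorDifferential_comp
        ((hY _ (ψ.map_source hps)).differentiableAt (by simp)) (hmd p hps), hψ0]
    -- The linear part of X is the differential of g followed by the inverse of the tangent
    -- trivialization at p. This trivialization is the differential of the chart, the identity at p,
    -- so `hX` carries over to g.
    have h3 : vectorDifferential (B := B) g p w = w := by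
      let τ := VectorBundle.continuousLinearEquivAt ℝ B (TangentSpace 𝓘(ℝ, B) : M → Type _) p
      have h4 : τ.symm (vectorDifferential (B := B) g p w) = w :=
        congrArg (fun T : Tan B p →ₗ[ℝ] Tan B p => T w) hX
      refine ((ContinuousLinearEquiv.symm_apply_eq τ).1 h4).trans ?_
      refine (trivializationAt_tangent_apply (mem_chart_source B p) w).trans ?_
      rw [← hd p hps]
      exact hdp w
    have h5 := congrArg (fun T : Tan B p →L[ℝ] B => T w) h2
    refine Eq.trans ?_ (h5.symm.trans h3)
    exact congrArg (fderiv ℝ Y 0) (hdp w).symm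
  obtain ⟨η, h0η, hη0, hη, hη', hηd, hηX⟩ := exists_euler_chart
    (eventually_of_mem (ψ.open_target.mem_nhds h0t) hY) hY0 hYd
  have hηm : ∀ y ∈ η.source, DifferentiableAt ℝ η y := fun y hy =>
    ((hη y hy).contDiffAt (η.open_source.mem_nhds hy)).differentiableAt (by simp)
  have hφd : ∀ q ∈ (ψ.trans η).source, vectorDifferential (ψ.trans η) q =
      fderiv ℝ η (ψ q) ∘L vectorDifferential ψ q := fun q hq =>
    vectorDifferential_comp (hηm _ hq.2) (hmd q hq.1)
  have hpη : p ∈ (ψ.trans η).source := ⟨hps, by change ψ p ∈ η.source; rw [hψ0]; exact h0η⟩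
  refine ⟨ψ.trans η, hpη, ?_, ?_, ?_, fun w => ?_, fun q hq => ?_⟩
  · change η (ψ p) = 0
    rw [hψ0, hη0]
  · exact hη.contMDiffOn.comp (hψ.mono fun q hq => hq.1) fun q hq => hq.2
  · exact hψ'.comp (hη'.contMDiffOn.mono fun y hy => hy.1) fun y hy => hy.2
  · rw [hφd p hpη, hψ0, hηd]
    exact hdp w
  · rw [hφd q hq]
    change fderiv ℝ η (ψ q) (vectorDifferential ψ q (X q)) = η (ψ q)
    rw [← hYψ q hq.1]
    exact hηX _ hq.2

/-- Euler coordinates may be shrunk into a neighbourhood of `p`. -/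
lemma exists_eulerChart {X : ∀ q : M, Tan B q} {p : M} {φ : OpenPartialHomeomorph M B}
    (hp : p ∈ φ.source) (hφp : φ p = 0) (hφ : ContMDiffOn 𝓘(ℝ, B) 𝓘(ℝ, B) ∞ φ φ.source)
    (hφ' : ContMDiffOn 𝓘(ℝ, B) 𝓘(ℝ, B) ∞ φ.symm φ.target)
    (hφd : ∀ w : Tan B p, vectorDifferential φ p w = w)
    (hX : ∀ q ∈ φ.source, vectorDifferential φ q (X q) = φ q) {S : Set M} (hS : S ∈ 𝓝 p) :
    ∃ η : EulerChart X p, η.base.source ⊆ S := by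
  obtain ⟨χ, hχ, hχs⟩ := exists_smoothFun_tsupport_subset (B := B) (φ.open_source.mem_nhds hp)
  have h0 : (0 : B) ∈ φ.target := hφp ▸ φ.map_source hp
  have hs0 : φ.symm 0 = p := by rw [← hφp, φ.left_inv hp]
  -- The radius is chosen so that the ball corresponds to points of S where χ = 1; there the cut-off
  -- coordinate functions agree with the components of φ.
  have h1 : φ.target ∩ φ.symm ⁻¹' (S ∩ {q | χ q = 1}) ∈ 𝓝 (0 : B) :=
    inter_mem (φ.open_target.mem_nhds h0)
      ((φ.symm.continuousAt h0).preimage_mem_nhds (by rw [hs0]; exact inter_mem hS hχ))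
  obtain ⟨r, hr, hrs⟩ := Metric.mem_nhds_iff.1 h1
  let η := (φ.symm.restrOpen (Metric.ball 0 r) Metric.isOpen_ball).symm
  have hηt : η.target = Metric.ball 0 r := by
    change φ.target ∩ Metric.ball 0 r = _
    exact Set.inter_eq_right.2 fun y hy => (hrs hy).1
  have hηs : ∀ q ∈ η.source, q ∈ φ.source ∧ q ∈ S ∧ χ q = 1 := fun q hq => by
    have h2 : φ q ∈ Metric.ball (0 : B) r := hηt ▸ η.map_source hq
    have h3 : q ∈ φ.source := by
      have := hq
      simp [η] at this
      exact this.1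
    have h4 := (hrs h2).2
    rw [Set.mem_preimage, φ.left_inv h3] at h4
    exact ⟨h3, h4⟩
  refine ⟨
    { base := η
      radius := r
      mem_source := by simp [η, hp, hφp, hr]
      base_apply := hφp
      target_eq := hηt
      smooth_base := hφ.mono fun q hq => (hηs q hq).1
      smooth_base_symm := hφ'.mono fun y hy => hy.1
      vectorDifferential_base := hφd
      euler := fun q hq => hX q (hηs q hq).1
      coord := fun ξ => ⟨fun q => χ q * ξ (φ q), contMDiff_of_tsupport fun q hq => ?_⟩
      coord_apply := fun q hq ξ => ?_ }, fun q hq => (hηs q hq).2.1⟩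
  · have hq' : q ∈ φ.source := hχs (tsupport_mul_subset_left hq)
    exact (χ.contMDiff q).mul (ξ.contMDiff.contMDiffAt.comp q
      ((hφ q hq').contMDiffAt (φ.open_source.mem_nhds hq')))
  · change χ q * ξ (φ q) = ξ (φ q)
    rw [(hηs q hq).2.2, one_mul]

end EulerCoordinates

/-! ### Existence of a frame that commutes with α -/

namespace AlmostLodayAlgebroid

section CommutingFrame

variable {B : Type*} [NormedAddCommGroup B] [NormedSpace ℝ B]
  {M : Type*} [TopologicalSpace M] [ChartedSpace B M] [IsManifold 𝓘(ℝ, B) ∞ M]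
  {F : Type*} [NormedAddCommGroup F] [NormedSpace ℝ F]
  {V : M → Type*} [TopologicalSpace (TotalSpace F V)] [∀ x, TopologicalSpace (V x)]
  [∀ x, AddCommGroup (V x)] [∀ x, Module ℝ (V x)] [FiberBundle F V] [VectorBundle ℝ F V]
variable [FiniteDimensional ℝ B] [FiniteDimensional ℝ F] [T2Space M]
  [ContMDiffVectorBundle ∞ F V 𝓘(ℝ, B)]

/-- The matrix of `[α, ·]` in the frame `Θ`, as a function of the coordinates `φ`. -/
def bracketMatrix (A : AlmostLodayAlgebroid B F V) {p : M} (Θ : LocalFrame B F V p)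
    (φ : OpenPartialHomeomorph M B) (α : SmoothSection B F V) (y : B) : F →L[ℝ] F :=
  LinearMap.toContinuousLinearMap
    { toFun := fun w => Θ.coeff (φ.symm y) (A.bracket α (Θ.sec w) (φ.symm y))
      map_add' := fun u w => by
        rw [map_add, map_add]; exact map_add (Θ.coeff _) _ _
      map_smul' := fun c w => by
        rw [map_smul, map_smul]; exact map_smul (Θ.coeff _) _ _ }

lemma bracketMatrix_apply (A : AlmostLodayAlgebroid B F V) {p : M} (Θ : LocalFrame B F V p)
    (φ : OpenPartialHomeomorph M B) (α : SmoothSection B F V) (y : B) (w : F) :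
    A.bracketMatrix Θ φ α y w = Θ.coeff (φ.symm y) (A.bracket α (Θ.sec w) (φ.symm y)) := rfl

lemma contDiffAt_bracketMatrix (A : AlmostLodayAlgebroid B F V) {p : M} (Θ : LocalFrame B F V p)
    {φ : OpenPartialHomeomorph M B} (hφ' : ContMDiffOn 𝓘(ℝ, B) 𝓘(ℝ, B) ∞ φ.symm φ.target)
    (α : SmoothSection B F V) {y : B} (hy : y ∈ φ.target) (hyΘ : φ.symm y ∈ Θ.domain) :
    ContDiffAt ℝ ∞ (A.bracketMatrix Θ φ α) y := by
  have hS : IsOpen (φ.target ∩ φ.symm ⁻¹' Θ.domain) :=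
    φ.symm.isOpen_inter_preimage Θ.isOpen_domain
  refine ContDiffOn.contDiffAt (contDiffOn_clm_apply.2 fun w => ?_) (hS.mem_nhds ⟨hy, hyΘ⟩)
  rw [← contMDiffOn_iff_contDiffOn]
  have h1 := (A.bracket α (Θ.sec w)).contMDiff.comp_contMDiffOn
    (hφ'.mono (Set.inter_subset_left (t := φ.symm ⁻¹' Θ.domain)))
  exact Θ.smooth_coeff.comp h1 fun z hz => hz.2

/-- If `ρ(α)` is the Euler vector field of the coordinates `φ` and `[α, ·]` vanishes at `p`, then
there is a frame around `p` that commutes with `α`. -/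
lemma exists_commuting_frame (A : AlmostLodayAlgebroid B F V) {p : M} {α : SmoothSection B F V}
    {φ : OpenPartialHomeomorph M B} (hp : p ∈ φ.source) (hφp : φ p = 0)
    (hφ : ContMDiffOn 𝓘(ℝ, B) 𝓘(ℝ, B) ∞ φ φ.source)
    (hφ' : ContMDiffOn 𝓘(ℝ, B) 𝓘(ℝ, B) ∞ φ.symm φ.target)
    (hX : ∀ q ∈ φ.source, vectorDifferential φ q (A.anchor q (α q)) = φ q)
    (hα : ∀ β, A.bracket α β p = 0) :
    ∃ Θ : LocalFrame B F V p,
      (∀ e, Θ.coeff p e = VectorBundle.continuousLinearEquivAt ℝ F V p e) ∧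
      ∀ᶠ q in 𝓝 p, ∀ w, A.bracket α (Θ.sec w) q = 0 := by
  have := FiniteDimensional.complete ℝ F
  obtain ⟨Θ₀, hΘ₀⟩ := exists_localFrame_trivializationAt B F V p
  have h0t : (0 : B) ∈ φ.target := hφp ▸ φ.map_source hp
  have hs0 : φ.symm 0 = p := by rw [← hφp, φ.left_inv hp]
  have hφc : ContinuousAt φ p := φ.continuousAt hp
  have ha : ∀ᶠ y in 𝓝 (0 : B), ContDiffAt ℝ ∞ (A.bracketMatrix Θ₀ φ α) y := by
    filter_upwards [φ.open_target.mem_nhds h0t, (φ.symm.continuousAt h0t).preimage_mem_nhds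
      (by rw [hs0]; exact Θ₀.isOpen_domain.mem_nhds Θ₀.mem_domain)] with y hy hyΘ
    exact A.contDiffAt_bracketMatrix Θ₀ hφ' α hy hyΘ
  have ha0 : A.bracketMatrix Θ₀ φ α 0 = 0 := by
    ext w
    rw [bracketMatrix_apply, hs0, hα, map_zero]; rfl
  -- A section with components b(φ) in the frame `Θ₀` has a bracket with α whose components at y =
  -- φ(q) are a(y) b(y) + db(y) y. For b = k w this vanishes exactly when dk(y) y = -a(y) k(y) on w.
  obtain ⟨k, hk, hk0, hkE⟩ := exists_euler_frame ha ha0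
  have hpull : ∀ {P : B → Prop}, (∀ᶠ y in 𝓝 0, P y) → ∀ᶠ q in 𝓝 p, P (φ q) := fun h => by
    rw [← hφp] at h
    exact hφc.eventually h
  have hkinv : ∀ᶠ y in 𝓝 (0 : B), (k y).IsInvertible := by
    have h1 : (Set.range ((↑) : (F ≃L[ℝ] F) → F →L[ℝ] F)) ∈ 𝓝 (k 0) := by
      rw [hk0]; exact ContinuousLinearEquiv.nhds (.refl ℝ F)
    exact hk.self_of_nhds.continuousAt.preimage_mem_nhds h1
  obtain ⟨Θ, hΘ⟩ := exists_localFrame V (p := p) (K := fun q => k (φ q))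
    (by
      filter_upwards [hpull hk, φ.open_source.mem_nhds hp] with q hq hqs
      exact hq.contMDiffAt.comp q ((hφ q hqs).contMDiffAt (φ.open_source.mem_nhds hqs)))
    (hpull hkinv)
  refine ⟨Θ, fun e => ?_, ?_⟩
  · rw [(hΘ p Θ.mem_domain).2.2.2.1, hφp, hk0, ContinuousLinearMap.inverse_id]
    rfl
  have hcoeff : ∀ᶠ q in 𝓝 p, ∀ w, Θ₀.coeff q (Θ.sec w q) = k (φ q) w := by
    filter_upwards [Θ.eventually_mem Θ.mem_domain, Θ₀.eventually_mem Θ₀.mem_domain]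
      with q hq hq0 w
    rw [(hΘ q hq).2.2.2.2, ← (hΘ₀ q hq0).2.2, Θ₀.coeff_sec q hq0]
  filter_upwards [eventually_eventually_nhds.2 hcoeff, Θ₀.eventually_mem Θ₀.mem_domain,
    hpull hk, hpull hkE, φ.open_source.mem_nhds hp] with q hcq hq0 hkq hkEq hqs w
  have hkd : DifferentiableAt ℝ k (φ q) := hkq.differentiableAt (by simp)
  have hkd' : HasFDerivAt (fun y => k y w) 
      (ContinuousLinearMap.apply ℝ F w ∘L fderiv ℝ k (φ q)) (φ q) :=
    (ContinuousLinearMap.apply ℝ F w).hasFDerivAt.comp (φ q) hkd.hasFDerivAt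
  have h1 := A.coeff_bracket_right Θ₀ hq0
    (((hφ q hqs).contMDiffAt (φ.open_source.mem_nhds hqs)).mdifferentiableAt (by simp)) α
    (β := Θ.sec w) (b := fun y => k y w) (hcq.mono fun r hr => hr w) hkd'.differentiableAt
  have h2 : ∑ i, (finBasis ℝ F).coord i (k (φ q) w) •
      Θ₀.coeff q (A.bracket α (Θ₀.sec (finBasis ℝ F i)) q) =
      A.bracketMatrix Θ₀ φ α (φ q) (k (φ q) w) := by
    conv_rhs => rw [← (finBasis ℝ F).sum_repr (k (φ q) w), map_sum]
    refine Finset.sum_congr rfl fun i _ => ?_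
    rw [map_smul, bracketMatrix_apply, φ.left_inv hqs]
    rfl
  have h3 : Θ₀.coeff q (A.bracket α (Θ.sec w) q) = 0 := by
    rw [h1, h2, hX q hqs, hkd'.fderiv, ContinuousLinearMap.comp_apply,
      ContinuousLinearMap.apply_apply, hkEq]
    exact add_neg_cancel _
  rw [← Θ₀.sec_coeff q hq0 (A.bracket α (Θ.sec w) q), h3, map_zero]
  rfl

end CommutingFrame

end AlmostLodayAlgebroid

end

theorem mainTheorem4
    {B : Type*} [NormedAddCommGroup B] [NormedSpace ℝ B] [FiniteDimensional ℝ B]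
    {M : Type*} [TopologicalSpace M] [T2Space M] [ChartedSpace B M] [IsManifold 𝓘(ℝ, B) ∞ M]
    {F : Type*} [NormedAddCommGroup F] [NormedSpace ℝ F] [FiniteDimensional ℝ F]
    {V : M → Type*} [TopologicalSpace (TotalSpace F V)] [∀ x, TopologicalSpace (V x)]
    [∀ x, AddCommGroup (V x)] [∀ x, Module ℝ (V x)] [FiberBundle F V] [VectorBundle ℝ F V]
    [ContMDiffVectorBundle ∞ F V 𝓘(ℝ, B)]
    (A : LodayAlgebroid B F V) (hA : A.IsLie ∨ A.IsCourant)
    (p : M) (hp : ∀ e : V p, A.anchor p e = 0)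
    (v : A.Isotropy hA p hp) (hv : v ∈ LieAlgebra.center ℝ (A.Isotropy hA p hp))
    (hid : A.isotropyAction hA p hp v = LinearMap.id) :
    A.toAlmostLodayAlgebroid.IsLinearizableAt p := by
  let α := extSection B F V p v
  have hαp : α p = v := extSection_self p v
  -- By definition ρ^L(v) is the linear part of ρ(α) for this very extension α, so `hid` is the
  -- hypothesis on the linear part.
  obtain ⟨φ, hpφ, hφp, hφ, hφ', hφd, hX⟩ := exists_euler_coordinates (A.anchorSection α) (hp _) hid
  have hα : ∀ β, A.bracket α β p = 0 := fun β => by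
    rw [A.bracket_apply hA hp, hαp]
    let u : A.Isotropy hA p hp := β p
    have h1 : ⁅u, v⁆ = 0 := (LieModule.mem_maxTrivSubmodule ℝ _ _ v).1 hv u
    -- Centrality is stated with v in the second slot; skew-symmetry in the isotropy algebra moves
    -- it to the first.
    rw [← lie_skew, neg_eq_zero] at h1
    exact h1
  obtain ⟨Θ, hΘp, hΘ⟩ := A.exists_commuting_frame hpφ hφp hφ hφ' hX hα
  obtain ⟨η, hη⟩ := exists_eulerChart hpφ hφp hφ hφ' hφd hX
    (hΘ.and (Θ.eventually_mem Θ.mem_domain))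
  exact A.isLinearizableAt_of_eulerChart hA hp η Θ (fun q hq => (hη hq).2)
    (fun q hq => (hη hq).1) hΘp
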